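/- **Marked Poisson point processes.** Let $\mathbb M$ be the space of Borel simple point measures on $\mathbb R$ (counting measures of locally finite subsets of $\mathbb R$), with the $\sigma$-algebra generated by the maps $\mu\mapsto\mu(B)$, $B$ Borel. For $t\in\mathbb R$ let $T_t\mu(B)=\mu(B-t)$. For $\mu\in\mathbb M$ enumerate its points in increasing order as $(p_i)$, where $p_0$ is the last point in $(-\infty,0]$ (for measures with finitely many points on one side of the origin, the indices form an interval of $\mathbb Z$). For $(\mu,x)\in\mathbb M\times A^{\mathbb Z}$ the point $p_i$ carries the mark $x_i$, and translations preserve marks: $T_t(\mu,x)=(T_t\mu,\sigma^n x)$, where $(\sigma x)_i=x_{i+1}$ and $n$ is the index of the last point of $\mu$ in $(-\infty,-t]$. (If there is no such point, $n$ is given by the same count: $n=\mu((0,-t])$ for $t\le 0$ and $n=-\mu((-t,0])$ for $t\ge 0$.) Two measures agree on an interval $I$ if their restrictions to $I$ coincide. Write $P_r$ for the law on $\mathbb M$ of a homogeneous Poisson point process of intensity $r$. Let $(A,\alpha)$ be a standard probability space (a standard Borel space with a probability measure). There exist a measurable map $\psi:\mathbb M\to\mathbb M\times A^{\mathbb Z}$,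 written $\psi(\mu)=(\psi(\mu)_1,\psi(\mu)_2)$, and a measurable map $\psi^{-1}:\mathbb M\times A^{\mathbb Z}\to\mathbb M$, such that $\psi$ is translation-equivariant, $\psi\circ T_t=T_t\circ\psi$ for all $t\in\mathbb R$, and the following hold for every $r>0$. (a) If $\Pi$ is a Poisson point process on $\mathbb R$ of intensity $r$, then $\psi(\Pi)_1$ is a Poisson point process on $\mathbb R$ of intensity $r$, and $\psi(\Pi)_2$ has law $\alpha^{\mathbb Z}$. (b) $\psi(\Pi)_1$ and $\psi(\Pi)_2$ are independent. (c) $\psi$ is injective on a set of full $P_r$-measure, and $\psi^{-1}$ is its almost sure inverse: $\psi^{-1}(\psi(\mu))=\mu$ for $P_r$-almost every $\mu$, and $\psi(\psi^{-1}(\mu,x))=(\mu,x)$ for $P_r\times\alpha^{\mathbb Z}$-almost every $(\mu,x)$. (d) $\psi$ is finitary: there is $w:\mathbb M\to\mathbb N\cup\{\infty\}$, finite $P_r$-almost surely, such that whenever $\mu,\mu'\in\mathbb M$ agree on $(-w(\mu),w(\mu))$, the measures $\psi(\mu)_1$ and $\psi(\mu')_1$ agree on $(-1,1)$, and their points in $(-1,1)$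 have the same marks under $\psi(\mu)$ and $\psi(\mu')$. (e) $\psi^{-1}$ is finitary: there is $w:\mathbb M\times A^{\mathbb Z}\to\mathbb N\cup\{\infty\}$, finite $P_r\times\alpha^{\mathbb Z}$-almost surely, such that whenever $\mu,\mu'$ agree on $(-w(\mu,x),w(\mu,x))$ and $x_i=x'_i$ for all integers $i\in(-w(\mu,x),w(\mu,x))$, the measures $\psi^{-1}(\mu,x)$ and $\psi^{-1}(\mu',x')$ agree on $(-1,1)$. -/

import Mathlib

open MeasureTheory ProbabilityTheory Set
open scoped ENNReal NNReal

noncomputable section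

namespace MarkedPoisson

/-- `μ` is a simple point measure on `ℝ`: it counts the points of a locally finite set `S`. -/
def IsSimplePointMeasure (μ : Measure ℝ) : Prop :=
  ∃ S : Set ℝ, (∀ a b : ℝ, (S ∩ Icc a b).Finite) ∧
    ∀ B : Set ℝ, MeasurableSet B → μ B = ((S ∩ B).encard : ℝ≥0∞)

/-- The space `𝕄` of Borel simple point measures on `ℝ`. Its σ-algebra is the usual one,
generated by the evaluations `μ ↦ μ B` at Borel sets `B`. -/
def PointMeasure : Type := {μ : Measure ℝ // IsSimplePointMeasure μ}

instance : MeasurableSpace PointMeasure :=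
  inferInstanceAs (MeasurableSpace {μ : Measure ℝ // IsSimplePointMeasure μ})

/-- The set of points of a point measure. -/
def PointMeasure.points (μ : PointMeasure) : Set ℝ := {p | μ.1 {p} ≠ 0}

/-- `μ` and `μ'` have the same restriction to `I`. -/
def PointMeasure.AgreeOn (μ μ' : PointMeasure) (I : Set ℝ) : Prop :=
  μ.1.restrict I = μ'.1.restrict I

theorem IsSimplePointMeasure.map_add {μ : Measure ℝ} (h : IsSimplePointMeasure μ) (t : ℝ) :
    IsSimplePointMeasure (μ.map (fun s => s + t)) := by
  obtain ⟨S, hS, hμ⟩ := h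
  have hm : Measurable (fun s : ℝ => s + t) := by fun_prop
  have hi : Function.Injective (fun s : ℝ => s + t) := add_left_injective t
  refine ⟨(fun s => s + t) '' S, fun a b => ?_, fun B hB => ?_⟩
  · refine ((hS (a - t) (b - t)).image (fun s => s + t)).subset ?_
    rintro _ ⟨⟨s, hs, rfl⟩, h1, h2⟩
    exact ⟨s, ⟨hs, by simp only at h1; linarith, by simp only at h2; linarith⟩, rfl⟩
  · rw [Measure.map_apply hm hB, hμ _ (hm hB), ← image_inter_preimage, hi.encard_image]

/-- The translation `T_t` on `𝕄`, `(T_t μ)(B) = μ(B - t)`: every point `p` is moved to `p + t`. -/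
def PointMeasure.translate (t : ℝ) (μ : PointMeasure) : PointMeasure :=
  ⟨μ.1.map (fun s => s + t), μ.2.map_add t⟩

/-- If the points of `μ` are enumerated in increasing order as `(p_i)` with `p_0` the last point
in `(-∞, 0]`, then `μ.label s` is the index of the last point in `(-∞, s]`. In particular
`μ.label p_i = i`. (One of the two counts is always zero. The counts make sense also when `μ` has
only finitely many points on a side of the origin: the enumeration then is by an interval
of integers.) -/
def PointMeasure.label (μ : PointMeasure) (s : ℝ) : ℤ :=
  ((μ.points ∩ Ioc 0 s).ncard : ℤ) - ((μ.points ∩ Ioc s 0).ncard : ℤ)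

variable {A : Type*}

/-- The mark of the point `p` in `(μ, x)`: the point `p_i` carries the mark `x_i`. -/
def mark (y : PointMeasure × (ℤ → A)) (p : ℝ) : A := y.2 (y.1.label p)

/-- The translation `T_t (μ, x) = (T_t μ, σ^n x)`, with `σ` the left shift and `n` the index of
the point `p_n` of `μ` for which `p_n + t` is the last point of `T_t μ` in `(-∞, 0]`,
i.e. `p_n` is the last point of `μ` in `(-∞, -t]`. -/
def translateMarked (t : ℝ) (y : PointMeasure × (ℤ → A)) : PointMeasure × (ℤ → A) :=
  (y.1.translate t, fun i => y.2 (i + y.1.label (-t)))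

/-- The point measures agree on `I`, and so do the marks of their points in `I`. -/
def MarkedAgreeOn (y y' : PointMeasure × (ℤ → A)) (I : Set ℝ) : Prop :=
  y.1.AgreeOn y'.1 I ∧ ∀ p ∈ y.1.points ∩ I, mark y p = mark y' p

/-- The open interval `(-w, w)`, which is `ℝ` for `w = ∞`. -/
def window (w : ℕ∞) : Set ℝ := {s | ENNReal.ofReal |s| < (w : ℝ≥0∞)}

/-- `w` is a coding window of `ψ : 𝕄 → 𝕄 × A^ℤ`. -/
def IsCodingWindow (ψ : PointMeasure → PointMeasure × (ℤ → A)) (w : PointMeasure → ℕ∞) : Prop :=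
  ∀ μ μ' : PointMeasure, μ.AgreeOn μ' (window (w μ)) →
    MarkedAgreeOn (ψ μ) (ψ μ') (Ioo (-1) 1)

/-- `w` is a coding window of `φ : 𝕄 × A^ℤ → 𝕄`. -/
def IsCodingWindowMarked (φ : PointMeasure × (ℤ → A) → PointMeasure)
    (w : PointMeasure × (ℤ → A) → ℕ∞) : Prop :=
  ∀ (μ μ' : PointMeasure) (x x' : ℤ → A), μ.AgreeOn μ' (window (w (μ, x))) →
    (∀ i : ℤ, (i : ℝ) ∈ window (w (μ, x)) → x i = x' i) →
    (φ (μ, x)).AgreeOn (φ (μ', x')) (Ioo (-1) 1)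

/-- `P` is the law `P_r` of a homogeneous Poisson point process on `ℝ` of intensity `r`: the number
of points in a Borel set of finite Lebesgue measure `|B|` is Poisson with mean `r|B|`, and
the numbers of points in disjoint Borel sets are independent. -/
structure IsPoissonLaw (r : ℝ≥0) (P : Measure PointMeasure) : Prop where
  isProbabilityMeasure : IsProbabilityMeasure P
  map_count : ∀ B : Set ℝ, MeasurableSet B → volume B < ∞ →
    P.map (fun μ => μ.1 B) =
      (poissonMeasure (r * (volume B).toNNReal)).map (fun k : ℕ => (k : ℝ≥0∞))
  iIndepFun_count : ∀ (n : ℕ) (B : Fin n → Set ℝ), (∀ i, MeasurableSet (B i)) →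
    Pairwise (fun i j => Disjoint (B i) (B j)) → iIndepFun (fun i μ => μ.1 (B i)) P

end MarkedPoisson

end

noncomputable section

namespace MarkedPoisson

/-! The randomness for the marks is taken from isolated triples `a < m < b`: three points within
distance one and no other point in `[a - 1, a + 2]`. Given all the other points, the middle point of
such a triple is uniform on `(a, b)`, so its relative position is a uniform variable `u`. The head
`a` is responsible for its block, the `k` points from `a` up to the next head. A uniform variable
has the same law as a uniform variable together with `k` independent samples of `α`, by an
isomorphism of atomless standard probability spaces (`Coding`). Encoding splits `u` in this way,
puts the middle point at the new uniform position and gives the `k` samples as marks to the points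
of the block.

The isolation condition forces heads to be more than two apart, and moving middle points inside
their triples changes neither the heads nor the block sizes (`isHead_move_iff`, `blkSize_move`). So
the image shows the same blocks, and the decoder recovers every `u` from the new position and the
marks of the block. This inversion, `decMap_encMap`, holds for every point measure. Nothing in the
construction refers to the origin or to the intensity, which gives equivariance and one map for all
`r`. Everything that happens between two heads is determined by the points around and the marks in
between, and almost surely there are heads in both directions (`IsPoissonLaw.ae_rich`), so both maps
are finitary.

The substance is the law of the image. Labels are shifted when a middle point crosses the origin and
block ends depend on other triples, so auxiliary iid marks are indexed by addresses instead: a unit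
cell, which contains at most one head, and a position in the block. Coding in a single cell
preserves the product of the Poisson law and the iid law (`IsPoissonLaw.map_partMap_singleton`): the
Mecke equation removes the middle point and puts it back uniformly. Iteration handles finitely many
cells, and all cells together follow because an event in a bounded window only notices finitely many
of them. Finally, given the points, passing from addresses to labels is an injective change of
indices, so the marks stay iid and independent of the points.

The other composition, encoding after decoding, is the identity on the range of the encoder, and
this range has full measure once the law is known. -/

/-- The set has finitely many points in each bounded interval. -/
def LocFin (S : Set ℝ) : Prop := ∀ a b : ℝ, (S ∩ Icc a b).Finite

/-- `a < m < b` is an isolated triple of points of `S`, of diameter at most one. -/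
def Trip (S : Set ℝ) (a m b : ℝ) : Prop :=
  a < m ∧ m < b ∧ b ≤ a + 1 ∧ S ∩ Icc (a - 1) (a + 2) = {a, m, b}

/-- `a` is the first point of an isolated triple. -/
def IsHead (S : Set ℝ) (a : ℝ) : Prop := ∃ m b, Trip S a m b

/-! ### Isolated triples and moves of their middle points. -/

section Triples

variable {S : Set ℝ} {a m b c : ℝ}

theorem Trip.isHead (h : Trip S a m b) : IsHead S a := ⟨m, b, h⟩

theorem Trip.mem_iff (h : Trip S a m b) {q : ℝ} (h1 : a - 1 ≤ q) (h2 : q ≤ a + 2) :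
    q ∈ S ↔ q = a ∨ q = m ∨ q = b := by
  have := h.2.2.2
  constructor
  · intro hq
    have : q ∈ S ∩ Icc (a - 1) (a + 2) := ⟨hq, h1, h2⟩
    rw [h.2.2.2] at this
    simpa using this
  · intro hq
    have : q ∈ S ∩ Icc (a - 1) (a + 2) := by
      rw [h.2.2.2]; simpa using hq
    exact this.1

theorem Trip.mem_left (h : Trip S a m b) : a ∈ S :=
  (h.mem_iff (by linarith) (by linarith)).2 (Or.inl rfl)

theorem Trip.mem_mid (h : Trip S a m b) : m ∈ S := by
  obtain ⟨h1, h2, h3, -⟩ := id h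
  exact (h.mem_iff (by linarith) (by linarith)).2 (Or.inr (Or.inl rfl))

theorem Trip.mem_right (h : Trip S a m b) : b ∈ S := by
  obtain ⟨h1, h2, h3, -⟩ := id h
  exact (h.mem_iff (by linarith) (by linarith)).2 (Or.inr (Or.inr rfl))

theorem IsHead.mem (h : IsHead S a) : a ∈ S := by
  obtain ⟨m, b, h⟩ := h
  exact h.mem_left

theorem Trip.eq_of_left {m' b' : ℝ} (h : Trip S a m b) (h' : Trip S a m' b') :
    m = m' ∧ b = b' := by
  obtain ⟨h1, h2, h3, -⟩ := id h
  obtain ⟨h1', h2', h3', -⟩ := id h'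
  have hm := (h.mem_iff (by linarith) (by linarith)).1 h'.mem_mid
  have hb := (h.mem_iff (by linarith) (by linarith)).1 h'.mem_right
  have hm' := (h'.mem_iff (by linarith) (by linarith)).1 h.mem_mid
  grind

/-- Heads are more than distance two apart. -/
theorem IsHead.add_two_lt (h : IsHead S a) (h' : IsHead S c) (hac : a < c) : a + 2 < c := by
  by_contra hc
  push Not at hc
  obtain ⟨m, b, h⟩ := h
  obtain ⟨m', b', h'⟩ := h'
  obtain ⟨h1, h2, h3, -⟩ := id h
  obtain ⟨h1', h2', h3', -⟩ := id h'
  -- If `a < c ≤ a + 2`, then `c` is `m` or `b`, hence `c ≤ a + 1`. This puts `a` into the window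
  -- `[c - 1, c + 2]`, whose points are all at least `c`.
  have hc' := (h.mem_iff (by linarith) (by linarith)).1 h'.mem_left
  have ha := (h'.mem_iff (q := a) (by grind) (by linarith)).1 h.mem_left
  grind

/-- Both heads lie within distance one to the left of the common middle point, which is too close
for two different heads. -/
theorem Trip.eq_of_mid {a' b' : ℝ} (h : Trip S a m b) (h' : Trip S a' m b') :
    a = a' ∧ b = b' := by
  have key : a = a' := by
    rcases lt_trichotomy a a' with hlt | rfl | hlt
    · have := h.isHead.add_two_lt h'.isHead hlt
      have := h.2.1; have := h.2.2.1; have := h'.1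
      linarith
    · rfl
    · have := h'.isHead.add_two_lt h.isHead hlt
      have := h'.2.1; have := h'.2.2.1; have := h.1
      linarith
  subst key
  exact ⟨rfl, (h.eq_of_left h').2⟩

open Classical in
/-- The relative position of the middle point in the triple that starts at `a`. -/
def ratio (S : Set ℝ) (a : ℝ) : ℝ :=
  if h : IsHead S a then (h.choose - a) / (h.choose_spec.choose - a) else 1 / 2

theorem Trip.ratio_eq (h : Trip S a m b) : ratio S a = (m - a) / (b - a) := by
  have h0 : IsHead S a := h.isHead
  have h1 := h0.choose_spec.choose_spec
  obtain ⟨e1, e2⟩ := h1.eq_of_left h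
  rw [ratio, dif_pos h0]
  rw [e2]
  rw [e1]

theorem ratio_of_not (h : ¬ IsHead S a) : ratio S a = 1 / 2 := dif_neg h

theorem ratio_mem (S : Set ℝ) (a : ℝ) : ratio S a ∈ Ioo (0 : ℝ) 1 := by
  by_cases h : IsHead S a
  · obtain ⟨m, b, h⟩ := h
    rw [h.ratio_eq]
    have h1 := h.1
    have h2 := h.2.1
    refine ⟨div_pos (by linarith) (by linarith), ?_⟩
    rw [div_lt_one (by linarith)]
    linarith
  · rw [ratio_of_not h]; norm_num

theorem Trip.mid_eq (h : Trip S a m b) : a + (b - a) * ratio S a = m := by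
  have h1 := h.1
  have h2 := h.2.1
  rw [h.ratio_eq, mul_div_cancel₀ _ (by linarith)]
  ring

open Classical in
/-- Moves the middle points of the isolated triples to the relative positions `v`. -/
def shiftMid (S : Set ℝ) (v : ℝ → ℝ) (s : ℝ) : ℝ :=
  if h : ∃ a b, Trip S a s b then h.choose + (h.choose_spec.choose - h.choose) * v h.choose else s

theorem Trip.shiftMid_eq (h : Trip S a m b) (v : ℝ → ℝ) :
    shiftMid S v m = a + (b - a) * v a := by
  have h0 : ∃ a b, Trip S a m b := ⟨a, b, h⟩
  obtain ⟨e1, e2⟩ := h0.choose_spec.choose_spec.eq_of_mid h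
  rw [shiftMid, dif_pos h0, e2, e1]

theorem shiftMid_of_not (v : ℝ → ℝ) (h : ¬ ∃ a b, Trip S a m b) : shiftMid S v m = m :=
  dif_neg h

/-- The set with the middle points of the isolated triples moved to the relative positions `v`. -/
def move (S : Set ℝ) (v : ℝ → ℝ) : Set ℝ := shiftMid S v '' S

theorem mem_move {v : ℝ → ℝ} {q : ℝ} : q ∈ move S v ↔
    (q ∈ S ∧ ¬ ∃ a b, Trip S a q b) ∨ ∃ a m b, Trip S a m b ∧ q = a + (b - a) * v a := by
  constructor
  · rintro ⟨s, hs, rfl⟩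
    by_cases h : ∃ a b, Trip S a s b
    · obtain ⟨a, b, h⟩ := h
      exact Or.inr ⟨a, s, b, h, h.shiftMid_eq v⟩
    · rw [shiftMid_of_not v h]
      exact Or.inl ⟨hs, h⟩
  · rintro (⟨h1, h2⟩ | ⟨a, m, b, h, rfl⟩)
    · exact ⟨q, h1, shiftMid_of_not v h2⟩
    · exact ⟨m, h.mem_mid, h.shiftMid_eq v⟩

theorem new_mem_Ioo {u : ℝ} (hab : a < b) (hu : u ∈ Ioo (0 : ℝ) 1) :
    a < a + (b - a) * u ∧ a + (b - a) * u < b := by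
  have h1 := mul_pos (sub_pos.2 hab) hu.1
  have h2 := mul_lt_mul_of_pos_left hu.2 (sub_pos.2 hab)
  constructor <;> linarith

theorem Trip.lt (h : Trip S a m b) : a < b := h.1.trans h.2.1

theorem Trip.left_not_mid (h : Trip S a m b) : ¬ ∃ c d, Trip S c a d := by
  rintro ⟨c, d, h'⟩
  have := h'.isHead.add_two_lt h.isHead h'.1
  have := h'.2.1; have := h'.2.2.1
  linarith

theorem Trip.right_not_mid (h : Trip S a m b) : ¬ ∃ c d, Trip S c b d := by
  rintro ⟨c, d, h'⟩
  have h1 := h.1; have h2 := h.2.1; have h3 := h.2.2.1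
  have h1' := h'.1; have h2' := h'.2.1; have h3' := h'.2.2.1
  rcases lt_trichotomy a c with hlt | rfl | hlt
  · have := h.isHead.add_two_lt h'.isHead hlt
    linarith
  · have := (h.eq_of_left h').1
    linarith
  · have := h'.isHead.add_two_lt h.isHead hlt
    linarith

variable {v w : ℝ → ℝ}

/-- Inside the window of `a` only its own middle point moves: any other triple starts beyond `a + 2`
or ends before `a - 1`, and its moved point stays inside it. -/
theorem Trip.move (h : Trip S a m b) (hv : ∀ a, v a ∈ Ioo (0 : ℝ) 1) :
    Trip (move S v) a (a + (b - a) * v a) b := by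
  obtain ⟨h1, h2, h3, h4⟩ := id h
  obtain ⟨n1, n2⟩ := new_mem_Ioo h.lt (hv a)
  refine ⟨n1, n2, h3, ?_⟩
  ext q
  simp only [mem_inter_iff, mem_move, mem_Icc, mem_insert_iff, mem_singleton_iff]
  constructor
  · rintro ⟨⟨hq, hq'⟩ | ⟨a', m', b', h', rfl⟩, h5, h6⟩
    · rcases (h.mem_iff h5 h6).1 hq with rfl | rfl | rfl
      · exact Or.inl rfl
      · exact absurd ⟨_, _, h⟩ hq'
      · exact Or.inr (Or.inr rfl)
    · obtain ⟨n1', n2'⟩ := new_mem_Ioo h'.lt (hv a')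
      have h3' := h'.2.2.1
      rcases lt_trichotomy a a' with hlt | rfl | hlt
      · have := h.isHead.add_two_lt h'.isHead hlt
        linarith
      · rw [(h.eq_of_left h').2]; exact Or.inr (Or.inl rfl)
      · have := h'.isHead.add_two_lt h.isHead hlt
        linarith
  · rintro (rfl | rfl | rfl)
    · exact ⟨Or.inl ⟨h.mem_left, h.left_not_mid⟩, by linarith, by linarith⟩
    · exact ⟨Or.inr ⟨a, m, b, h, rfl⟩, by linarith, by linarith⟩
    · exact ⟨Or.inl ⟨h.mem_right, h.right_not_mid⟩, by linarith, by linarith⟩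

/-- The danger is that a move creates a head. But each triple of `S` remains a triple after the
move, so by spacing it is far from a new head `a`; the window of `a` is then untouched by the move,
and `a` was a head before. -/
theorem isHead_move_iff (hv : ∀ a, v a ∈ Ioo (0 : ℝ) 1) : IsHead (move S v) a ↔ IsHead S a := by
  refine ⟨fun hh => ?_, fun ⟨m, b, h⟩ => (h.move hv).isHead⟩
  by_contra hn
  obtain ⟨m, b, h⟩ := id hh
  have far : ∀ a' m' b', Trip S a' m' b' → b' < a - 1 ∨ a + 2 < a' := by
    intro a' m' b' h'
    have h3' := h'.2.2.1
    have hd := (h'.move hv).isHead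
    rcases lt_trichotomy a a' with hlt | rfl | hlt
    · exact Or.inr (hh.add_two_lt hd hlt)
    · exact absurd h'.isHead hn
    · have := hd.add_two_lt hh hlt
      left; linarith
  refine hn ⟨m, b, h.1, h.2.1, h.2.2.1, ?_⟩
  rw [← h.2.2.2]
  ext q
  simp only [mem_inter_iff, mem_move, mem_Icc]
  refine and_congr_left fun ⟨h5, h6⟩ => ?_
  constructor
  · intro hq
    refine Or.inl ⟨hq, ?_⟩
    rintro ⟨c, d, h'⟩
    have h1' := h'.1; have h2' := h'.2.1
    rcases far _ _ _ h' with h7 | h7 <;> linarith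
  · rintro (hq | ⟨a', m', b', h', rfl⟩)
    · exact hq.1
    · obtain ⟨n1', n2'⟩ := new_mem_Ioo h'.lt (hv a')
      rcases far _ _ _ h' with h7 | h7 <;> linarith

theorem ratio_move (h : IsHead S a) (hv : ∀ a, v a ∈ Ioo (0 : ℝ) 1) :
    ratio (move S v) a = v a := by
  obtain ⟨m, b, h⟩ := h
  have := h.lt
  rw [(h.move hv).ratio_eq, add_sub_cancel_left, mul_div_cancel_left₀ _ (by linarith)]

theorem trip_move_iff (hv : ∀ a, v a ∈ Ioo (0 : ℝ) 1) :
    Trip (move S v) a c b ↔ ∃ m, Trip S a m b ∧ c = a + (b - a) * v a := by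
  constructor
  · intro h
    obtain ⟨m', b', h'⟩ := (isHead_move_iff hv).1 h.isHead
    obtain ⟨rfl, rfl⟩ := h.eq_of_left (h'.move hv)
    exact ⟨m', h', rfl⟩
  · rintro ⟨m, h, rfl⟩
    exact h.move hv

/-- Moves do not accumulate, since the end points of the triples stay and only the last relative
positions count. Decoding and coding cell by cell both rest on this. -/
theorem move_move (hv : ∀ a, v a ∈ Ioo (0 : ℝ) 1) : move (move S v) w = move S w := by
  ext q
  rw [mem_move (S := move S v), mem_move (S := S) (v := w)]
  refine or_congr ?_ ?_
  · constructor
    · rintro ⟨hq, hq'⟩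
      rcases mem_move.1 hq with h | ⟨a, m, b, h, rfl⟩
      · exact h
      · exact absurd ⟨a, b, h.move hv⟩ hq'
    · rintro ⟨hq, hq'⟩
      refine ⟨mem_move.2 (Or.inl ⟨hq, hq'⟩), ?_⟩
      rintro ⟨a, b, h⟩
      obtain ⟨m, h', rfl⟩ := (trip_move_iff hv).1 h
      have h3 := h'.2.2.1
      obtain ⟨n1, n2⟩ := new_mem_Ioo h'.lt (hv a)
      rcases (h'.mem_iff (by linarith) (by linarith)).1 hq with h5 | h5 | h5
      · linarith
      · exact hq' ⟨a, b, h5 ▸ h'⟩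
      · linarith
  · constructor
    · rintro ⟨a, m, b, h, rfl⟩
      obtain ⟨m', h', -⟩ := (trip_move_iff hv).1 h
      exact ⟨a, m', b, h', rfl⟩
    · rintro ⟨a, m, b, h, rfl⟩
      exact ⟨a, _, b, h.move hv, rfl⟩

theorem move_congr (h : ∀ a, IsHead S a → v a = w a) : move S v = move S w := by
  ext q
  rw [mem_move, mem_move]
  refine or_congr Iff.rfl ?_
  constructor
  · rintro ⟨a, m, b, h', rfl⟩
    exact ⟨a, m, b, h', by rw [h a h'.isHead]⟩
  · rintro ⟨a, m, b, h', rfl⟩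
    exact ⟨a, m, b, h', by rw [h a h'.isHead]⟩

theorem shiftMid_ratio (s : ℝ) : shiftMid S (ratio S) s = s := by
  by_cases h : ∃ a b, Trip S a s b
  · obtain ⟨a, b, h⟩ := h
    rw [h.shiftMid_eq, h.mid_eq]
  · exact shiftMid_of_not _ h

/-- Together with `move_move`: moving back to the original ratios undoes any move. -/
theorem move_ratio : move S (ratio S) = S := by
  ext q
  simp [move, shiftMid_ratio]

/-- A new middle point stays in its own triple, where the only other points are the two ends.
Injectivity carries counts of points through a move. -/
theorem injOn_shiftMid (hv : ∀ a, v a ∈ Ioo (0 : ℝ) 1) : InjOn (shiftMid S v) S := by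
  have key : ∀ s t, s ∈ S → t ∈ S → shiftMid S v s = shiftMid S v t → (∃ a b, Trip S a s b) →
      s = t := by
    rintro s t hs ht he ⟨a, b, h⟩
    rw [h.shiftMid_eq] at he
    have h3 := h.2.2.1
    obtain ⟨n1, n2⟩ := new_mem_Ioo h.lt (hv a)
    by_cases h' : ∃ a b, Trip S a t b
    · obtain ⟨c, d, h'⟩ := h'
      rw [h'.shiftMid_eq] at he
      have h3' := h'.2.2.1
      obtain ⟨n1', n2'⟩ := new_mem_Ioo h'.lt (hv c)
      rcases lt_trichotomy a c with hlt | rfl | hlt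
      · have := h.isHead.add_two_lt h'.isHead hlt
        linarith
      · exact (h.eq_of_left h').1
      · have := h'.isHead.add_two_lt h.isHead hlt
        linarith
    · rw [shiftMid_of_not v h'] at he
      rcases (h.mem_iff (by linarith) (by linarith)).1 ht with h5 | h5 | h5
      · linarith
      · exact h5.symm
      · linarith
  intro s hs t ht he
  by_cases h : ∃ a b, Trip S a s b
  · exact key s t hs ht he h
  · by_cases h' : ∃ a b, Trip S a t b
    · exact (key t s ht hs he.symm h').symm
    · rwa [shiftMid_of_not v h, shiftMid_of_not v h'] at he

theorem abs_shiftMid_sub_le (hv : ∀ a, v a ∈ Ioo (0 : ℝ) 1) (s : ℝ) :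
    |shiftMid S v s - s| ≤ 1 := by
  by_cases h : ∃ a b, Trip S a s b
  · obtain ⟨a, b, h⟩ := h
    rw [h.shiftMid_eq, abs_le]
    have h1 := h.1; have h2 := h.2.1; have h3 := h.2.2.1
    obtain ⟨n1, n2⟩ := new_mem_Ioo h.lt (hv a)
    constructor <;> linarith
  · rw [shiftMid_of_not v h]; simp

theorem LocFin.move (hS : LocFin S) (hv : ∀ a, v a ∈ Ioo (0 : ℝ) 1) : LocFin (move S v) := by
  intro x y
  refine ((hS (x - 1) (y + 1)).image (shiftMid S v)).subset ?_
  rintro _ ⟨⟨s, hs, rfl⟩, h1, h2⟩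
  have := abs_le.1 (abs_shiftMid_sub_le (S := S) hv s)
  exact ⟨s, ⟨hs, by linarith, by linarith⟩, rfl⟩

end Triples

/-! ### Blocks between heads and labels of points. -/

section Blocks

variable {S : Set ℝ} {a b c q : ℝ} {v w : ℝ → ℝ}

/-- The points of `S` from `a` up to the next head. -/
def blk (S : Set ℝ) (a : ℝ) : Set ℝ := {q ∈ S | a ≤ q ∧ ∀ c, IsHead S c → ¬ (a < c ∧ c ≤ q)}

/-- The number of points from `a` up to the next head. -/
def blkSize (S : Set ℝ) (a : ℝ) : ℕ := (blk S a).ncard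

/-- The old and the new middle point of a triple compare in the same way with every head, because no
head follows the head of the triple within distance two. -/
theorem blk_move (ha : IsHead S a) (hv : ∀ a, v a ∈ Ioo (0 : ℝ) 1) :
    blk (move S v) a = shiftMid S v '' blk S a := by
  have key : ∀ s ∈ S, (a ≤ shiftMid S v s ∧ ∀ c, IsHead S c → ¬ (a < c ∧ c ≤ shiftMid S v s)) ↔
      (a ≤ s ∧ ∀ c, IsHead S c → ¬ (a < c ∧ c ≤ s)) := by
    intro s hs
    by_cases h : ∃ a b, Trip S a s b
    · obtain ⟨x, y, h⟩ := h
      rw [h.shiftMid_eq]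
      have h1 := h.1; have h2 := h.2.1; have h3 := h.2.2.1
      obtain ⟨n1, n2⟩ := new_mem_Ioo h.lt (hv x)
      have ord : ∀ c, IsHead S c → ∀ z, x < z → z < y → (c ≤ z ↔ c ≤ x) := by
        intro c hc z hz1 hz2
        refine ⟨fun h7 => ?_, fun h7 => by linarith⟩
        by_contra h8
        push Not at h8
        have := h.isHead.add_two_lt hc h8
        linarith
      rw [ord a ha _ n1 n2, ord a ha _ h1 h2]
      refine and_congr_right fun _ => forall₂_congr fun c hc => ?_
      rw [ord c hc _ n1 n2, ord c hc _ h1 h2]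
    · rw [shiftMid_of_not v h]
  ext q
  simp only [blk, mem_ofPred_eq, isHead_move_iff hv, mem_image]
  constructor
  · rintro ⟨⟨s, hs, rfl⟩, h⟩
    exact ⟨s, ⟨hs, (key s hs).1 h⟩, rfl⟩
  · rintro ⟨s, ⟨hs, h⟩, rfl⟩
    exact ⟨⟨s, hs, rfl⟩, (key s hs).2 h⟩

theorem blkSize_move (ha : IsHead S a) (hv : ∀ a, v a ∈ Ioo (0 : ℝ) 1) :
    blkSize (move S v) a = blkSize S a := by
  rw [blkSize, blk_move ha hv, ((injOn_shiftMid hv).mono fun q hq => hq.1).ncard_image, blkSize]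

theorem blk_subset (hc : IsHead S c) (hac : a < c) : blk S a ⊆ S ∩ Ico a c := by
  rintro q ⟨h1, h2, h3⟩
  exact ⟨h1, h2, not_le.1 fun h => h3 c hc ⟨hac, h⟩⟩

theorem blk_eq (hc : IsHead S c) (hac : a < c) (h : ∀ d, IsHead S d → ¬ (a < d ∧ d < c)) :
    blk S a = S ∩ Ico a c := by
  refine (blk_subset hc hac).antisymm ?_
  rintro q ⟨h1, h2, h3⟩
  exact ⟨h1, h2, fun d hd hd' => h d hd ⟨hd'.1, hd'.2.trans_lt h3⟩⟩

theorem LocFin.finite_of_subset (hS : LocFin S) {T : Set ℝ} {x y : ℝ} (hT : T ⊆ Icc x y) :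
    (S ∩ T).Finite := (hS x y).subset (inter_subset_inter_right _ hT)

/-- The signed number of points between the origin and `s`. -/
def lab (S : Set ℝ) (s : ℝ) : ℤ := ((S ∩ Ioc 0 s).ncard : ℤ) - ((S ∩ Ioc s 0).ncard : ℤ)

theorem ncard_Ioc_add (hS : LocFin S) {x y z : ℝ} (hxy : x ≤ y) (hyz : y ≤ z) :
    (S ∩ Ioc x z).ncard = (S ∩ Ioc x y).ncard + (S ∩ Ioc y z).ncard := by
  rw [← Ioc_union_Ioc_eq_Ioc hxy hyz, inter_union_distrib_left,
    ncard_union_eq ?_ (hS.finite_of_subset Ioc_subset_Icc_self)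
      (hS.finite_of_subset Ioc_subset_Icc_self)]
  · refine Disjoint.mono inter_subset_right inter_subset_right ?_
    rw [Set.disjoint_left]
    rintro q ⟨_, h⟩ ⟨h', _⟩
    linarith

/-- The two one-sided counts combine to a single additive counting function, wherever the origin
lies; later arguments use only label differences. -/
theorem lab_sub_lab (hS : LocFin S) {x y : ℝ} (hxy : x ≤ y) :
    lab S y - lab S x = (S ∩ Ioc x y).ncard := by
  unfold lab
  rcases le_total 0 x with hx | hx
  · have h := ncard_Ioc_add hS hx hxy
    rw [Ioc_eq_empty (not_lt.2 hx), Ioc_eq_empty (not_lt.2 (hx.trans hxy))]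
    simp; omega
  · rcases le_total 0 y with hy | hy
    · have h := ncard_Ioc_add hS hx hy
      rw [Ioc_eq_empty (not_lt.2 hx), Ioc_eq_empty (not_lt.2 hy)]
      simp; omega
    · have h := ncard_Ioc_add hS hxy hy
      rw [Ioc_eq_empty (not_lt.2 hx), Ioc_eq_empty (not_lt.2 hy)]
      simp; omega

theorem lab_mono (hS : LocFin S) {x y : ℝ} (hxy : x ≤ y) : lab S x ≤ lab S y := by
  have := lab_sub_lab hS hxy
  omega

/-- Label differences count `(a, c]` while blocks are contained in `[a, c)`; exchanging one end
point for the other is harmless since both are points. -/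
theorem ncard_Ioc_eq_Ico (hS : LocFin S) (ha : a ∈ S) (hc : c ∈ S) (hac : a ≤ c) :
    (S ∩ Ioc a c).ncard = (S ∩ Ico a c).ncard := by
  rcases hac.eq_or_lt with rfl | hac
  · simp
  have h1 : S ∩ Ioc a c = insert c (S ∩ Ioo a c) := by
    ext q; simp only [mem_inter_iff, mem_Ioc, mem_insert_iff, mem_Ioo]; grind
  have h2 : S ∩ Ico a c = insert a (S ∩ Ioo a c) := by
    ext q; simp only [mem_inter_iff, mem_Ico, mem_insert_iff, mem_Ioo]; grind
  have hf : (S ∩ Ioo a c).Finite := hS.finite_of_subset Ioo_subset_Icc_self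
  rw [h1, h2, ncard_insert_of_notMem (by simp) hf, ncard_insert_of_notMem (by simp) hf]

/-- The label intervals of different blocks are disjoint. For consecutive heads they are also
adjacent, see `lab_add_blkSize_eq`. -/
theorem lab_add_blkSize_le (hS : LocFin S) (ha : IsHead S a) (hc : IsHead S c) (hac : a < c) :
    lab S a + blkSize S a ≤ lab S c := by
  have h1 := lab_sub_lab hS hac.le
  rw [ncard_Ioc_eq_Ico hS ha.mem hc.mem hac.le] at h1
  have h2 : blkSize S a ≤ (S ∩ Ico a c).ncard :=
    ncard_le_ncard (blk_subset hc hac) (hS.finite_of_subset Ico_subset_Icc_self)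
  omega

theorem lab_add_blkSize_eq (hS : LocFin S) (ha : IsHead S a) (hc : IsHead S c) (hac : a < c)
    (h : ∀ d, IsHead S d → ¬ (a < d ∧ d < c)) :
    lab S a + blkSize S a = lab S c := by
  have h1 := lab_sub_lab hS hac.le
  rw [ncard_Ioc_eq_Ico hS ha.mem hc.mem hac.le] at h1
  rw [blkSize, blk_eq hc hac h]
  omega

/-- The index `i` belongs to the block of points that starts with the head `a`. -/
def Slot (S : Set ℝ) (i : ℤ) (a : ℝ) : Prop :=
  IsHead S a ∧ lab S a ≤ i ∧ i < lab S a + blkSize S a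

theorem Slot.unique (hS : LocFin S) {i : ℤ} (h : Slot S i a) (h' : Slot S i c) : a = c := by
  rcases lt_trichotomy a c with hlt | rfl | hlt
  · have := lab_add_blkSize_le hS h.1 h'.1 hlt
    have := h.2.2; have := h'.2.1
    omega
  · rfl
  · have := lab_add_blkSize_le hS h'.1 h.1 hlt
    have := h'.2.2; have := h.2.1
    omega

/-- If `q` lies between two heads then its label belongs to a block that starts between them. -/
theorem exists_slot (hS : LocFin S) {x y : ℝ} (hx : IsHead S x) (hy : IsHead S y) {i : ℤ}
    (h1 : lab S x ≤ i) (h2 : i < lab S y) : ∃ a, x ≤ a ∧ a < y ∧ Slot S i a := by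
  have hfin : {d | IsHead S d ∧ d ∈ Icc x y}.Finite :=
    (hS x y).subset fun d hd => ⟨hd.1.mem, hd.2⟩
  have hxy : x < y := by
    by_contra h
    have := lab_mono hS (not_lt.1 h)
    omega
  have hf1 : {d | (IsHead S d ∧ d ∈ Icc x y) ∧ lab S d ≤ i}.Finite :=
    hfin.subset fun d hd => hd.1
  -- `a` is the last head with label at most `i`, and `c` below is the next head after it; by
  -- maximality the label of `c` exceeds `i`.
  obtain ⟨a, ⟨⟨ha, ha'⟩, hai⟩, hmax⟩ := exists_max_image _ id hf1 ⟨x, ⟨hx, le_rfl, hxy.le⟩, h1⟩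
  have hay : a < y := by
    by_contra h
    have := lab_mono hS (not_lt.1 h)
    omega
  have hf2 : {d | (IsHead S d ∧ d ∈ Icc x y) ∧ a < d}.Finite :=
    hfin.subset fun d hd => hd.1
  obtain ⟨c, ⟨⟨hc, hc'⟩, hac⟩, hmin⟩ := exists_min_image _ id hf2 ⟨y, ⟨hy, hxy.le, le_rfl⟩, hay⟩
  refine ⟨a, ha'.1, hay, ha, hai, ?_⟩
  rw [lab_add_blkSize_eq hS ha hc hac]
  · by_contra h
    exact absurd (hmax c ⟨⟨hc, hc'⟩, not_lt.1 h⟩) (not_le.2 hac)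
  · rintro d hd ⟨hd1, hd2⟩
    exact absurd (hmin d ⟨⟨hd, ha'.1.trans hd1.le, hd2.le.trans hc'.2⟩, hd1⟩) (not_le.2 hd2)

end Blocks

/-! ### Splitting a uniform variable into a uniform variable and marks. -/

/-- For every `k`, an isomorphism between the uniform law on `(0, 1)` and its product with
`k` copies of `α`. Only the first `k` marks are meaningful. -/
structure Coding {A : Type*} [MeasurableSpace A] (α : Measure A) where
  enc : ℕ → ℝ → ℝ × (ℕ → A)
  dec : ℕ → ℝ × (ℕ → A) → ℝ
  measurable_enc : ∀ k, Measurable (enc k)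
  measurable_dec : ∀ k, Measurable (dec k)
  enc_mem : ∀ k u, (enc k u).1 ∈ Ioo (0 : ℝ) 1
  dec_mem : ∀ k y, dec k y ∈ Ioo (0 : ℝ) 1
  -- Required for every `u` in the interval and not only almost surely, so that decoding inverts
  -- encoding on every point measure.
  dec_enc : ∀ k, ∀ u ∈ Ioo (0 : ℝ) 1, dec k (enc k u) = u
  dec_congr : ∀ k u x y, (∀ j < k, x j = y j) → dec k (u, x) = dec k (u, y)
  map_enc : ∀ k, (volume.restrict (Ioo (0 : ℝ) 1)).map
    (fun u => ((enc k u).1, fun j : Fin k => (enc k u).2 j)) =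
      (volume.restrict (Ioo (0 : ℝ) 1)).prod (Measure.pi fun _ : Fin k => α)

section Read

variable {A : Type*} (a₀ : A) {S : Set ℝ}

open Classical in
/-- The marks of the points of `S`, given by their cells and positions in blocks. -/
def readMarks (S : Set ℝ) (m : ℤ × ℕ → A) (i : ℤ) : A :=
  if h : ∃ a, Slot S i a then m (⌊h.choose⌋, (i - lab S h.choose).toNat) else a₀

theorem readMarks_of_slot (hS : LocFin S) {i : ℤ} {a : ℝ} (h : Slot S i a) (m : ℤ × ℕ → A) :
    readMarks a₀ S m i = m (⌊a⌋, (i - lab S a).toNat) := by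
  have h0 : ∃ a, Slot S i a := ⟨a, h⟩
  have e := h0.choose_spec.unique hS h
  rw [readMarks, dif_pos h0, e]

theorem readMarks_of_not {i : ℤ} (h : ¬ ∃ a, Slot S i a) (m : ℤ × ℕ → A) :
    readMarks a₀ S m i = a₀ := dif_neg h

end Read

/-! ### The encoder and the decoder on sets. -/

section Code

variable {A : Type*} [MeasurableSpace A] {α : Measure A} (C : Coding α) (a₀ : A)
variable {S T : Set ℝ}

/-- The code length is the number of points that the head has to mark. It is the same before and
after the move, so the decoder knows which code was used. An infinite last block has `blkSize` zero
and gets no encoded marks. -/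
def encPos (S : Set ℝ) (a : ℝ) : ℝ := (C.enc (blkSize S a) (ratio S a)).1

def encSet (S : Set ℝ) : Set ℝ := move S (encPos C S)

open Classical in
/-- The mark of the point with index `i` in `encSet C S`. -/
def encMarks (S : Set ℝ) (i : ℤ) : A :=
  if h : ∃ a, Slot (encSet C S) i a then
    (C.enc (blkSize S h.choose) (ratio S h.choose)).2 (i - lab (encSet C S) h.choose).toNat
  else a₀

def decPos (S : Set ℝ) (x : ℤ → A) (a : ℝ) : ℝ :=
  C.dec (blkSize S a) (ratio S a, fun j => x (lab S a + j))

def decSet (S : Set ℝ) (x : ℤ → A) : Set ℝ := move S (decPos C S x)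

theorem encPos_mem (S : Set ℝ) (a : ℝ) : encPos C S a ∈ Ioo (0 : ℝ) 1 := C.enc_mem _ _

theorem decPos_mem (S : Set ℝ) (x : ℤ → A) (a : ℝ) : decPos C S x a ∈ Ioo (0 : ℝ) 1 :=
  C.dec_mem _ _

theorem LocFin.encSet (hS : LocFin S) : LocFin (encSet C S) := hS.move (encPos_mem C S)

theorem LocFin.decSet (hS : LocFin S) (x : ℤ → A) : LocFin (decSet C S x) :=
  hS.move (decPos_mem C S x)

theorem encMarks_of_slot (hS : LocFin S) {i : ℤ} {a : ℝ} (h : Slot (encSet C S) i a) :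
    encMarks C a₀ S i =
      (C.enc (blkSize S a) (ratio S a)).2 (i - lab (encSet C S) a).toNat := by
  have h0 : ∃ a, Slot (encSet C S) i a := ⟨a, h⟩
  have e := h0.choose_spec.unique (hS.encSet C) h
  rw [encMarks, dif_pos h0, e]

theorem encMarks_of_not {i : ℤ} (h : ¬ ∃ a, Slot (encSet C S) i a) :
    encMarks C a₀ S i = a₀ := dif_neg h

theorem isHead_encSet_iff {a : ℝ} : IsHead (encSet C S) a ↔ IsHead S a :=
  isHead_move_iff (encPos_mem C S)

theorem blkSize_encSet {a : ℝ} (h : IsHead S a) : blkSize (encSet C S) a = blkSize S a :=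
  blkSize_move h (encPos_mem C S)

/-- The encoded set shows the same heads and block sizes, its ratios are the encoded positions, and
its block carries the first `k` encoded marks. So `dec` returns the original ratio at every head,
and `move_move` restores `S`. -/
theorem decSet_encSet (hS : LocFin S) : decSet C (encSet C S) (encMarks C a₀ S) = S := by
  have hv := encPos_mem C S
  rw [decSet]
  conv_lhs => rw [encSet]
  rw [move_move hv]
  conv_rhs => rw [← move_ratio (S := S)]
  refine move_congr fun a ha => ?_
  have e1 : blkSize (encSet C S) a = blkSize S a := blkSize_encSet C ha
  have e2 : ratio (encSet C S) a = encPos C S a := ratio_move ha hv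
  change decPos C (encSet C S) (encMarks C a₀ S) a = _
  rw [decPos, e1, e2, encPos, ← C.dec_enc (blkSize S a) (ratio S a) (ratio_mem S a)]
  rw [C.dec_enc _ _ (ratio_mem S a)]
  rw [C.dec_congr _ _ _ (C.enc (blkSize S a) (ratio S a)).2, C.dec_enc _ _ (ratio_mem S a)]
  intro j hj
  -- The labels are those of the encoded set; they can differ from the labels of `S`, as a middle
  -- point may cross the origin.
  have hs : Slot (encSet C S) (lab (encSet C S) a + j) a := by
    refine ⟨(isHead_encSet_iff C).2 ha, by omega, ?_⟩
    rw [e1]; omega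
  rw [encMarks_of_slot C a₀ hS hs]
  simp

/-! ### Locality -/

/-- `S` and `T` agree around the interval between the two heads `x < y`. -/
def Sync (S T : Set ℝ) (x y : ℝ) : Prop :=
  x < y ∧ IsHead S x ∧ IsHead S y ∧
    ∀ q, x - 1 ≤ q → q ≤ y + 2 → (q ∈ S ↔ q ∈ T)

variable {x y : ℝ}

theorem Trip.congr {a m b : ℝ} (h : Trip S a m b)
    (hST : ∀ q, a - 1 ≤ q → q ≤ a + 2 → (q ∈ S ↔ q ∈ T)) : Trip T a m b := by
  refine ⟨h.1, h.2.1, h.2.2.1, ?_⟩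
  rw [← h.2.2.2]
  ext q
  exact and_congr_left fun hq => (hST q hq.1 hq.2).symm

theorem Sync.trip (h : Sync S T x y) {a m b : ℝ} (hx : x ≤ a) (hy : a ≤ y) (ht : Trip S a m b) :
    Trip T a m b :=
  ht.congr fun q h1 h2 => h.2.2.2 q (by linarith) (by linarith)

theorem Sync.symm (h : Sync S T x y) : Sync T S x y := by
  obtain ⟨m, b, hx⟩ := h.2.1
  obtain ⟨m', b', hy⟩ := h.2.2.1
  exact ⟨h.1, (h.trip le_rfl h.1.le hx).isHead, (h.trip h.1.le le_rfl hy).isHead,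
    fun q h1 h2 => (h.2.2.2 q h1 h2).symm⟩

theorem Sync.isHead (h : Sync S T x y) {a : ℝ} (hx : x ≤ a) (hy : a ≤ y) (ht : IsHead S a) :
    IsHead T a := by
  obtain ⟨m, b, ht⟩ := ht
  exact (h.trip hx hy ht).isHead

theorem Sync.blk_subset (h : Sync S T x y) {a : ℝ} (hx : x ≤ a) (hy : a < y) :
    blk S a ⊆ blk T a := by
  rintro q hq
  have h1 := (MarkedPoisson.blk_subset h.2.2.1 hy hq).2
  refine ⟨(h.2.2.2 q (by linarith [h1.1]) (by linarith [h1.2])).1 hq.1, hq.2.1, fun c hc hc' => ?_⟩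
  exact hq.2.2 c (h.symm.isHead (by linarith) (by linarith [h1.2]) hc) hc'

theorem Sync.blkSize (h : Sync S T x y) {a : ℝ} (hx : x ≤ a) (hy : a < y) :
    blkSize S a = blkSize T a := by
  rw [MarkedPoisson.blkSize, MarkedPoisson.blkSize,
    (h.blk_subset hx hy).antisymm (h.symm.blk_subset hx hy)]

theorem Sync.ratio (h : Sync S T x y) {a : ℝ} (hx : x ≤ a) (hy : a ≤ y) :
    ratio S a = ratio T a := by
  by_cases ha : IsHead S a
  · obtain ⟨m, b, ha⟩ := ha
    rw [ha.ratio_eq, (h.trip hx hy ha).ratio_eq]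
  · rw [ratio_of_not ha, ratio_of_not fun h' => ha (h.symm.isHead hx hy h')]

/-- A middle point to the right of a head belongs to a triple to the right of this head. -/
theorem IsHead.le_of_trip (hx : IsHead S x) {a m b q : ℝ} (h : Trip S a m b) (hq : q < b)
    (hxq : x ≤ q) : x ≤ a := by
  by_contra hlt
  have := h.isHead.add_two_lt hx (not_le.1 hlt)
  have := h.2.2.1
  linarith

theorem Sync.move_subset (h : Sync S T x y) {v w : ℝ → ℝ} (hv : ∀ a, v a ∈ Ioo (0 : ℝ) 1)
    (hvw : ∀ a, x ≤ a → a < y → IsHead S a → v a = w a) :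
    move S v ∩ Ico x y ⊆ move T w := by
  rintro q ⟨hq, h1, h2⟩
  rw [mem_move] at hq ⊢
  rcases hq with ⟨h3, h4⟩ | ⟨a, m, b, h3, rfl⟩
  · refine Or.inl ⟨(h.2.2.2 q (by linarith) (by linarith)).1 h3, ?_⟩
    rintro ⟨a, b, h5⟩
    have h6 := h.symm.2.1.le_of_trip h5 h5.2.1 h1
    exact h4 ⟨a, b, h.symm.trip h6 (by linarith [h5.1]) h5⟩
  · obtain ⟨n1, n2⟩ := new_mem_Ioo h3.lt (hv a)
    have h6 := h.2.1.le_of_trip h3 n2 h1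
    exact Or.inr ⟨a, m, b, h.trip h6 (by linarith) h3, by
      rw [hvw a h6 (by linarith) h3.isHead]⟩

theorem Sync.move_eq (h : Sync S T x y) {v w : ℝ → ℝ} (hv : ∀ a, v a ∈ Ioo (0 : ℝ) 1)
    (hw : ∀ a, w a ∈ Ioo (0 : ℝ) 1) (hvw : ∀ a, x ≤ a → a < y → IsHead S a → v a = w a) :
    move S v ∩ Ico x y = move T w ∩ Ico x y := by
  refine subset_antisymm (fun q hq => ⟨h.move_subset hv hvw hq, hq.2⟩)
    (fun q hq => ⟨h.symm.move_subset hw (fun a h1 h2 h3 => ?_) hq, hq.2⟩)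
  exact (hvw a h1 h2 (h.symm.isHead h1 h2.le h3)).symm

/-- The origin must belong to the region of agreement, because labels are counted from there. -/
theorem lab_congr (h : S ∩ Ico x y = T ∩ Ico x y) (hx : x ≤ 0) (hy : 0 < y) {s : ℝ}
    (h1 : x ≤ s) (h2 : s < y) : lab S s = lab T s := by
  have key : ∀ I : Set ℝ, I ⊆ Ico x y → S ∩ I = T ∩ I := by
    intro I hI
    rw [← inter_eq_self_of_subset_right hI, ← inter_assoc, h, inter_assoc]
  rw [lab, lab, key (Ioc 0 s), key (Ioc s 0)]
  · exact fun q hq => ⟨by linarith [hq.1], by linarith [hq.2]⟩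
  · exact fun q hq => ⟨by linarith [hq.1], by linarith [hq.2]⟩

theorem Sync.encSet_eq (h : Sync S T x y) : encSet C S ∩ Ico x y = encSet C T ∩ Ico x y := by
  refine h.move_eq (encPos_mem C S) (encPos_mem C T) fun a h1 h2 _ => ?_
  rw [encPos, encPos, h.blkSize h1 h2, h.ratio h1 h2.le]

theorem lab_lt_of_mem (hS : LocFin S) (hy : y ∈ S) (hxy : x < y) : lab S x < lab S y := by
  have h := lab_sub_lab hS hxy.le
  have : 0 < (S ∩ Ioc x y).ncard :=
    (ncard_pos (hS.finite_of_subset Ioc_subset_Icc_self)).2 ⟨y, hy, hxy, le_rfl⟩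
  omega

/-- The head whose block contains the label of `q` lies in `[x, y)` by `exists_slot`, and its block
ends at `y` at the latest. Hence its ratio, its block size and its label are visible to both sets.
-/
theorem Sync.encMarks_eq (h : Sync S T x y) (hS : LocFin S) (hT : LocFin T) (hx : x ≤ 0)
    (hy : 0 < y) {q : ℝ} (h1 : x ≤ q) (h2 : q < y) :
    encMarks C a₀ S (lab (encSet C S) q) = encMarks C a₀ T (lab (encSet C T) q) := by
  have hx' : IsHead (encSet C S) x := (isHead_encSet_iff C).2 h.2.1
  have hy' : IsHead (encSet C S) y := (isHead_encSet_iff C).2 h.2.2.1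
  obtain ⟨a, ha1, ha2, ha⟩ := exists_slot (hS.encSet C) hx' hy'
    (lab_mono (hS.encSet C) h1) (lab_lt_of_mem (hS.encSet C) hy'.mem h2)
  have e1 := lab_congr (h.encSet_eq C) hx hy h1 h2
  have e2 := lab_congr (h.encSet_eq C) hx hy ha1 ha2
  have haS : IsHead S a := (isHead_encSet_iff C).1 ha.1
  have haT : IsHead T a := h.isHead ha1 ha2.le haS
  have hs : Slot (encSet C T) (lab (encSet C T) q) a := by
    obtain ⟨h3, h4, h5⟩ := ha
    refine ⟨(isHead_encSet_iff C).2 haT, by omega, ?_⟩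
    rw [blkSize_encSet C haT, ← h.blkSize ha1 ha2, ← blkSize_encSet C haS]
    omega
  rw [encMarks_of_slot C a₀ hS ha, encMarks_of_slot C a₀ hT hs, h.blkSize ha1 ha2,
    h.ratio ha1 ha2.le, e1, e2]

/-- Blocks that start in `[x, y)` use only labels from `lab S x` to below `lab S y`, so agreement of
these marks suffices. -/
theorem Sync.decSet_eq (h : Sync S T x y) (hS : LocFin S) (hx : x ≤ 0)
    (hy : 0 < y) {ξ η : ℤ → A} (hξ : ∀ i, lab S x ≤ i → i < lab S y → ξ i = η i) :
    decSet C S ξ ∩ Ico x y = decSet C T η ∩ Ico x y := by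
  have hST : S ∩ Ico x y = T ∩ Ico x y := by
    ext q
    exact and_congr_left fun hq => h.2.2.2 q (by linarith [hq.1]) (by linarith [hq.2])
  refine h.move_eq (decPos_mem C S ξ) (decPos_mem C T η) fun a h1 h2 ha => ?_
  rw [decPos, decPos, ← h.blkSize h1 h2, ← h.ratio h1 h2.le]
  refine C.dec_congr _ _ _ _ fun j hj => ?_
  have e1 := lab_mono hS h1
  have e2 := lab_add_blkSize_le hS ha h.2.2.1 h2
  rw [← lab_congr hST hx hy h1 h2]
  exact hξ _ (by omega) (by omega)

/-! ### Translations -/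

/-- The set moved by `t`. -/
def shiftSet (t : ℝ) (S : Set ℝ) : Set ℝ := {s | s - t ∈ S}

theorem mem_shiftSet {t s : ℝ} : s ∈ shiftSet t S ↔ s - t ∈ S := Iff.rfl

theorem shiftSet_eq_image (t : ℝ) (S : Set ℝ) : shiftSet t S = (fun s => s + t) '' S := by
  ext s
  simp only [mem_shiftSet, mem_image]
  exact ⟨fun h => ⟨_, h, by ring⟩, by rintro ⟨q, hq, rfl⟩; simpa using hq⟩

theorem trip_shiftSet {t a m b : ℝ} :
    Trip (shiftSet t S) a m b ↔ Trip S (a - t) (m - t) (b - t) := by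
  have e : (shiftSet t S ∩ Icc (a - 1) (a + 2) = {a, m, b}) ↔
      (S ∩ Icc (a - t - 1) (a - t + 2) = {a - t, m - t, b - t}) := by
    simp only [Set.ext_iff, mem_inter_iff, mem_shiftSet, mem_Icc, mem_insert_iff,
      mem_singleton_iff]
    constructor
    · intro h q
      have := h (q + t)
      grind
    · intro h q
      have := h (q - t)
      grind
  unfold Trip
  rw [e]
  refine and_congr (by simp) (and_congr (by simp) (and_congr ?_ Iff.rfl))
  constructor <;> intro <;> linarith

theorem isHead_shiftSet {t a : ℝ} : IsHead (shiftSet t S) a ↔ IsHead S (a - t) := by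
  constructor
  · rintro ⟨m, b, h⟩
    exact (trip_shiftSet.1 h).isHead
  · rintro ⟨m, b, h⟩
    refine ⟨m + t, b + t, trip_shiftSet.2 ?_⟩
    simpa using h

theorem ratio_shiftSet (t a : ℝ) : ratio (shiftSet t S) a = ratio S (a - t) := by
  by_cases ha : IsHead S (a - t)
  · obtain ⟨m, b, h⟩ := isHead_shiftSet.2 ha
    rw [h.ratio_eq, (trip_shiftSet.1 h).ratio_eq]
    simp
  · rw [ratio_of_not ha, ratio_of_not fun h => ha (isHead_shiftSet.1 h)]

theorem move_shiftSet (t : ℝ) (v : ℝ → ℝ) :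
    move (shiftSet t S) v = shiftSet t (move S fun a => v (a + t)) := by
  ext q
  rw [mem_shiftSet (S := move S _), mem_move, mem_move]
  simp only [trip_shiftSet, mem_shiftSet]
  refine or_congr (and_congr_right fun _ => not_congr ?_) ?_
  · constructor
    · rintro ⟨a, b, h⟩
      exact ⟨_, _, h⟩
    · rintro ⟨a, b, h⟩
      exact ⟨a + t, b + t, by simpa using h⟩
  · constructor
    · rintro ⟨a, m, b, h, rfl⟩
      exact ⟨_, _, _, h, by simp; ring⟩
    · rintro ⟨a, m, b, h, h'⟩
      exact ⟨a + t, m + t, b + t, by simpa using h, by linear_combination h'⟩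

theorem blkSize_shiftSet (t a : ℝ) : blkSize (shiftSet t S) a = blkSize S (a - t) := by
  have : blk (shiftSet t S) a = (fun s => s + t) '' blk S (a - t) := by
    rw [← shiftSet_eq_image]
    ext q
    simp only [mem_shiftSet, blk, mem_ofPred_eq, isHead_shiftSet]
    refine and_congr_right fun _ => and_congr (by simp) ?_
    constructor
    · intro h c hc hc'
      exact h (c + t) (by simpa using hc) ⟨by linarith, by linarith⟩
    · intro h c hc hc'
      exact h (c - t) hc ⟨by linarith, by linarith⟩
  rw [blkSize, this, ncard_image_of_injective _ (add_left_injective t), blkSize]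

theorem ncard_shiftSet_Ioc (t x y : ℝ) :
    (shiftSet t S ∩ Ioc x y).ncard = (S ∩ Ioc (x - t) (y - t)).ncard := by
  have : shiftSet t S ∩ Ioc x y = (fun s => s + t) '' (S ∩ Ioc (x - t) (y - t)) := by
    rw [← shiftSet_eq_image]
    ext q
    simp [mem_shiftSet]
  rw [this, ncard_image_of_injective _ (add_left_injective t)]

theorem LocFin.shiftSet (hS : LocFin S) (t : ℝ) : LocFin (shiftSet t S) := by
  intro a b
  rw [shiftSet_eq_image]
  refine ((hS (a - t) (b - t)).image (fun s => s + t)).subset ?_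
  rintro _ ⟨⟨s, hs, rfl⟩, h1, h2⟩
  exact ⟨s, ⟨hs, by simp only at h1; linarith, by simp only at h2; linarith⟩, rfl⟩

/-- After the translation the labels are counted from the point that was `-t` before. -/
theorem lab_shiftSet (hS : LocFin S) (t s : ℝ) :
    lab (shiftSet t S) s = lab S (s - t) - lab S (-t) := by
  have h0 : ∀ U : Set ℝ, lab U 0 = 0 := fun U => by simp [lab]
  rcases le_total 0 s with h | h
  · have e1 := lab_sub_lab (hS.shiftSet t) h
    have e2 := lab_sub_lab hS (x := -t) (y := s - t) (by linarith)
    simp only [ncard_shiftSet_Ioc, h0, zero_sub] at e1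
    omega
  · have e1 := lab_sub_lab (hS.shiftSet t) h
    have e2 := lab_sub_lab hS (x := s - t) (y := -t) (by linarith)
    simp only [ncard_shiftSet_Ioc, h0, zero_sub] at e1
    omega

theorem encSet_shiftSet (t : ℝ) : encSet C (shiftSet t S) = shiftSet t (encSet C S) := by
  rw [encSet, move_shiftSet, encSet]
  congr 2
  funext a
  rw [encPos, encPos, blkSize_shiftSet, ratio_shiftSet, add_sub_cancel_right]

theorem slot_shiftSet (hS : LocFin S) {t a : ℝ} {i : ℤ} :
    Slot (shiftSet t S) i a ↔ Slot S (i + lab S (-t)) (a - t) := by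
  unfold Slot
  rw [isHead_shiftSet, lab_shiftSet hS, blkSize_shiftSet]
  refine and_congr Iff.rfl (and_congr ?_ ?_)
  · constructor <;> intro <;> omega
  · constructor <;> intro <;> omega

/-- A mark depends on the position `i - lab a` in its block, a difference of labels, which does not
see the origin. -/
theorem encMarks_shiftSet (hS : LocFin S) (t : ℝ) (i : ℤ) :
    encMarks C a₀ (shiftSet t S) i = encMarks C a₀ S (i + lab (encSet C S) (-t)) := by
  by_cases h : ∃ a, Slot (encSet C (shiftSet t S)) i a
  · obtain ⟨a, h⟩ := h
    have h' := h
    rw [encSet_shiftSet, slot_shiftSet (hS.encSet C)] at h'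
    rw [encMarks_of_slot C a₀ (hS.shiftSet t) h, encMarks_of_slot C a₀ hS h', blkSize_shiftSet,
      ratio_shiftSet, encSet_shiftSet, lab_shiftSet (hS.encSet C), sub_sub_eq_add_sub]
  · rw [encMarks_of_not C a₀ h, encMarks_of_not]
    rintro ⟨a, h'⟩
    refine h ⟨a + t, ?_⟩
    rw [encSet_shiftSet, slot_shiftSet (hS.encSet C)]
    simpa using h'

/-! ### Coding in some cells -/

open Classical in
/-- The new relative position in the triple that starts at `a`, if only the triples
that start in the unit cells `[n, n + 1)`, `n ∈ F`, are used. -/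
def partPos (F : Set ℤ) (S : Set ℝ) (a : ℝ) : ℝ :=
  if ⌊a⌋ ∈ F then encPos C S a else ratio S a

def partSet (F : Set ℤ) (S : Set ℝ) : Set ℝ := move S (partPos C F S)

/-- The head `a` in the cell `p.1` owns at least `p.2 + 1` points. -/
def Owns (S : Set ℝ) (p : ℤ × ℕ) (a : ℝ) : Prop := IsHead S a ∧ ⌊a⌋ = p.1 ∧ p.2 < blkSize S a

open Classical in
/-- Marks indexed by cells and positions in blocks; the marks in the cells of `F` are
replaced by those that are encoded in `S`. -/
def partMarks (F : Set ℤ) (S : Set ℝ) (m : ℤ × ℕ → A) (p : ℤ × ℕ) : A :=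
  if h : p.1 ∈ F ∧ ∃ a, Owns S p a then
    (C.enc (blkSize S h.2.choose) (ratio S h.2.choose)).2 p.2
  else m p

/-- A unit cell contains at most one head, so a cell and a position in a block form an address for a
mark that does not depend on the labels. -/
theorem IsHead.eq_of_floor {a b : ℝ} (ha : IsHead S a) (hb : IsHead S b) (h : ⌊a⌋ = ⌊b⌋) :
    a = b := by
  have h1 := abs_lt.1 (Int.abs_sub_lt_one_of_floor_eq_floor h)
  rcases lt_trichotomy a b with hlt | h | hlt
  · have := ha.add_two_lt hb hlt
    linarith [h1.1]
  · exact h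
  · have := hb.add_two_lt ha hlt
    linarith [h1.2]

theorem partPos_mem (F : Set ℤ) (S : Set ℝ) (a : ℝ) : partPos C F S a ∈ Ioo (0 : ℝ) 1 := by
  unfold partPos
  split_ifs
  · exact encPos_mem C S a
  · exact ratio_mem S a

theorem LocFin.partSet (hS : LocFin S) (F : Set ℤ) : LocFin (partSet C F S) :=
  hS.move (partPos_mem C F S)

theorem isHead_partSet_iff {F : Set ℤ} {a : ℝ} : IsHead (partSet C F S) a ↔ IsHead S a :=
  isHead_move_iff (partPos_mem C F S)

theorem blkSize_partSet {F : Set ℤ} {a : ℝ} (h : IsHead S a) :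
    blkSize (partSet C F S) a = blkSize S a :=
  blkSize_move h (partPos_mem C F S)

theorem owns_partSet_iff {F : Set ℤ} {p : ℤ × ℕ} {a : ℝ} :
    Owns (partSet C F S) p a ↔ Owns S p a := by
  unfold Owns
  rw [isHead_partSet_iff]
  refine and_congr_right fun h => ?_
  rw [blkSize_partSet C h]

theorem partMarks_of_owns {F : Set ℤ} {p : ℤ × ℕ} {a : ℝ} (hp : p.1 ∈ F) (h : Owns S p a)
    (m : ℤ × ℕ → A) : partMarks C F S m p = (C.enc (blkSize S a) (ratio S a)).2 p.2 := by
  have h0 : p.1 ∈ F ∧ ∃ a, Owns S p a := ⟨hp, a, h⟩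
  have e := h0.2.choose_spec.1.eq_of_floor h.1 (h0.2.choose_spec.2.1.trans h.2.1.symm)
  rw [partMarks, dif_pos h0, e]

theorem partMarks_of_not {F : Set ℤ} {p : ℤ × ℕ} (h : ¬ (p.1 ∈ F ∧ ∃ a, Owns S p a))
    (m : ℤ × ℕ → A) : partMarks C F S m p = m p := dif_neg h

/-- The cells do not interfere: coding in `F` leaves the ratio of the triple that starts in cell `n`
and all block sizes as they were, so cell `n` encodes the same data as before. -/
theorem partSet_partSet {n : ℤ} {F : Set ℤ} (hn : n ∉ F) :
    partSet C {n} (partSet C F S) = partSet C (insert n F) S := by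
  rw [partSet, partSet, move_move (partPos_mem C F S), partSet]
  refine move_congr fun a ha => ?_
  have e1 : blkSize (move S (partPos C F S)) a = blkSize S a := blkSize_partSet C ha
  have e2 := ratio_move ha (partPos_mem C F S)
  unfold partPos at *
  by_cases h : ⌊a⌋ = n
  · have h' : ⌊a⌋ ∉ F := h ▸ hn
    simp only [h, mem_singleton_iff, mem_insert_iff, true_or, if_true]
    rw [encPos, e1, e2, if_neg h', encPos]
  · by_cases h' : ⌊a⌋ ∈ F
    · simp only [mem_singleton_iff, h, if_false, mem_insert_iff, h', or_true, if_true]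
      rw [e2, if_pos h']
    · simp only [mem_singleton_iff, h, if_false, mem_insert_iff, h', or_false]
      rw [e2, if_neg h']

theorem partMarks_partMarks {n : ℤ} {F : Set ℤ} (hn : n ∉ F) (m : ℤ × ℕ → A) :
    partMarks C {n} (partSet C F S) (partMarks C F S m) = partMarks C (insert n F) S m := by
  funext p
  by_cases ho : ∃ a, Owns S p a
  · obtain ⟨a, ho⟩ := ho
    by_cases h : p.1 = n
    · rw [partMarks_of_owns C h ((owns_partSet_iff C).2 ho), partMarks_of_owns C (Or.inl h) ho,
        blkSize_partSet C ho.1]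
      have h' : ⌊a⌋ ∉ F := by rw [ho.2.1, h]; exact hn
      have : ratio (partSet C F S) a = _ := ratio_move ho.1 (partPos_mem C F S)
      rw [this, partPos, if_neg h']
    · rw [partMarks_of_not C (fun h' => h h'.1)]
      by_cases h' : p.1 ∈ F
      · rw [partMarks_of_owns C h' ho, partMarks_of_owns C (Or.inr h') ho]
      · rw [partMarks_of_not C (fun h'' => h' h''.1), partMarks_of_not C]
        rintro ⟨h1 | h1, -⟩
        exacts [h h1, h' h1]
  · rw [partMarks_of_not C, partMarks_of_not C, partMarks_of_not C]
    · exact fun h => ho h.2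
    · exact fun h => ho h.2
    · rintro ⟨-, a, h⟩
      exact ho ⟨a, (owns_partSet_iff C).1 h⟩

theorem partSet_univ : partSet C univ S = encSet C S := by
  rw [partSet, encSet]
  congr 1
  funext a
  rw [partPos, if_pos (mem_univ _)]

/-- Every address that is read was overwritten by an encoded mark, so the auxiliary marks `m`
disappear. -/
theorem readMarks_partMarks_univ (hS : LocFin S) (m : ℤ × ℕ → A) :
    readMarks a₀ (encSet C S) (partMarks C univ S m) = encMarks C a₀ S := by
  funext i
  by_cases h : ∃ a, Slot (encSet C S) i a
  · obtain ⟨a, h⟩ := h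
    have ha : IsHead S a := (isHead_encSet_iff C).1 h.1
    have ho : Owns S (⌊a⌋, (i - lab (encSet C S) a).toNat) a := by
      refine ⟨ha, rfl, ?_⟩
      have h1 := h.2.1
      have h2 := h.2.2
      rw [blkSize_encSet C ha] at h2
      simp only
      omega
    rw [readMarks_of_slot a₀ (hS.encSet C) h, encMarks_of_slot C a₀ hS h,
      partMarks_of_owns C (mem_univ _) ho]
  · rw [readMarks_of_not a₀ h, encMarks_of_not C a₀ h]

end Code

/-! ### Point measures as locally finite sets. -/

theorem measurableSet_and {X : Type*} [MeasurableSpace X] {p q : X → Prop}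
    (hp : MeasurableSet {x | p x}) (hq : MeasurableSet {x | q x}) :
    MeasurableSet {x | p x ∧ q x} := hp.inter hq

namespace PointMeasure

/-- The underlying measure. -/
def toMeasure (μ : PointMeasure) : Measure ℝ := μ.1

theorem exists_points (μ : PointMeasure) : LocFin μ.points ∧
    ∀ B, MeasurableSet B → μ.toMeasure B = ((μ.points ∩ B).encard : ℝ≥0∞) := by
  obtain ⟨S, hS, h⟩ := μ.2
  have e : μ.points = S := by
    ext p
    have h' := h _ (measurableSet_singleton p)
    rw [points, mem_ofPred_eq]
    change μ.1 {p} ≠ 0 ↔ _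
    rw [h']
    by_cases hp : p ∈ S
    · simp [hp, inter_eq_self_of_subset_right (singleton_subset_iff.2 hp)]
    · simp [hp]
  rw [e]
  exact ⟨hS, h⟩

theorem locFin (μ : PointMeasure) : LocFin μ.points := μ.exists_points.1

theorem apply_eq (μ : PointMeasure) {B : Set ℝ} (hB : MeasurableSet B) :
    μ.toMeasure B = ((μ.points ∩ B).encard : ℝ≥0∞) := μ.exists_points.2 B hB

theorem ext_points {μ ν : PointMeasure} (h : μ.points = ν.points) : μ = ν := by
  refine Subtype.ext (Measure.ext fun B hB => ?_)
  change μ.toMeasure B = ν.toMeasure B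
  rw [μ.apply_eq hB, ν.apply_eq hB, h]

end PointMeasure

theorem LocFin.countable {S : Set ℝ} (hS : LocFin S) : S.Countable := by
  have : S = ⋃ n : ℕ, S ∩ Icc (-(n : ℝ)) n := by
    ext s
    simp only [mem_iUnion, mem_inter_iff, mem_Icc]
    constructor
    · intro hs
      obtain ⟨n, hn⟩ := exists_nat_ge |s|
      exact ⟨n, hs, abs_le.1 hn⟩
    · rintro ⟨n, hs, -⟩
      exact hs
  rw [this]
  exact countable_iUnion fun n => (hS _ _).countable

/-- The point measure with the given set of points. -/
def ofSet (S : Set ℝ) (hS : LocFin S) : PointMeasure :=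
  ⟨Measure.count.restrict S, S, hS, fun B hB => by
    rw [Measure.restrict_apply hB, Measure.count_apply (hB.inter hS.countable.measurableSet),
      inter_comm]⟩

theorem points_ofSet {S : Set ℝ} (hS : LocFin S) : (ofSet S hS).points = S := by
  ext p
  rw [PointMeasure.points, mem_ofPred_eq]
  change (Measure.count.restrict S) {p} ≠ 0 ↔ _
  rw [Measure.restrict_apply (measurableSet_singleton p),
    Measure.count_apply ((measurableSet_singleton p).inter hS.countable.measurableSet)]
  by_cases hp : p ∈ S
  · simp [hp]
  · simp [hp]

theorem ofSet_congr {S T : Set ℝ} (h : S = T) (hS : LocFin S) (hT : LocFin T) :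
    ofSet S hS = ofSet T hT := by
  subst h; rfl

theorem agreeOn_iff {μ ν : PointMeasure} {I : Set ℝ} (hI : MeasurableSet I) :
    μ.AgreeOn ν I ↔ μ.points ∩ I = ν.points ∩ I := by
  constructor
  · intro h
    have key : ∀ p ∈ I, (p ∈ μ.points ↔ p ∈ ν.points) := by
      intro p hp
      have := congrArg (fun m : Measure ℝ => m {p}) h
      simp only [Measure.restrict_apply (measurableSet_singleton p),
        inter_eq_self_of_subset_left (singleton_subset_iff.2 hp)] at this
      simp only [PointMeasure.points, mem_ofPred_eq, this]
    ext p
    exact and_congr_left fun hp => key p hp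
  · intro h
    refine Measure.ext fun B hB => ?_
    change μ.toMeasure.restrict I B = ν.toMeasure.restrict I B
    rw [Measure.restrict_apply hB, Measure.restrict_apply hB, μ.apply_eq (hB.inter hI),
      ν.apply_eq (hB.inter hI), inter_comm B, ← inter_assoc, h, inter_assoc]

theorem points_translate (t : ℝ) (μ : PointMeasure) :
    (μ.translate t).points = shiftSet t μ.points := by
  ext p
  have hm : Measurable (fun s : ℝ => s + t) := by fun_prop
  rw [mem_shiftSet]
  simp only [PointMeasure.points, mem_ofPred_eq, PointMeasure.translate,
    Measure.map_apply hm (measurableSet_singleton p)]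
  have : (fun s : ℝ => s + t) ⁻¹' {p} = {p - t} := by
    ext s; simp only [mem_preimage, mem_singleton_iff]; exact eq_sub_iff_add_eq.symm
  rw [this]

theorem label_eq_lab (μ : PointMeasure) (s : ℝ) : μ.label s = lab μ.points s := rfl

/-! ### Measurability -/

theorem measurable_val : Measurable (fun μ : PointMeasure => μ.toMeasure) := measurable_subtype_coe

/-- A point measure as a kernel. -/
def pointKernel : Kernel PointMeasure ℝ := ⟨fun μ => μ.toMeasure, measurable_val⟩

theorem pointKernel_apply (μ : PointMeasure) : pointKernel μ = μ.toMeasure := rfl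

theorem measurable_apply {B : Set ℝ} (hB : MeasurableSet B) :
    Measurable (fun μ : PointMeasure => μ.toMeasure B) := (Measure.measurable_coe hB).comp measurable_val

theorem apply_Ico_lt_top (μ : PointMeasure) (n : ℤ) : ∃ k : ℕ, μ.toMeasure (Ico (n : ℝ) (n + 1)) = k := by
  have hf := μ.locFin.finite_of_subset (T := Ico (n : ℝ) (n + 1)) Ico_subset_Icc_self
  refine ⟨(μ.points ∩ Ico (n : ℝ) (n + 1)).ncard, ?_⟩
  rw [μ.apply_eq measurableSet_Ico, ← hf.cast_ncard_eq]
  simp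

theorem measurableSet_cell_eq (p : ℤ × ℕ) :
    MeasurableSet {μ : PointMeasure | μ.toMeasure (Ico (p.1 : ℝ) (p.1 + 1)) = p.2} :=
  measurable_apply measurableSet_Ico (measurableSet_singleton _)

/-- The restriction of a point measure to a unit cell with a given number of points. -/
def cellKernel (p : ℤ × ℕ) : Kernel PointMeasure ℝ := by
  classical
  exact Kernel.piecewise (measurableSet_cell_eq p)
    (pointKernel.restrict (measurableSet_Ico (a := (p.1 : ℝ)) (b := p.1 + 1))) 0

instance (p : ℤ × ℕ) : IsFiniteKernel (cellKernel p) := by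
  refine ⟨⟨p.2, by simp, fun μ => ?_⟩⟩
  classical
  rw [cellKernel, Kernel.piecewise_apply]
  split_ifs with h
  · rw [Kernel.restrict_apply, Measure.restrict_apply_univ]
    exact le_of_eq h
  · simp

/-- Finite kernels need a uniform bound on their mass, so the cells are also split by their number
of points. The resulting s-finiteness gives joint measurability in `measurable_apply_setOf`. -/
theorem sum_cellKernel : Kernel.sum cellKernel = pointKernel := by
  ext μ B hB
  have h1 : ∀ n : ℤ, ∑' k : ℕ, cellKernel (n, k) μ B = μ.toMeasure (B ∩ Ico (n : ℝ) (n + 1)) := by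
    intro n
    obtain ⟨k, hk⟩ := apply_Ico_lt_top μ n
    rw [tsum_eq_single k]
    · classical
      rw [cellKernel, Kernel.piecewise_apply, if_pos (show μ ∈ _ from hk), Kernel.restrict_apply,
        Measure.restrict_apply hB, pointKernel_apply]
    · intro j hj
      classical
      rw [cellKernel, Kernel.piecewise_apply, if_neg]
      · simp
      · intro h
        have : (k : ℝ≥0∞) = j := hk.symm.trans h
        exact hj (by exact_mod_cast this.symm)
  rw [Kernel.sum_apply' _ _ hB, ENNReal.tsum_prod (f := fun n k => cellKernel (n, k) μ B)]
  simp_rw [h1]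
  rw [pointKernel_apply, ← measure_iUnion]
  · rw [← inter_iUnion, iUnion_Ico_intCast, inter_univ]
  · intro i j hij
    exact (pairwise_disjoint_Ico_intCast ℝ hij).mono inter_subset_right inter_subset_right
  · exact fun n => hB.inter measurableSet_Ico

instance : IsSFiniteKernel pointKernel := by
  rw [← sum_cellKernel]
  infer_instance

section

variable {X : Type*} [MeasurableSpace X] {π : X → PointMeasure}

theorem measurable_apply_setOf (hπ : Measurable π) {p : X → ℝ → Prop}
    (hp : MeasurableSet {z : X × ℝ | p z.1 z.2}) : Measurable fun x => (π x).toMeasure {s | p x s} :=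
  Kernel.measurable_kernel_prodMk_left (κ := pointKernel.comap π hπ) hp

theorem measurableSet_section {p : X → ℝ → Prop}
    (hp : MeasurableSet {z : X × ℝ | p z.1 z.2}) (x : X) : MeasurableSet {s | p x s} :=
  measurable_prodMk_left hp

/-- A quantifier over real numbers would not preserve measurability, but one over points does: it
says that the counting measure of a section is not zero. -/
theorem measurableSet_exists (hπ : Measurable π) {p : X → ℝ → Prop}
    (hp : MeasurableSet {z : X × ℝ | p z.1 z.2}) :
    MeasurableSet {x | ∃ s ∈ (π x).points, p x s} := by
  have : {x | ∃ s ∈ (π x).points, p x s} = {x | (π x).toMeasure {s | p x s} = 0}ᶜ := by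
    ext x
    simp only [mem_compl_iff, mem_ofPred_eq]
    rw [(π x).apply_eq (measurableSet_section hp x)]
    simp only [ENat.toENNReal_eq_zero, encard_eq_zero, ← ne_eq, ← nonempty_iff_ne_empty]
    rfl
  rw [this]
  exact (measurable_apply_setOf hπ hp (measurableSet_singleton 0)).compl

theorem measurable_ncard (hπ : Measurable π) {p : X → ℝ → Prop}
    (hp : MeasurableSet {z : X × ℝ | p z.1 z.2}) :
    Measurable fun x => ((π x).points ∩ {s | p x s}).ncard := by
  -- The conventions for infinite sets match: `ncard` and `ENNReal.toReal ∞` are both zero.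
  have : (fun x => ((π x).points ∩ {s | p x s}).ncard) =
      fun x => ⌊((π x).toMeasure {s | p x s}).toReal⌋₊ := by
    funext x
    rw [(π x).apply_eq (measurableSet_section hp x), ncard]
    cases h : ((π x).points ∩ {s | p x s}).encard <;> simp
  rw [this]
  exact Nat.measurable_floor.comp (measurable_apply_setOf hπ hp).ennreal_toReal

theorem measurableSet_mem_points (hπ : Measurable π) {f : X → ℝ} (hf : Measurable f) :
    MeasurableSet {x | f x ∈ (π x).points} := by
  have : {x | f x ∈ (π x).points} = {x | ∃ s ∈ (π x).points, s = f x} := by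
    ext x; simp
  rw [this]
  exact measurableSet_exists hπ (measurableSet_eq_fun (by fun_prop) (by fun_prop))

theorem measurable_pointMeasure {f : X → PointMeasure}
    (h : ∀ B, MeasurableSet B → Measurable fun x => (f x).toMeasure B) : Measurable f :=
  (Measure.measurable_of_measurable_coe _ h).subtype_mk

/-- A function that is given by a choice of a point is measurable. -/
theorem measurable_of_select {Y : Type*} [MeasurableSpace Y] (hπ : Measurable π) {g : X → Y}
    {p : X → ℝ → Prop} (hp : MeasurableSet {z : X × ℝ | p z.1 z.2}) {val : X × ℝ → Y}
    (hval : Measurable val) {y : X → Y} (hy : Measurable y)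
    (h : ∀ x a, p x a → a ∈ (π x).points ∧ g x = val (x, a))
    (h0 : ∀ x, (¬ ∃ a, p x a) → g x = y x) : Measurable g := by
  intro B hB
  -- No measurable selection is needed: every admissible `a` gives the same value, so the preimage
  -- is a quantifier over points.
  have : g ⁻¹' B = {x | ∃ a ∈ (π x).points, p x a ∧ val (x, a) ∈ B} ∪
      ({x | ∃ a ∈ (π x).points, p x a}ᶜ ∩ y ⁻¹' B) := by
    ext x
    simp only [mem_preimage, mem_union, mem_ofPred_eq, mem_inter_iff, mem_compl_iff]
    by_cases hx : ∃ a, p x a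
    · obtain ⟨a, ha⟩ := hx
      obtain ⟨h1, h2⟩ := h x a ha
      constructor
      · intro h3
        exact Or.inl ⟨a, h1, ha, h2 ▸ h3⟩
      · rintro (⟨c, -, hc, hc'⟩ | ⟨h3, -⟩)
        · rwa [(h x c hc).2]
        · exact absurd ⟨a, h1, ha⟩ h3
    · rw [h0 x hx]
      constructor
      · exact fun h3 => Or.inr ⟨fun ⟨a, _, ha⟩ => hx ⟨a, ha⟩, h3⟩
      · rintro (⟨c, -, hc, hc'⟩ | ⟨-, h3⟩)
        · exact absurd ⟨c, hc⟩ hx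
        · exact h3
  rw [this]
  refine MeasurableSet.union ?_ ((measurableSet_exists hπ hp).compl.inter (hy hB))
  exact measurableSet_exists hπ (p := fun x a => p x a ∧ val (x, a) ∈ B) (hp.inter (hval hB))

theorem measurableSet_trip (hπ : Measurable π) {f g h : X → ℝ} (hf : Measurable f)
    (hg : Measurable g) (hh : Measurable h) :
    MeasurableSet {x | Trip (π x).points (f x) (g x) (h x)} := by
  have : {x | Trip (π x).points (f x) (g x) (h x)} =
      {x | f x < g x} ∩ {x | g x < h x} ∩ {x | h x ≤ f x + 1} ∩
      {x | f x ∈ (π x).points} ∩ {x | g x ∈ (π x).points} ∩ {x | h x ∈ (π x).points} ∩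
      {x | ∃ s ∈ (π x).points, f x - 1 ≤ s ∧ s ≤ f x + 2 ∧ s ≠ f x ∧ s ≠ g x ∧ s ≠ h x}ᶜ := by
    ext x
    simp only [mem_inter_iff, mem_ofPred_eq, mem_compl_iff]
    constructor
    · intro ht
      refine ⟨⟨⟨⟨⟨⟨ht.1, ht.2.1⟩, ht.2.2.1⟩, ht.mem_left⟩, ht.mem_mid⟩, ht.mem_right⟩, ?_⟩
      rintro ⟨s, hs, h1, h2, h3, h4, h5⟩
      rcases (ht.mem_iff h1 h2).1 hs with h | h | h
      exacts [h3 h, h4 h, h5 h]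
    · rintro ⟨⟨⟨⟨⟨⟨h1, h2⟩, h3⟩, h4⟩, h5⟩, h6⟩, h7⟩
      refine ⟨h1, h2, h3, ?_⟩
      ext s
      simp only [mem_inter_iff, mem_Icc, mem_insert_iff, mem_singleton_iff]
      constructor
      · rintro ⟨hs, hs1, hs2⟩
        by_contra hc
        push Not at hc
        exact h7 ⟨s, hs, hs1, hs2, hc.1, hc.2.1, hc.2.2⟩
      · rintro (rfl | rfl | rfl)
        · exact ⟨h4, by linarith, by linarith⟩
        · exact ⟨h5, by linarith, by linarith⟩
        · exact ⟨h6, by linarith, by linarith⟩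
  rw [this]
  refine MeasurableSet.inter (MeasurableSet.inter (MeasurableSet.inter (MeasurableSet.inter
    (MeasurableSet.inter (MeasurableSet.inter (measurableSet_lt hf hg) (measurableSet_lt hg hh))
    (measurableSet_le hh (hf.add_const 1))) (measurableSet_mem_points hπ hf))
    (measurableSet_mem_points hπ hg)) (measurableSet_mem_points hπ hh))
    (measurableSet_exists hπ ?_).compl
  refine measurableSet_and ?_ (measurableSet_and ?_ (measurableSet_and ?_ (measurableSet_and ?_ ?_)))
  · exact measurableSet_le (by fun_prop) (by fun_prop)
  · exact measurableSet_le (by fun_prop) (by fun_prop)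
  all_goals exact (measurableSet_eq_fun (by fun_prop) (by fun_prop)).compl

theorem measurableSet_exists_trip (hπ : Measurable π) {f : X → ℝ} (hf : Measurable f)
    {p : X → ℝ → ℝ → Prop} (hp : MeasurableSet {z : (X × ℝ) × ℝ | p z.1.1 z.1.2 z.2}) :
    MeasurableSet {x | ∃ m b, Trip (π x).points (f x) m b ∧ p x m b} := by
  have : {x | ∃ m b, Trip (π x).points (f x) m b ∧ p x m b} = {x | ∃ m ∈ (π x).points,
      ∃ b ∈ (π x).points, Trip (π x).points (f x) m b ∧ p x m b} := by
    ext x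
    constructor
    · rintro ⟨m, b, h, h'⟩
      exact ⟨m, h.mem_mid, b, h.mem_right, h, h'⟩
    · rintro ⟨m, -, b, -, h⟩
      exact ⟨m, b, h⟩
  rw [this]
  refine measurableSet_exists hπ (p := fun x m => ∃ b ∈ (π x).points,
    Trip (π x).points (f x) m b ∧ p x m b) ?_
  refine measurableSet_exists (π := fun z : X × ℝ => π z.1) (by fun_prop)
    (p := fun z b => Trip (π z.1).points (f z.1) z.2 b ∧ p z.1 z.2 b) ?_
  exact (measurableSet_trip (π := fun z : (X × ℝ) × ℝ => π z.1.1) (by fun_prop)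
    (by fun_prop) (by fun_prop) (by fun_prop)).inter hp

theorem measurableSet_exists_trip_mid (hπ : Measurable π) {f : X → ℝ} (hf : Measurable f)
    {p : X → ℝ → ℝ → Prop} (hp : MeasurableSet {z : (X × ℝ) × ℝ | p z.1.1 z.1.2 z.2}) :
    MeasurableSet {x | ∃ a b, Trip (π x).points a (f x) b ∧ p x a b} := by
  have : {x | ∃ a b, Trip (π x).points a (f x) b ∧ p x a b} = {x | ∃ a ∈ (π x).points,
      ∃ b ∈ (π x).points, Trip (π x).points a (f x) b ∧ p x a b} := by
    ext x
    constructor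
    · rintro ⟨m, b, h, h'⟩
      exact ⟨m, h.mem_left, b, h.mem_right, h, h'⟩
    · rintro ⟨m, -, b, -, h⟩
      exact ⟨m, b, h⟩
  rw [this]
  refine measurableSet_exists hπ (p := fun x a => ∃ b ∈ (π x).points,
    Trip (π x).points a (f x) b ∧ p x a b) ?_
  refine measurableSet_exists (π := fun z : X × ℝ => π z.1) (by fun_prop)
    (p := fun z b => Trip (π z.1).points z.2 (f z.1) b ∧ p z.1 z.2 b) ?_
  exact (measurableSet_trip (π := fun z : (X × ℝ) × ℝ => π z.1.1) (by fun_prop)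
    (by fun_prop) (by fun_prop) (by fun_prop)).inter hp

theorem measurableSet_isHead (hπ : Measurable π) {f : X → ℝ} (hf : Measurable f) :
    MeasurableSet {x | IsHead (π x).points (f x)} := by
  have := measurableSet_exists_trip hπ hf (p := fun _ _ _ => True) MeasurableSet.univ
  simpa only [and_true] using! this

theorem measurable_ratio (hπ : Measurable π) {f : X → ℝ} (hf : Measurable f) :
    Measurable fun x => ratio (π x).points (f x) := by
  intro B hB
  have : (fun x => ratio (π x).points (f x)) ⁻¹' B =
      {x | ∃ m b, Trip (π x).points (f x) m b ∧ (m - f x) / (b - f x) ∈ B} ∪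
      ({x | IsHead (π x).points (f x)}ᶜ ∩ {_x | (1 / 2 : ℝ) ∈ B}) := by
    ext x
    simp only [mem_preimage, mem_union, mem_ofPred_eq, mem_inter_iff, mem_compl_iff]
    by_cases hx : IsHead (π x).points (f x)
    · obtain ⟨m, b, h⟩ := id hx
      rw [h.ratio_eq]
      constructor
      · exact fun h' => Or.inl ⟨m, b, h, h'⟩
      · rintro (⟨m', b', h1, h2⟩ | h1)
        · obtain ⟨rfl, rfl⟩ := h.eq_of_left h1
          exact h2
        · exact absurd hx h1.1
    · rw [ratio_of_not hx]
      constructor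
      · exact fun h => Or.inr ⟨hx, h⟩
      · rintro (⟨m', b', h1, h2⟩ | h1)
        · exact absurd h1.isHead hx
        · exact h1.2
  rw [this]
  refine (measurableSet_exists_trip hπ hf ?_).union
    ((measurableSet_isHead hπ hf).compl.inter (MeasurableSet.const _))
  have : Measurable fun z : (X × ℝ) × ℝ => (z.1.2 - f z.1.1) / (z.2 - f z.1.1) := by fun_prop
  exact this hB

theorem measurable_blkSize (hπ : Measurable π) {f : X → ℝ} (hf : Measurable f) :
    Measurable fun x => blkSize (π x).points (f x) := by
  refine measurable_ncard hπ (p := fun x q => f x ≤ q ∧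
    ∀ c, IsHead (π x).points c → ¬ (f x < c ∧ c ≤ q)) ?_
  refine (measurableSet_le (f := fun z : X × ℝ => f z.1) (by fun_prop) measurable_snd).inter ?_
  have : {z : X × ℝ | ∀ c, IsHead (π z.1).points c → ¬ (f z.1 < c ∧ c ≤ z.2)} =
      {z : X × ℝ | ∃ c ∈ (π z.1).points, IsHead (π z.1).points c ∧ f z.1 < c ∧ c ≤ z.2}ᶜ := by
    ext z
    simp only [mem_ofPred_eq, mem_compl_iff]
    constructor
    · rintro h ⟨c, -, h1, h2⟩
      exact h c h1 h2
    · intro h c h1 h2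
      exact h ⟨c, h1.mem, h1, h2⟩
  change MeasurableSet {z : X × ℝ | ∀ c, IsHead (π z.1).points c → ¬ (f z.1 < c ∧ c ≤ z.2)}
  rw [this]
  refine (measurableSet_exists (π := fun z : X × ℝ => π z.1) (by fun_prop)
    (p := fun z c => IsHead (π z.1).points c ∧ f z.1 < c ∧ c ≤ z.2) ?_).compl
  refine measurableSet_and ?_ (measurableSet_and ?_ ?_)
  · exact measurableSet_isHead (π := fun z : (X × ℝ) × ℝ => π z.1.1) (by fun_prop)
      (f := fun z => z.2) (by fun_prop)
  · exact measurableSet_lt (by fun_prop) (by fun_prop)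
  · exact measurableSet_le (by fun_prop) (by fun_prop)

theorem measurable_lab (hπ : Measurable π) {f : X → ℝ} (hf : Measurable f) :
    Measurable fun x => lab (π x).points (f x) := by
  unfold lab
  refine Measurable.sub ?_ ?_
  · refine (measurable_from_top (f := fun n : ℕ => (n : ℤ))).comp
      (measurable_ncard hπ (p := fun x q => 0 < q ∧ q ≤ f x) ?_)
    refine measurableSet_and ?_ ?_
    · exact measurableSet_lt (by fun_prop) (by fun_prop)
    · exact measurableSet_le (by fun_prop) (by fun_prop)
  · refine (measurable_from_top (f := fun n : ℕ => (n : ℤ))).comp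
      (measurable_ncard hπ (p := fun x q => f x < q ∧ q ≤ 0) ?_)
    refine measurableSet_and ?_ ?_
    · exact measurableSet_lt (by fun_prop) (by fun_prop)
    · exact measurableSet_le (by fun_prop) (by fun_prop)

theorem measurableSet_slot (hπ : Measurable π) {f : X → ℝ} (hf : Measurable f) (i : ℤ) :
    MeasurableSet {x | Slot (π x).points i (f x)} := by
  have h1 := measurable_lab hπ hf
  have h2 := measurable_blkSize hπ hf
  refine (measurableSet_isHead hπ hf).inter (MeasurableSet.inter ?_ ?_)
  · exact measurableSet_le h1 measurable_const
  · exact measurableSet_lt measurable_const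
      (h1.add ((measurable_from_top (f := fun n : ℕ => (n : ℤ))).comp h2))

theorem measurable_shiftMid (hπ : Measurable π) {f : X → ℝ} (hf : Measurable f)
    {v : X → ℝ → ℝ} (hv : Measurable fun z : X × ℝ => v z.1 z.2) :
    Measurable fun x => shiftMid (π x).points (v x) (f x) := by
  intro B hB
  have : (fun x => shiftMid (π x).points (v x) (f x)) ⁻¹' B =
      {x | ∃ a b, Trip (π x).points a (f x) b ∧ a + (b - a) * v x a ∈ B} ∪
      ({x | ∃ a b, Trip (π x).points a (f x) b ∧ True}ᶜ ∩ f ⁻¹' B) := by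
    ext x
    simp only [mem_preimage, mem_union, mem_ofPred_eq, mem_inter_iff, mem_compl_iff, and_true]
    by_cases hx : ∃ a b, Trip (π x).points a (f x) b
    · obtain ⟨a, b, h⟩ := id hx
      rw [h.shiftMid_eq]
      constructor
      · exact fun h' => Or.inl ⟨a, b, h, h'⟩
      · rintro (⟨m', b', h1, h2⟩ | h1)
        · obtain ⟨rfl, rfl⟩ := h.eq_of_mid h1
          exact h2
        · exact absurd hx h1.1
    · rw [shiftMid_of_not _ hx]
      constructor
      · exact fun h => Or.inr ⟨hx, h⟩
      · rintro (⟨m', b', h1, h2⟩ | h1)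
        · exact absurd ⟨_, _, h1⟩ hx
        · exact h1.2
  rw [this]
  refine (measurableSet_exists_trip_mid hπ hf ?_).union
    ((measurableSet_exists_trip_mid hπ hf (p := fun _ _ _ => True) MeasurableSet.univ).compl.inter (hf hB))
  have h1 : Measurable fun z : (X × ℝ) × ℝ => v z.1.1 z.1.2 :=
    hv.comp (measurable_fst.fst.prodMk measurable_fst.snd)
  have : Measurable fun z : (X × ℝ) × ℝ => z.1.2 + (z.2 - z.1.2) * v z.1.1 z.1.2 := by fun_prop
  exact this hB

/-- By injectivity of `shiftMid`, the count of the moved set in `B` is the count of original points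
that are sent into `B`. -/
theorem measurable_ofSet_move (hπ : Measurable π) {v : X → ℝ → ℝ}
    (hv : Measurable fun z : X × ℝ => v z.1 z.2) (hv' : ∀ x a, v x a ∈ Ioo (0 : ℝ) 1) :
    Measurable fun x => ofSet (move (π x).points (v x)) ((π x).locFin.move (hv' x)) := by
  refine measurable_pointMeasure fun B hB => ?_
  have hm : MeasurableSet {z : X × ℝ | shiftMid (π z.1).points (v z.1) z.2 ∈ B} := by
    refine measurable_shiftMid (π := fun z : X × ℝ => π z.1) (by fun_prop) measurable_snd
      (v := fun z => v z.1) ?_ hB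
    exact hv.comp (measurable_fst.fst.prodMk measurable_snd)
  convert measurable_apply_setOf hπ (p := fun x s => shiftMid (π x).points (v x) s ∈ B) hm using 2
    with x
  rw [PointMeasure.apply_eq _ hB, points_ofSet,
    PointMeasure.apply_eq _ (measurableSet_section
      (p := fun x s => shiftMid (π x).points (v x) s ∈ B) hm x)]
  congr 1
  have : move (π x).points (v x) ∩ B = shiftMid (π x).points (v x) ''
      ((π x).points ∩ {s | shiftMid (π x).points (v x) s ∈ B}) := by
    exact (image_inter_preimage _ _ _).symm
  rw [this, ((injOn_shiftMid (hv' x)).mono inter_subset_left).encard_image]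

end

/-! ### The encoder and the decoder on point measures. -/

section Maps

variable {A : Type*} [MeasurableSpace A] {α : Measure A} (C : Coding α) (a₀ : A)

def encMap (μ : PointMeasure) : PointMeasure × (ℤ → A) :=
  (ofSet (encSet C μ.points) (μ.locFin.encSet C), encMarks C a₀ μ.points)

def decMap (y : PointMeasure × (ℤ → A)) : PointMeasure :=
  ofSet (decSet C y.1.points y.2) (y.1.locFin.decSet C y.2)

def partMap (F : Set ℤ) (y : PointMeasure × (ℤ × ℕ → A)) : PointMeasure × (ℤ × ℕ → A) :=
  (ofSet (partSet C F y.1.points) (y.1.locFin.partSet C F), partMarks C F y.1.points y.2)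

def readMap (y : PointMeasure × (ℤ × ℕ → A)) : PointMeasure × (ℤ → A) :=
  (y.1, readMarks a₀ y.1.points y.2)

theorem decMap_encMap (μ : PointMeasure) : decMap C (encMap C a₀ μ) = μ := by
  refine PointMeasure.ext_points ?_
  rw [decMap, points_ofSet, encMap]
  simp only [points_ofSet]
  exact decSet_encSet C a₀ μ.locFin

/-- The law of `encMap` is computed through this factorization: coding in the cells preserves a
product law, and reading only changes the indices of iid marks. -/
theorem readMap_partMap_univ (y : PointMeasure × (ℤ × ℕ → A)) :
    readMap a₀ (partMap C univ y) = encMap C a₀ y.1 := by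
  have e : ofSet (partSet C univ y.1.points) (y.1.locFin.partSet C univ) =
      ofSet (encSet C y.1.points) (y.1.locFin.encSet C) := ofSet_congr (partSet_univ C) _ _
  rw [readMap, encMap, partMap]
  simp only [e, points_ofSet]
  rw [readMarks_partMarks_univ C a₀ y.1.locFin]

theorem partMap_partMap {n : ℤ} {F : Set ℤ} (hn : n ∉ F) (y : PointMeasure × (ℤ × ℕ → A)) :
    partMap C {n} (partMap C F y) = partMap C (insert n F) y := by
  refine Prod.ext (PointMeasure.ext_points ?_) ?_
  · simp only [partMap, points_ofSet]
    exact partSet_partSet C hn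
  · simp only [partMap, points_ofSet]
    exact partMarks_partMarks C hn y.2

theorem encMap_translate (t : ℝ) (μ : PointMeasure) :
    encMap C a₀ (μ.translate t) = translateMarked t (encMap C a₀ μ) := by
  refine Prod.ext (PointMeasure.ext_points ?_) ?_
  · simp only [encMap, translateMarked, points_ofSet, points_translate]
    exact encSet_shiftSet C t
  · funext i
    simp only [encMap, translateMarked, points_translate, label_eq_lab, points_ofSet]
    exact encMarks_shiftSet C a₀ μ.locFin t i

section Measurability

variable {X : Type*} [MeasurableSpace X] {π : X → PointMeasure}

theorem measurable_floorInt {f : X → ℝ} (hf : Measurable f) : Measurable fun x => ⌊f x⌋ :=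
  Int.measurable_floor.comp hf

theorem measurable_apply_index {ι B : Type*} [Countable ι] [MeasurableSpace ι]
    [MeasurableSingletonClass ι] [MeasurableSpace B] {m : X → ι → B} (hm : Measurable m)
    {k : X → ι} (hk : Measurable k) : Measurable fun x => m x (k x) := by
  have h : Measurable fun z : ι × (ι → B) => z.2 z.1 :=
    measurable_from_prod_countable_right fun i => measurable_pi_apply i
  exact h.comp (hk.prodMk hm)

theorem measurable_enc_comp {k : X → ℕ} (hk : Measurable k) {u : X → ℝ} (hu : Measurable u) :
    Measurable fun x => C.enc (k x) (u x) := by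
  have h : Measurable fun z : ℕ × ℝ => C.enc z.1 z.2 :=
    measurable_from_prod_countable_right fun i => C.measurable_enc i
  exact h.comp (hk.prodMk hu)

theorem measurable_dec_comp {k : X → ℕ} (hk : Measurable k) {u : X → ℝ × (ℕ → A)}
    (hu : Measurable u) : Measurable fun x => C.dec (k x) (u x) := by
  have h : Measurable fun z : ℕ × (ℝ × (ℕ → A)) => C.dec z.1 z.2 :=
    measurable_from_prod_countable_right fun i => C.measurable_dec i
  exact h.comp (hk.prodMk hu)

theorem measurable_code (hπ : Measurable π) {f : X → ℝ} (hf : Measurable f) :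
    Measurable fun x => C.enc (blkSize (π x).points (f x)) (ratio (π x).points (f x)) :=
  measurable_enc_comp C (measurable_blkSize hπ hf) (measurable_ratio hπ hf)

theorem measurable_encPos (hπ : Measurable π) {f : X → ℝ} (hf : Measurable f) :
    Measurable fun x => encPos C (π x).points (f x) := (measurable_code C hπ hf).fst

theorem measurable_decPos (hπ : Measurable π) {ξ : X → ℤ → A} (hξ : Measurable ξ) {f : X → ℝ}
    (hf : Measurable f) : Measurable fun x => decPos C (π x).points (ξ x) (f x) := by
  refine measurable_dec_comp C (measurable_blkSize hπ hf) ((measurable_ratio hπ hf).prodMk ?_)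
  refine measurable_pi_lambda _ fun j => ?_
  exact measurable_apply_index hξ ((measurable_lab hπ hf).add_const _)

theorem measurable_partPos (F : Set ℤ) (hπ : Measurable π) {f : X → ℝ} (hf : Measurable f) :
    Measurable fun x => partPos C F (π x).points (f x) := by
  classical
  exact Measurable.ite (p := fun x => ⌊f x⌋ ∈ F)
    (measurable_floorInt hf (MeasurableSpace.measurableSet_top (s := F)))
    (measurable_encPos C hπ hf) (measurable_ratio hπ hf)

theorem measurable_encMap_fst : Measurable fun μ => (encMap C a₀ μ).1 :=
  measurable_ofSet_move measurable_id
    (measurable_encPos C (π := fun z : PointMeasure × ℝ => z.1) measurable_fst measurable_snd)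
    fun μ => encPos_mem C μ.points

theorem measurable_encMap : Measurable (encMap C a₀) := by
  have h1 := measurable_encMap_fst C a₀
  have h1' : Measurable fun z : PointMeasure × ℝ => (encMap C a₀ z.1).1 := h1.comp measurable_fst
  refine h1.prodMk (measurable_pi_lambda _ fun i => ?_)
  refine measurable_of_select (π := fun μ => μ) measurable_id
    (g := fun μ => encMarks C a₀ μ.points i)
    (p := fun μ a => Slot (encMap C a₀ μ).1.points i a)
    (val := fun z => (C.enc (blkSize z.1.points z.2) (ratio z.1.points z.2)).2
      (i - lab (encMap C a₀ z.1).1.points z.2).toNat) ?_ ?_ (measurable_const (a := a₀)) ?_ ?_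
  · exact measurableSet_slot h1' measurable_snd i
  · refine measurable_apply_index (measurable_code C measurable_fst measurable_snd).snd ?_
    exact (measurable_from_top (f := fun j : ℤ => (i - j).toNat)).comp
      (measurable_lab h1' measurable_snd)
  · intro μ a h
    simp only [encMap, points_ofSet] at h ⊢
    exact ⟨((isHead_encSet_iff C).1 h.1).mem, encMarks_of_slot C a₀ μ.locFin h⟩
  · intro μ h
    simp only [encMap, points_ofSet] at h
    exact encMarks_of_not C a₀ h

theorem measurable_decMap : Measurable (decMap C) :=
  measurable_ofSet_move (π := fun y : PointMeasure × (ℤ → A) => y.1) measurable_fst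
    (v := fun y => decPos C y.1.points y.2)
    (measurable_decPos C (π := fun z : (PointMeasure × (ℤ → A)) × ℝ => z.1.1) measurable_fst.fst
      (ξ := fun z => z.1.2) measurable_fst.snd measurable_snd)
    fun y => decPos_mem C y.1.points y.2

theorem measurableSet_owns (hπ : Measurable π) {f : X → ℝ} (hf : Measurable f) (p : ℤ × ℕ) :
    MeasurableSet {x | Owns (π x).points p (f x)} := by
  refine measurableSet_and (measurableSet_isHead hπ hf) (measurableSet_and ?_ ?_)
  · exact measurable_floorInt hf (measurableSet_singleton p.1)
  · exact measurableSet_lt measurable_const (measurable_blkSize hπ hf)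

theorem measurable_partMap (F : Set ℤ) : Measurable (partMap C F) := by
  refine Measurable.prodMk ?_ (measurable_pi_lambda _ fun p => ?_)
  · exact measurable_ofSet_move (π := fun y : PointMeasure × (ℤ × ℕ → A) => y.1) measurable_fst
      (v := fun y => partPos C F y.1.points)
      (measurable_partPos C F (π := fun z : (PointMeasure × (ℤ × ℕ → A)) × ℝ => z.1.1)
        measurable_fst.fst measurable_snd) fun y => partPos_mem C F y.1.points
  · by_cases hp : p.1 ∈ F
    · refine measurable_of_select (X := PointMeasure × (ℤ × ℕ → A)) (π := fun y => y.1)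
        measurable_fst (g := fun y => partMarks C F y.1.points y.2 p)
        (p := fun y a => Owns y.1.points p a)
        (val := fun z => (C.enc (blkSize z.1.1.points z.2) (ratio z.1.1.points z.2)).2 p.2)
        ?_ ?_ (y := fun y => y.2 p) ?_ ?_ ?_
      · exact measurableSet_owns measurable_fst.fst measurable_snd p
      · exact (measurable_pi_apply _).comp
          (measurable_code C measurable_fst.fst measurable_snd).snd
      · exact (measurable_pi_apply _).comp measurable_snd
      · exact fun y a h => ⟨h.1.mem, partMarks_of_owns C hp h _⟩
      · exact fun y h => partMarks_of_not C (fun h' => h h'.2) _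
    · have : (fun y : PointMeasure × (ℤ × ℕ → A) => partMarks C F y.1.points y.2 p) =
          fun y => y.2 p := by
        funext y
        exact partMarks_of_not C (fun h => hp h.1) _
      change Measurable (fun y : PointMeasure × (ℤ × ℕ → A) => partMarks C F y.1.points y.2 p)
      rw [this]
      exact (measurable_pi_apply _).comp measurable_snd

theorem measurable_readMap : Measurable (readMap (A := A) a₀) := by
  refine measurable_fst.prodMk (measurable_pi_lambda _ fun i => ?_)
  refine measurable_of_select (X := PointMeasure × (ℤ × ℕ → A)) (π := fun y => y.1)
    measurable_fst (g := fun y => readMarks a₀ y.1.points y.2 i)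
    (p := fun y a => Slot y.1.points i a)
    (val := fun z => z.1.2 (⌊z.2⌋, (i - lab z.1.1.points z.2).toNat))
    ?_ ?_ (measurable_const (a := a₀)) ?_ ?_
  · exact measurableSet_slot measurable_fst.fst measurable_snd i
  · refine measurable_apply_index measurable_fst.snd
      ((measurable_floorInt measurable_snd).prodMk ?_)
    exact (measurable_from_top (f := fun j : ℤ => (i - j).toNat)).comp
      (measurable_lab measurable_fst.fst measurable_snd)
  · exact fun y a h => ⟨h.1.mem, readMarks_of_slot a₀ y.1.locFin h _⟩
  · exact fun y h => readMarks_of_not a₀ h _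

end Measurability

/-! ### Coding windows -/

theorem measurableSet_window (w : ℕ∞) : MeasurableSet (window w) :=
  measurableSet_lt (by fun_prop) measurable_const

theorem mem_window_coe {N : ℕ} {s : ℝ} : s ∈ window N ↔ |s| < N := by
  rw [window, mem_ofPred_eq, ENat.toENNReal_coe, ← ENNReal.ofReal_natCast,
    ENNReal.ofReal_lt_ofReal_iff_of_nonneg (abs_nonneg s)]

theorem window_top : window ⊤ = univ := by
  ext s
  simp [window]

/-- There are heads in both directions. -/
def Rich (S : Set ℝ) : Prop := ∀ r : ℝ, (∃ x < r, IsHead S x) ∧ ∃ y > r, IsHead S y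

/-- Within distance `N` of the origin there are heads around `[-1, 1]` with all labels in between
bounded by `N`. -/
def Visible (S : Set ℝ) (N : ℕ) : Prop :=
  ∃ x y, IsHead S x ∧ IsHead S y ∧ x ≤ -1 ∧ 1 ≤ y ∧ -(N : ℝ) < x - 1 ∧ y + 2 < N ∧
    -(N : ℤ) < lab S x ∧ lab S y ≤ N

theorem Rich.exists_visible {S : Set ℝ} (h : Rich S) : ∃ N, Visible S N := by
  obtain ⟨x, hx, hx'⟩ := (h (-1)).1
  obtain ⟨y, hy, hy'⟩ := (h 1).2
  obtain ⟨N, hN⟩ := exists_nat_gt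
    (max (max (1 - x) (y + 2)) (max (-(lab S x : ℝ)) (lab S y : ℝ)))
  simp only [max_lt_iff] at hN
  refine ⟨N, x, y, hx', hy', hx.le, le_of_lt hy, by linarith, by linarith, ?_, ?_⟩
  · have := hN.2.1
    have h2 : -(lab S x) < (N : ℤ) := by exact_mod_cast this
    omega
  · have h2 : lab S y < (N : ℤ) := by exact_mod_cast hN.2.2
    omega

open Classical in
/-- A coding window for both maps. -/
def codingWindow (μ : PointMeasure) : ℕ∞ :=
  if h : ∃ N, Visible μ.points N then (h.choose : ℕ∞) else ⊤

theorem codingWindow_lt_top {μ : PointMeasure} (h : Rich μ.points) : codingWindow μ < ⊤ := by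
  rw [codingWindow, dif_pos h.exists_visible]
  exact ENat.natCast_lt_top _

theorem codingWindow_cases (μ : PointMeasure) :
    codingWindow μ = ⊤ ∨ ∃ N : ℕ, codingWindow μ = N ∧ Visible μ.points N := by
  by_cases h : ∃ N, Visible μ.points N
  · exact Or.inr ⟨_, dif_pos h, h.choose_spec⟩
  · exact Or.inl (dif_neg h)

theorem sync_of_agreeOn {μ ν : PointMeasure} {N : ℕ} (h : μ.AgreeOn ν (window N)) {x y : ℝ}
    (hx : IsHead μ.points x) (hy : IsHead μ.points y) (hxy : x < y)
    (hx' : -(N : ℝ) < x - 1) (hy' : y + 2 < N) : Sync μ.points ν.points x y := by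
  rw [agreeOn_iff (measurableSet_window _)] at h
  refine ⟨hxy, hx, hy, fun q h1 h2 => ?_⟩
  have hq : q ∈ window N := mem_window_coe.2 (abs_lt.2 ⟨by linarith, by linarith⟩)
  have := Set.ext_iff.1 h q
  simpa [hq] using this

theorem agreeOn_ofSet {S T : Set ℝ} (hS : LocFin S) (hT : LocFin T) {x y : ℝ} (hx : x ≤ -1)
    (hy : 1 ≤ y) (h : S ∩ Ico x y = T ∩ Ico x y) :
    (ofSet S hS).AgreeOn (ofSet T hT) (Ioo (-1) 1) := by
  rw [agreeOn_iff measurableSet_Ioo, points_ofSet, points_ofSet]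
  have hI : Ioo (-1 : ℝ) 1 ⊆ Ico x y := fun q hq => ⟨by linarith [hq.1], by linarith [hq.2]⟩
  rw [← inter_eq_self_of_subset_right hI, ← inter_assoc, h, inter_assoc]

/-- A finite window contains two heads around `[-1, 1]` with their margins, which gives `Sync`. An
infinite window is the whole line, where agreement means equality. -/
theorem isCodingWindow_encMap : IsCodingWindow (encMap C a₀) codingWindow := by
  intro μ ν h
  rcases codingWindow_cases μ with h' | ⟨N, h', x, y, hx, hy, hx1, hy1, hxN, hyN, -, -⟩
  · rw [h', window_top, agreeOn_iff MeasurableSet.univ, inter_univ, inter_univ] at h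
    rw [PointMeasure.ext_points h]
    exact ⟨rfl, fun _ _ => rfl⟩
  · rw [h'] at h
    have hs := sync_of_agreeOn h hx hy (by linarith) hxN hyN
    refine ⟨agreeOn_ofSet (μ.locFin.encSet C) (ν.locFin.encSet C) hx1 hy1 (hs.encSet_eq C), ?_⟩
    rintro p ⟨-, hp⟩
    simp only [mark, encMap, label_eq_lab, points_ofSet]
    exact hs.encMarks_eq C a₀ μ.locFin ν.locFin (by linarith) (by linarith) (by linarith [hp.1])
      (by linarith [hp.2])

theorem isCodingWindowMarked_decMap :
    IsCodingWindowMarked (decMap C) fun y => codingWindow y.1 := by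
  intro μ ν ξ η h hξ
  simp only at h hξ
  rcases codingWindow_cases μ with h' | ⟨N, h', x, y, hx, hy, hx1, hy1, hxN, hyN, hlx, hly⟩
  · rw [h', window_top, agreeOn_iff MeasurableSet.univ, inter_univ, inter_univ] at h
    have : ξ = η := funext fun i => hξ i (by rw [h', window_top]; trivial)
    rw [PointMeasure.ext_points h, this]
    rfl
  · rw [h'] at h
    have hs := sync_of_agreeOn h hx hy (by linarith) hxN hyN
    refine agreeOn_ofSet _ _ hx1 hy1 (hs.decSet_eq C μ.locFin (by linarith) (by linarith) ?_)
    -- The label bounds in `Visible` put all marks of the blocks between the two heads into the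
    -- window.
    intro i h1 h2
    refine hξ i ?_
    rw [h', mem_window_coe]
    have h3 : |i| < (N : ℤ) := abs_lt.2 ⟨by omega, by omega⟩
    exact_mod_cast h3

end Maps

/-! ### Quantile transform and existence of the coding. -/

section

open Filter Topology

section Quantile

variable (ρ : Measure ℝ)

def quantile (u : ℝ) : ℝ := sInf {x | u ≤ cdf ρ x}

variable {ρ} {u : ℝ}

/-- Right continuity of the distribution function says that the infimum is attained, which turns the
quantile into a lower adjoint. -/
theorem quantile_le_iff (hu : u ∈ Ioo (0 : ℝ) 1) (x : ℝ) : quantile ρ u ≤ x ↔ u ≤ cdf ρ x := by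
  have hne : {x | u ≤ cdf ρ x}.Nonempty := by
    obtain ⟨x, hx⟩ := ((tendsto_order.1 (tendsto_cdf_atTop ρ)).1 u hu.2).exists
    exact ⟨x, hx.le⟩
  have hbdd : BddBelow {x | u ≤ cdf ρ x} := by
    obtain ⟨x, hx⟩ := ((tendsto_order.1 (tendsto_cdf_atBot ρ)).2 u hu.1).exists
    refine ⟨x, fun y hy => ?_⟩
    by_contra h
    exact absurd ((hy : u ≤ cdf ρ y).trans (monotone_cdf ρ (not_le.1 h).le)) (not_le.2 hx)
  constructor
  · intro h
    refine le_trans ?_ (monotone_cdf ρ h)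
    have hc := ((cdf ρ).right_continuous (quantile ρ u)).mono Ioi_subset_Ici_self
    refine ge_of_tendsto (hc : Tendsto _ (𝓝[>] _) _) ?_
    filter_upwards [self_mem_nhdsWithin] with z hz
    obtain ⟨y, hy, hyz⟩ := exists_lt_of_csInf_lt hne (hz : sInf _ < z)
    exact (hy : u ≤ cdf ρ y).trans (monotone_cdf ρ hyz.le)
  · intro h
    exact csInf_le hbdd h

/-- Without atoms the distribution function has no jump at the quantile, so the level `u` is hit
exactly. -/
theorem cdf_quantile [IsProbabilityMeasure ρ] [NullSingletonClass ρ] (hu : u ∈ Ioo (0 : ℝ) 1) : cdf ρ (quantile ρ u) = u := by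
  refine le_antisymm ?_ ((quantile_le_iff hu _).1 le_rfl)
  have h := (cdf ρ).measure_singleton (quantile ρ u)
  rw [measure_cdf, measure_singleton] at h
  have h1 : cdf ρ (quantile ρ u) ≤ Function.leftLim (cdf ρ) (quantile ρ u) := by
    have := ENNReal.ofReal_eq_zero.1 h.symm
    linarith
  refine h1.trans ?_
  refine le_of_tendsto ((monotone_cdf ρ).tendsto_leftLim _) ?_
  filter_upwards [self_mem_nhdsWithin] with z hz
  by_contra hc
  exact absurd ((quantile_le_iff hu z).2 (not_le.1 hc).le) (not_le.2 hz)

variable (ρ) [IsProbabilityMeasure ρ] in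
theorem exists_quantile : ∃ q : ℝ → ℝ, Measurable q ∧
    (∀ u ∈ Ioo (0 : ℝ) 1, q u = quantile ρ u) ∧ (volume.restrict (Ioo (0 : ℝ) 1)).map q = ρ := by
  classical
  let q : ℝ → ℝ := fun u => if u ∈ Ioo (0 : ℝ) 1 then quantile ρ u else 0
  have hq1 : ∀ u ∈ Ioo (0 : ℝ) 1, q u = quantile ρ u := fun u hu => if_pos hu
  have hqx : ∀ x, q ⁻¹' Iic x = (Ioo 0 1 ∩ Iic (cdf ρ x)) ∪ ((Ioo 0 1)ᶜ ∩ {_u | 0 ≤ x}) := by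
    intro x
    ext u
    simp only [mem_preimage, mem_Iic, mem_union, mem_inter_iff, mem_compl_iff, mem_ofPred_eq]
    by_cases hu : u ∈ Ioo (0 : ℝ) 1
    · rw [hq1 u hu, quantile_le_iff hu]
      simp [hu]
    · simp only [q, if_neg hu, hu, false_and, not_false_eq_true, true_and, false_or]
  have hqm : Measurable q := by
    refine measurable_of_Iic fun x => ?_
    rw [hqx]
    exact (measurableSet_Ioo.inter measurableSet_Iic).union
      (measurableSet_Ioo.compl.inter (MeasurableSet.const _))
  refine ⟨q, hqm, hq1, ?_⟩
  have : IsFiniteMeasure (volume.restrict (Ioo (0 : ℝ) 1)) := ⟨by simp⟩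
  refine Measure.ext_of_Iic _ _ fun x => ?_
  rw [Measure.map_apply hqm measurableSet_Iic, Measure.restrict_apply (hqm measurableSet_Iic),
    ← ofReal_cdf, hqx]
  have e : ((Ioo 0 1 ∩ Iic (cdf ρ x)) ∪ ((Ioo 0 1)ᶜ ∩ {_u : ℝ | 0 ≤ x})) ∩ Ioo (0 : ℝ) 1 =
      Ioo 0 1 ∩ Iic (cdf ρ x) := by
    ext u
    simp only [mem_union, mem_inter_iff, mem_compl_iff]
    tauto
  rw [e]
  have h1 := cdf_le_one ρ x
  refine le_antisymm ?_ ?_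
  · refine (measure_mono (t := Ioc 0 (cdf ρ x)) fun u hu => ⟨hu.1.1, hu.2⟩).trans ?_
    simp
  · refine le_trans ?_ (measure_mono (s := Ioo 0 (cdf ρ x)) fun u hu =>
      ⟨⟨hu.1, hu.2.trans_le h1⟩, hu.2.le⟩)
    simp

end Quantile

/-- A nonatomic standard probability space is isomorphic to the unit interval. -/
theorem exists_uniform_iso {Y : Type*} [MeasurableSpace Y] [StandardBorelSpace Y]
    (hY : ¬ Countable Y) (ν : Measure Y) [IsProbabilityMeasure ν] [NullSingletonClass ν] :
    ∃ (f : ℝ → Y) (g : Y → ℝ), Measurable f ∧ Measurable g ∧ (∀ y, g y ∈ Ioo (0 : ℝ) 1) ∧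
      (∀ u ∈ Ioo (0 : ℝ) 1, g (f u) = u) ∧ (volume.restrict (Ioo (0 : ℝ) 1)).map f = ν := by
  classical
  have hR : ¬ Countable ℝ := by
    rw [← Set.countable_univ_iff]; exact not_countable_univ
  -- A Borel isomorphism turns the problem into one on the line, where quantile and distribution
  -- function are the two maps. The distribution function can take the values 0 and 1, which the
  -- definition of `g` below replaces by 1/2.
  let e : Y ≃ᵐ ℝ := PolishSpace.measurableEquivOfNotCountable hY hR
  let ρ := ν.map e
  have : IsProbabilityMeasure ρ := Measure.isProbabilityMeasure_map e.measurable.aemeasurable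
  have : NullSingletonClass ρ := by
    refine ⟨fun x => ?_⟩
    rw [Measure.map_apply e.measurable (measurableSet_singleton x)]
    have : e ⁻¹' {x} = {e.symm x} := by
      ext y
      simp only [mem_preimage, mem_singleton_iff]
      exact ⟨fun h => by rw [← h, e.symm_apply_apply], fun h => by rw [h, e.apply_symm_apply]⟩
    rw [this, measure_singleton]
  obtain ⟨q, hqm, hq, hqρ⟩ := exists_quantile ρ
  have hgm : Measurable fun y => cdf ρ (e y) := (monotone_cdf ρ).measurable.comp e.measurable
  refine ⟨fun u => e.symm (q u),
    fun y => if cdf ρ (e y) ∈ Ioo (0 : ℝ) 1 then cdf ρ (e y) else 1 / 2,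
    e.symm.measurable.comp hqm, Measurable.ite (hgm measurableSet_Ioo) hgm measurable_const,
    fun y => ?_, fun u hu => ?_, ?_⟩
  · by_cases h : cdf ρ (e y) ∈ Ioo (0 : ℝ) 1
    · simp only [if_pos h]; exact h
    · simp only [if_neg h]; norm_num
  · simp only [e.apply_symm_apply, hq u hu, cdf_quantile hu, if_pos hu]
  · have h1 := Measure.map_map (μ := volume.restrict (Ioo (0 : ℝ) 1)) e.symm.measurable hqm
    change Measure.map (e.symm ∘ q) _ = ν
    rw [← h1, hqρ, Measure.map_map e.symm.measurable e.measurable]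
    simp

section

variable {A : Type*} [MeasurableSpace A] [StandardBorelSpace A] (α : Measure A)
  [IsProbabilityMeasure α]

/-- The uniform factor makes `(0, 1) × A^k` uncountable and its measure atomless for any `α`, even a
point mass, and for `k = 0`. The marks beyond the first `k` are filled with a constant and never
read. -/
theorem exists_coding_step (k : ℕ) : ∃ (enc : ℝ → ℝ × (ℕ → A)) (dec : ℝ × (ℕ → A) → ℝ),
    Measurable enc ∧ Measurable dec ∧ (∀ u, (enc u).1 ∈ Ioo (0 : ℝ) 1) ∧
    (∀ y, dec y ∈ Ioo (0 : ℝ) 1) ∧ (∀ u ∈ Ioo (0 : ℝ) 1, dec (enc u) = u) ∧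
    (∀ u x y, (∀ j < k, x j = y j) → dec (u, x) = dec (u, y)) ∧
    (volume.restrict (Ioo (0 : ℝ) 1)).map (fun u => ((enc u).1, fun j : Fin k => (enc u).2 j)) =
      (volume.restrict (Ioo (0 : ℝ) 1)).prod (Measure.pi fun _ : Fin k => α) := by
  classical
  have : Nonempty A := nonempty_of_isProbabilityMeasure α
  let a₀ : A := Classical.arbitrary A
  let I := Ioo (0 : ℝ) 1
  have : StandardBorelSpace I := measurableSet_Ioo.standardBorel
  let ν₁ : Measure I := Measure.comap Subtype.val volume
  have hmap : ν₁.map Subtype.val = volume.restrict I := map_comap_subtype_coe measurableSet_Ioo _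
  have : IsProbabilityMeasure ν₁ := by
    refine ⟨?_⟩
    have h := congrArg (fun m : Measure ℝ => m univ) hmap
    simp only [Measure.map_apply measurable_subtype_coe MeasurableSet.univ, preimage_univ,
      Measure.restrict_apply_univ] at h
    rw [h]; simp [I]
  have : NullSingletonClass ν₁ := by
    refine ⟨fun x => ?_⟩
    have h := congrArg (fun m : Measure ℝ => m {x.1}) hmap
    simp only [Measure.map_apply measurable_subtype_coe (measurableSet_singleton _),
      measure_singleton] at h
    refine measure_mono_null ?_ h
    rintro y rfl
    exact rfl
  have hY : ¬ Countable (I × (Fin k → A)) := by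
    intro h
    have h1 : Countable I := (Prod.fst_surjective (α := I) (β := Fin k → A)).countable
    have h2 : (Ioo (0 : ℝ) 1).Countable := h1
    exact absurd (Cardinal.Real.Ioo_countable_iff.1 h2) (by norm_num)
  obtain ⟨f, g, hf, hg, hg1, hgf, hν⟩ :=
    exists_uniform_iso hY (ν₁.prod (Measure.pi fun _ : Fin k => α))
  have half : (1 / 2 : ℝ) ∈ Ioo (0 : ℝ) 1 := by norm_num
  let pr : ℝ → I := fun u => ⟨if u ∈ Ioo (0 : ℝ) 1 then u else 1 / 2, by
    split_ifs with h
    exacts [h, half]⟩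
  have hpr : Measurable pr :=
    (Measurable.ite measurableSet_Ioo measurable_id measurable_const).subtype_mk
  have hpr' : ∀ u : I, pr u.1 = u := fun u => Subtype.ext (if_pos u.2)
  refine ⟨fun u => ((f u).1.1, fun j => if h : j < k then (f u).2 ⟨j, h⟩ else a₀),
    fun y => g (pr y.1, fun j => y.2 j), ?_, ?_, fun u => (f u).1.2, fun y => hg1 _, ?_, ?_, ?_⟩
  · refine (measurable_subtype_coe.comp hf.fst).prodMk (measurable_pi_lambda _ fun j => ?_)
    by_cases h : j < k
    · simp only [dif_pos h]
      exact (measurable_pi_apply _).comp hf.snd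
    · simp only [dif_neg h]
      exact measurable_const
  · refine hg.comp ((hpr.comp measurable_fst).prodMk (measurable_pi_lambda _ fun j => ?_))
    exact (measurable_pi_apply _).comp measurable_snd
  · intro u hu
    simp only [hpr', Fin.is_lt, dif_pos]
    exact hgf u hu
  · intro u x y h
    have : (fun j : Fin k => x j) = fun j : Fin k => y j := funext fun j => h j j.2
    simp only [this]
  · simp only [Fin.is_lt, dif_pos]
    have h1 : Measurable fun y : I × (Fin k → A) => (y.1.1, y.2) :=
      (measurable_subtype_coe.comp measurable_fst).prodMk measurable_snd
    have h2 := Measure.map_map (μ := volume.restrict (Ioo (0 : ℝ) 1)) h1 hf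
    change Measure.map ((fun y : I × (Fin k → A) => (y.1.1, y.2)) ∘ f) _ = _
    rw [← h2, hν]
    have h3 := Measure.map_prod_map ν₁ (Measure.pi fun _ : Fin k => α)
      (measurable_subtype_coe (p := fun x => x ∈ I)) measurable_id
    rw [hmap, Measure.map_id] at h3
    exact h3.symm

theorem nonempty_coding : Nonempty (Coding α) := by
  choose enc dec h1 h2 h3 h4 h5 h6 h7 using exists_coding_step α
  exact ⟨⟨enc, dec, h1, h2, h3, h4, h5, h6, h7⟩⟩

end

end

/-! ### Counts of a Poisson process. -/

section

open Filter Topology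

/-- The number of points in `B`. -/
def cnt (B : Set ℝ) (μ : PointMeasure) : ℕ := (μ.points ∩ B).ncard

/-- Bounded Borel sets. -/
def BddBorel (B : Set ℝ) : Prop := MeasurableSet B ∧ ∃ c : ℝ, B ⊆ Icc (-c) c

theorem BddBorel.subset {B D : Set ℝ} (hB : BddBorel B) (hD : MeasurableSet D) (h : D ⊆ B) :
    BddBorel D := by
  obtain ⟨-, c, hc⟩ := hB
  exact ⟨hD, c, h.trans hc⟩

theorem BddBorel.volume_lt_top {B : Set ℝ} (hB : BddBorel B) : volume B < ∞ := by
  obtain ⟨-, c, hc⟩ := hB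
  exact (measure_mono hc).trans_lt (by simp)

theorem BddBorel.finite {B : Set ℝ} (hB : BddBorel B) (μ : PointMeasure) :
    (μ.points ∩ B).Finite := by
  obtain ⟨-, c, hc⟩ := hB
  exact μ.locFin.finite_of_subset hc

theorem BddBorel.apply_eq {B : Set ℝ} (hB : BddBorel B) (μ : PointMeasure) :
    μ.toMeasure B = cnt B μ := by
  rw [μ.apply_eq hB.1, cnt, ← (hB.finite μ).cast_ncard_eq]
  simp

theorem measurable_cnt {B : Set ℝ} (hB : MeasurableSet B) : Measurable (cnt B) :=
  measurable_ncard measurable_id (p := fun _ s => s ∈ B) (measurable_snd hB)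

/-- Size biasing a Poisson variable is the same as adding one: the scalar form of the Mecke
equation. -/
theorem poissonMeasure_succ (r : ℝ≥0) (k : ℕ) :
    (k + 1 : ℕ) * poissonMeasure r {k + 1} = r * poissonMeasure r {k} := by
  rw [poissonMeasure_singleton, poissonMeasure_singleton, ← ENNReal.ofReal_natCast,
    ← ENNReal.ofReal_coe_nnreal, ← ENNReal.ofReal_mul (by positivity),
    ← ENNReal.ofReal_mul (by positivity)]
  congr 1
  rw [Nat.factorial_succ]
  push_cast
  field_simp
  ring

theorem LocFin.insert {S : Set ℝ} (hS : LocFin S) (t : ℝ) : LocFin (insert t S) := by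
  intro a b
  refine ((hS a b).insert t).subset ?_
  rintro q ⟨rfl | h, h'⟩
  · exact Or.inl rfl
  · exact Or.inr ⟨h, h'⟩

/-- The point measure with an additional point. -/
def addPoint (μ : PointMeasure) (t : ℝ) : PointMeasure := ofSet (insert t μ.points) (μ.locFin.insert t)

theorem points_addPoint (μ : PointMeasure) (t : ℝ) : (addPoint μ t).points = insert t μ.points :=
  points_ofSet _

theorem measurable_addPoint : Measurable fun z : PointMeasure × ℝ => addPoint z.1 z.2 := by
  classical
  refine measurable_pointMeasure fun B hB => ?_
  have hp : MeasurableSet {z : (PointMeasure × ℝ) × ℝ | z.2 ∈ B ∧ z.2 ≠ z.1.2} :=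
    measurableSet_and (measurable_snd hB)
      (measurableSet_eq_fun measurable_snd measurable_fst.snd).compl
  have h1 := measurable_apply_setOf (π := fun z : PointMeasure × ℝ => z.1) measurable_fst
    (p := fun z s => s ∈ B ∧ s ≠ z.2) hp
  have h2 : Measurable fun z : PointMeasure × ℝ => if z.2 ∈ B then (1 : ℝ≥0∞) else 0 :=
    Measurable.ite (measurable_snd hB) measurable_const measurable_const
  convert h1.add h2 using 1
  funext z
  simp only [Pi.add_apply]
  rw [PointMeasure.apply_eq _ hB, PointMeasure.apply_eq _ (measurableSet_section
    (p := fun (z : PointMeasure × ℝ) s => s ∈ B ∧ s ≠ z.2) hp z), points_addPoint]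
  by_cases h : z.2 ∈ B
  · have : insert z.2 z.1.points ∩ B =
        insert z.2 (z.1.points ∩ {s | s ∈ B ∧ s ≠ z.2}) := by
      ext s
      simp only [mem_inter_iff, mem_insert_iff, mem_ofPred_eq]
      grind
    rw [this, encard_insert_of_notMem (by simp), if_pos h]
    simp
  · have : insert z.2 z.1.points ∩ B = z.1.points ∩ {s | s ∈ B ∧ s ≠ z.2} := by
      ext s
      simp only [mem_inter_iff, mem_insert_iff, mem_ofPred_eq]
      grind
    rw [this, if_neg h]
    simp

section Law

variable {r : ℝ≥0} {P : Measure PointMeasure} (hP : IsPoissonLaw r P)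

include hP

theorem IsPoissonLaw.measure_cnt_eq {B : Set ℝ} (hB : BddBorel B) (k : ℕ) :
    P {μ | cnt B μ = k} = poissonMeasure (r * (volume B).toNNReal) {k} := by
  have h0 : P.map (fun μ => μ.toMeasure B) =
      (poissonMeasure (r * (volume B).toNNReal)).map (fun k : ℕ => (k : ℝ≥0∞)) :=
    hP.map_count B hB.1 hB.volume_lt_top
  have h := congrArg (fun m : Measure ℝ≥0∞ => m {(k : ℝ≥0∞)}) h0
  have hm : Measurable fun k : ℕ => (k : ℝ≥0∞) := measurable_from_top
  simp only [Measure.map_apply (measurable_apply hB.1) (measurableSet_singleton _), Measure.map_apply hm (measurableSet_singleton _)] at h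
  have e1 : (fun μ : PointMeasure => μ.toMeasure B) ⁻¹' {(k : ℝ≥0∞)} = {μ | cnt B μ = k} := by
    ext μ
    have := hB.apply_eq μ
    rw [mem_preimage, mem_singleton_iff, mem_ofPred_eq]
    rw [this, Nat.cast_inj]
  have e2 : (fun k : ℕ => (k : ℝ≥0∞)) ⁻¹' {(k : ℝ≥0∞)} = {k} := by
    ext j; simp
  rw [e1, e2] at h
  exact h

theorem IsPoissonLaw.iIndepFun_apply {ι : Type*} {B : ι → Set ℝ} (hB : ∀ i, MeasurableSet (B i))
    (hd : Pairwise fun i j => Disjoint (B i) (B j)) :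
    iIndepFun (fun i (μ : PointMeasure) => μ.toMeasure (B i)) P := by
  rw [iIndepFun_iff_finset]
  intro s
  have h := hP.iIndepFun_count s.card (fun i => B (s.equivFin.symm i)) (fun i => hB _) (by
    intro i j hij
    exact hd fun h => hij (s.equivFin.symm.injective (Subtype.ext h)))
  exact iIndepFun.of_precomp (g := s.equivFin.symm) s.equivFin.symm.surjective h

theorem IsPoissonLaw.measure_cnt_iInter {ι : Type*} {B : ι → Set ℝ} (hB : ∀ i, BddBorel (B i))
    (hd : Pairwise fun i j => Disjoint (B i) (B j)) (s : Finset ι) (k : ι → ℕ) :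
    P (⋂ i ∈ s, {μ | cnt (B i) μ = k i}) = ∏ i ∈ s, P {μ | cnt (B i) μ = k i} := by
  have h := iIndepFun_iff_measure_inter_preimage_eq_mul.1
    (hP.iIndepFun_apply (fun i => (hB i).1) hd) s (sets := fun i => {(k i : ℝ≥0∞)})
    fun i _ => measurableSet_singleton _
  have e : ∀ i, (fun μ : PointMeasure => μ.toMeasure (B i)) ⁻¹' {(k i : ℝ≥0∞)} =
      {μ | cnt (B i) μ = k i} := by
    intro i
    ext μ
    rw [mem_preimage, mem_singleton_iff, (hB i).apply_eq, Nat.cast_inj]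
    rfl
  simp only [e] at h
  exact h

/-- The count of a null set is Poisson with mean zero. -/
theorem IsPoissonLaw.ae_notMem (t : ℝ) : ∀ᵐ μ ∂P, t ∉ μ.points := by
  have := hP.isProbabilityMeasure
  have h := hP.measure_cnt_eq (B := {t}) ⟨measurableSet_singleton t, |t|, by
    rintro s rfl; exact ⟨neg_abs_le s, le_abs_self s⟩⟩ 0
  have h1 : P {μ | cnt {t} μ = 0} = 1 := by
    rw [h]
    simp [poissonMeasure_singleton]
  have h2 : ∀ᵐ μ ∂P, cnt {t} μ = 0 := by
    have hm : MeasurableSet {μ : PointMeasure | cnt {t} μ = 0} :=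
      measurable_cnt (measurableSet_singleton t) (measurableSet_singleton 0)
    exact (prob_compl_eq_zero_iff hm).2 h1
  filter_upwards [h2] with μ hμ ht
  have : μ.points ∩ {t} = {t} := inter_eq_self_of_subset_right (singleton_subset_iff.2 ht)
  rw [cnt, this, ncard_singleton] at hμ
  exact one_ne_zero hμ

/-- The Mecke equation for functions of the counts of disjoint sets. -/
theorem IsPoissonLaw.lintegral_cnt_mul {ι : Type*} [Fintype ι] [DecidableEq ι] {B : ι → Set ℝ}
    (hB : ∀ i, BddBorel (B i)) (hd : Pairwise fun i j => Disjoint (B i) (B j)) (i : ι)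
    (h : (ι → ℕ) → ℝ≥0∞) :
    ∫⁻ μ, (cnt (B i) μ : ℝ≥0∞) * h (fun j => cnt (B j) μ) ∂P =
      r * volume (B i) * ∫⁻ μ, h ((fun j => cnt (B j) μ) + Pi.single i 1) ∂P := by
  have hX : Measurable fun (μ : PointMeasure) (j : ι) => cnt (B j) μ :=
    measurable_pi_lambda _ fun j => measurable_cnt (hB j).1
  set ν := P.map fun (μ : PointMeasure) (j : ι) => cnt (B j) μ with hν
  set p : ι → ℕ → ℝ≥0∞ := fun j k => poissonMeasure (r * (volume (B j)).toNNReal) {k} with hp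
  have hνk : ∀ k, ν {k} = ∏ j, p j (k j) := by
    intro k
    rw [hν, Measure.map_apply hX (measurableSet_singleton k)]
    have e : (fun (μ : PointMeasure) (j : ι) => cnt (B j) μ) ⁻¹' {k} =
        ⋂ j ∈ Finset.univ, {μ | cnt (B j) μ = k j} := by
      ext μ
      simp [funext_iff]
    rw [e, hP.measure_cnt_iInter hB hd]
    exact Finset.prod_congr rfl fun j _ => hP.measure_cnt_eq (hB j) (k j)
  have e1 : ∫⁻ μ, (cnt (B i) μ : ℝ≥0∞) * h (fun j => cnt (B j) μ) ∂P =
      ∫⁻ k, (k i : ℝ≥0∞) * h k ∂ν := by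
    rw [hν, lintegral_map (measurable_of_countable _) hX]
  have e2 : ∫⁻ μ, h ((fun j => cnt (B j) μ) + Pi.single i 1) ∂P =
      ∫⁻ k, h (k + (Pi.single i 1 : ι → ℕ)) ∂ν := by
    rw [hν, lintegral_map (measurable_of_countable _) hX]
  rw [e1, e2, lintegral_countable', lintegral_countable', ← ENNReal.tsum_mul_left]
  -- The left sum is reindexed by `k ↦ k + e_i`; it loses nothing, since terms with `k i = 0` carry
  -- the factor zero.
  have hinj : Function.Injective fun k : ι → ℕ => k + (Pi.single i 1 : ι → ℕ) := add_left_injective _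
  rw [← hinj.tsum_eq]
  · refine tsum_congr fun k => ?_
    rw [hνk, hνk, ← Finset.mul_prod_erase Finset.univ _ (Finset.mem_univ i),
      ← Finset.mul_prod_erase Finset.univ (fun j => p j (k j)) (Finset.mem_univ i)]
    have h1 : ∏ j ∈ Finset.univ.erase i, p j ((k + (Pi.single i 1 : ι → ℕ)) j) =
        ∏ j ∈ Finset.univ.erase i, p j (k j) := by
      refine Finset.prod_congr rfl fun j hj => ?_
      simp [(Finset.mem_erase.1 hj).1]
    have h2 : (((k + (Pi.single i 1 : ι → ℕ)) i : ℕ) : ℝ≥0∞) * p i ((k + (Pi.single i 1 : ι → ℕ)) i) =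
        r * volume (B i) * p i (k i) := by
      have h3 := poissonMeasure_succ (r * (volume (B i)).toNNReal) (k i)
      rw [ENNReal.coe_mul, ENNReal.coe_toNNReal (hB i).volume_lt_top.ne] at h3
      simpa [hp] using h3
    rw [h1]
    calc _ = (((k + (Pi.single i 1 : ι → ℕ)) i : ℕ) : ℝ≥0∞) * p i ((k + (Pi.single i 1 : ι → ℕ)) i) *
          (h (k + (Pi.single i 1 : ι → ℕ)) * ∏ j ∈ Finset.univ.erase i, p j (k j)) := by ring
      _ = _ := by rw [h2]; ring
  · intro k hk
    have hk' : k i ≠ 0 := by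
      intro h0
      simp [h0] at hk
    refine ⟨k - Pi.single i 1, ?_⟩
    funext j
    by_cases hj : j = i
    · subst hj
      simp; omega
    · simp [hj]

/-- A point added at `t ∈ B i` is almost surely new and raises only the count of `B i`, so the inner
integral is constant in `t`. -/
theorem IsPoissonLaw.lintegral_cnt_mul_eq_lintegral {ι : Type*} [Fintype ι] [DecidableEq ι]
    {B : ι → Set ℝ}
    (hB : ∀ i, BddBorel (B i)) (hd : Pairwise fun i j => Disjoint (B i) (B j)) (i : ι)
    (h : (ι → ℕ) → ℝ≥0∞) :
    ∫⁻ μ, (cnt (B i) μ : ℝ≥0∞) * h (fun j => cnt (B j) μ) ∂P =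
      r * ∫⁻ t in B i, ∫⁻ μ, h (fun j => cnt (B j) (addPoint μ t)) ∂P := by
  rw [hP.lintegral_cnt_mul hB hd i h]
  have : ∀ t ∈ B i, ∫⁻ μ, h (fun j => cnt (B j) (addPoint μ t)) ∂P =
      ∫⁻ μ, h ((fun j => cnt (B j) μ) + Pi.single i 1) ∂P := by
    intro t ht
    refine lintegral_congr_ae ?_
    filter_upwards [hP.ae_notMem t] with μ hμ
    congr 1
    funext j
    by_cases hj : j = i
    · subst hj
      have e : insert t μ.points ∩ B j = insert t (μ.points ∩ B j) := insert_inter_of_mem ht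
      simp only [cnt, points_addPoint, Pi.add_apply, Pi.single_eq_same]
      rw [e, ncard_insert_of_notMem (fun h => hμ h.1) ((hB j).finite μ)]
    · have htj : t ∉ B j := fun h => Set.disjoint_left.1 (hd hj) h ht
      have e : insert t μ.points ∩ B j = μ.points ∩ B j := insert_inter_of_notMem htj
      simp only [cnt, points_addPoint, Pi.add_apply, Pi.single_eq_of_ne hj, e, add_zero]
  rw [setLIntegral_congr_fun (hB i).1 this, setLIntegral_const]
  ring

end Law

end

/-! ### The Mecke equation. -/

section

open Filter Topology

section Atoms

variable {ι : Type*} (B : ι → Set ℝ)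

/-- The atoms of a family of sets. -/
def atom (σ : ι → Bool) : Set ℝ := {t | (∃ j, t ∈ B j) ∧ ∀ j, t ∈ B j ↔ σ j = true}

variable {B}

theorem pairwise_disjoint_atom : Pairwise fun σ τ => Disjoint (atom B σ) (atom B τ) := by
  intro σ τ hστ
  rw [Set.disjoint_left]
  intro t h h'
  refine hστ (funext fun j => ?_)
  rw [Bool.eq_iff_iff, ← h.2 j, h'.2 j]

variable [Fintype ι]

theorem bddBorel_atom (hB : ∀ i, BddBorel (B i)) (σ : ι → Bool) : BddBorel (atom B σ) := by
  have hm : MeasurableSet (atom B σ) := by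
    have : atom B σ = (⋃ j, B j) ∩ ⋂ j, if σ j = true then B j else (B j)ᶜ := by
      ext t
      simp only [atom, mem_ofPred_eq, mem_inter_iff, mem_iUnion, mem_iInter]
      refine and_congr_right fun _ => forall_congr' fun j => ?_
      split_ifs with h <;> simp [h]
    rw [this]
    refine (MeasurableSet.iUnion fun j => (hB j).1).inter (MeasurableSet.iInter fun j => ?_)
    split_ifs
    exacts [(hB j).1, (hB j).1.compl]
  by_cases h : ∃ j, σ j = true
  · obtain ⟨j, hj⟩ := h
    exact (hB j).subset hm fun t ht => (ht.2 j).2 hj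
  · refine ⟨hm, 0, ?_⟩
    rintro t ⟨⟨j, hj⟩, ht⟩
    exact absurd ⟨j, (ht j).1 hj⟩ h

theorem biUnion_atom [DecidableEq ι] (j : ι) :
    ⋃ σ ∈ Finset.univ.filter (fun σ : ι → Bool => σ j = true), atom B σ = B j := by
  classical
  ext t
  simp only [Finset.mem_filter, Finset.mem_univ, true_and, mem_iUnion, exists_prop]
  constructor
  · rintro ⟨σ, hσ, ht⟩
    exact (ht.2 j).2 hσ
  · intro ht
    exact ⟨fun i => decide (t ∈ B i), by simpa using ht, ⟨j, ht⟩, fun i => by simp⟩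

theorem cnt_eq_sum_atom [DecidableEq ι] (hB : ∀ i, BddBorel (B i)) (j : ι) (μ : PointMeasure) :
    cnt (B j) μ = ∑ σ ∈ Finset.univ.filter (fun σ : ι → Bool => σ j = true), cnt (atom B σ) μ := by
  have h : μ.toMeasure (B j) =
      ∑ σ ∈ Finset.univ.filter (fun σ : ι → Bool => σ j = true), μ.toMeasure (atom B σ) := by
    conv_lhs => rw [← biUnion_atom (B := B) j]
    exact measure_biUnion_finset (fun σ _ τ _ h => pairwise_disjoint_atom h)
      fun σ _ => (bddBorel_atom hB σ).1
  rw [(hB j).apply_eq] at h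
  simp only [(bddBorel_atom hB _).apply_eq] at h
  exact_mod_cast h

end Atoms

/-- Overlapping sets are decomposed into disjoint atoms. Both sides are additive over the atoms that
make up `B i`. -/
theorem IsPoissonLaw.lintegral_cnt_mul_of_finite {r : ℝ≥0} {P : Measure PointMeasure}
    (hP : IsPoissonLaw r P) {ι : Type*} [Fintype ι]
    {B : ι → Set ℝ} (hB : ∀ i, BddBorel (B i)) (i : ι) (h : (ι → ℕ) → ℝ≥0∞) :
    ∫⁻ μ, (cnt (B i) μ : ℝ≥0∞) * h (fun j => cnt (B j) μ) ∂P =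
      r * ∫⁻ t in B i, ∫⁻ μ, h (fun j => cnt (B j) (addPoint μ t)) ∂P := by
  classical
  have hA := bddBorel_atom hB
  simp_rw [fun j (μ : PointMeasure) => cnt_eq_sum_atom hB j μ]
  let h' : ((ι → Bool) → ℕ) → ℝ≥0∞ := fun k =>
    h fun j => ∑ σ ∈ Finset.univ.filter (fun σ : ι → Bool => σ j = true), k σ
  push_cast
  simp_rw [Finset.sum_mul]
  rw [lintegral_finsetSum]
  · have := fun σ => hP.lintegral_cnt_mul_eq_lintegral hA pairwise_disjoint_atom σ h'
    simp only [h'] at this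
    simp_rw [this]
    rw [← Finset.mul_sum]
    congr 1
    conv_rhs => rw [← biUnion_atom (B := B) i]
    rw [lintegral_biUnion_finset (fun σ _ τ _ h => pairwise_disjoint_atom h)
      fun σ _ => (hA σ).1]
  · intro σ _
    have hX : Measurable fun (μ : PointMeasure) (σ : ι → Bool) => cnt (atom B σ) μ :=
      measurable_pi_lambda _ fun σ => measurable_cnt (hA σ).1
    have h2 : Measurable fun k : (ι → Bool) → ℕ => (k σ : ℝ≥0∞) * h' k := measurable_of_countable _
    exact h2.comp hX

/-- The sigma-algebra on point measures is generated by the counts of bounded sets. -/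
theorem eq_iSup_comap_cnt : instMeasurableSpacePointMeasure =
    ⨆ B : {B : Set ℝ // BddBorel B}, MeasurableSpace.comap (cnt B.1) ⊤ := by
  refine le_antisymm ?_ ?_
  · set m' : MeasurableSpace PointMeasure :=
      ⨆ B : {B : Set ℝ // BddBorel B}, MeasurableSpace.comap (cnt B.1) ⊤
    have hc : ∀ B, BddBorel B → Measurable[m'] (cnt B) := fun B hB =>
      (comap_measurable (cnt B)).mono (le_iSup (fun B : {B : Set ℝ // BddBorel B} =>
        MeasurableSpace.comap (cnt B.1) ⊤) ⟨B, hB⟩) le_rfl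
    have : @Measurable PointMeasure PointMeasure m' instMeasurableSpacePointMeasure
        (fun μ => μ) := by
      refine @measurable_pointMeasure PointMeasure m' _ fun B hB => ?_
      have hb : ∀ n : ℕ, BddBorel (B ∩ Icc (-(n : ℝ)) n) := fun n =>
        ⟨hB.inter measurableSet_Icc, n, inter_subset_right⟩
      have e : (fun μ : PointMeasure => μ.toMeasure B) =
          fun μ => ⨆ n : ℕ, ((cnt (B ∩ Icc (-(n : ℝ)) n) μ : ℕ) : ℝ≥0∞) := by
        funext μ
        simp_rw [← (hb _).apply_eq]
        rw [← Monotone.measure_iUnion]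
        · congr 1
          ext t
          simp only [mem_iUnion, mem_inter_iff, mem_Icc]
          constructor
          · intro ht
            obtain ⟨n, hn⟩ := exists_nat_ge |t|
            exact ⟨n, ht, abs_le.1 hn⟩
          · rintro ⟨n, ht, -⟩
            exact ht
        · intro n k hnk
          have : (n : ℝ) ≤ k := by exact_mod_cast hnk
          exact inter_subset_inter_right _ (Icc_subset_Icc (by linarith) this)
      rw [e]
      refine Measurable.iSup fun n => ?_
      exact (measurable_from_top (f := fun k : ℕ => (k : ℝ≥0∞))).comp (hc _ (hb n))
    intro s hs
    exact this hs
  · refine iSup_le fun B => ?_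
    exact (measurable_cnt B.2.1).comap_le

/-- Events given by finitely many counts form a π-system that generates the σ-algebra. Taking no
sets at all gives the equality of the total masses. -/
theorem measure_ext_cnt {Q₁ Q₂ : Measure PointMeasure} [IsFiniteMeasure Q₁]
    (h : ∀ (n : ℕ) (D : Fin n → Set ℝ), (∀ i, BddBorel (D i)) → ∀ T : Set (Fin n → ℕ),
      Q₁ {μ | (fun j => cnt (D j) μ) ∈ T} = Q₂ {μ | (fun j => cnt (D j) μ) ∈ T}) : Q₁ = Q₂ := by
  refine ext_of_generate_finite (piiUnionInter (fun D : {B : Set ℝ // BddBorel B} =>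
    {s | MeasurableSet[MeasurableSpace.comap (cnt D.1) ⊤] s}) univ) ?_ ?_ ?_ ?_
  · rw [generateFrom_piiUnionInter_measurableSet
      (fun D : {B : Set ℝ // BddBorel B} => MeasurableSpace.comap (cnt D.1) ⊤)]
    simp only [mem_univ, iSup_pos]
    exact eq_iSup_comap_cnt
  · refine isPiSystem_piiUnionInter (fun D : {B : Set ℝ // BddBorel B} =>
      {s | MeasurableSet[MeasurableSpace.comap (cnt D.1) ⊤] s}) ?_ univ
    intro D
    exact @MeasurableSpace.isPiSystem_measurableSet _ (MeasurableSpace.comap (cnt D.1) ⊤)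
  · rintro s ⟨t, -, f, hf, hs⟩
    have hf' : ∀ x, ∃ T : Set ℕ, x ∈ t → cnt x.1 ⁻¹' T = f x := by
      intro x
      by_cases hx : x ∈ t
      · obtain ⟨T, -, hT⟩ := hf x hx
        exact ⟨T, fun _ => hT⟩
      · exact ⟨∅, fun h => absurd h hx⟩
    choose T hT using hf'
    have e : s = {μ | (fun i : Fin t.card => cnt (t.equivFin.symm i).1.1 μ) ∈
          {k : Fin t.card → ℕ | ∀ i, k i ∈ T (t.equivFin.symm i).1}} := by
      rw [hs]
      ext μ
      simp only [mem_iInter, mem_ofPred_eq]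
      constructor
      · intro h i
        have := h _ (t.equivFin.symm i).2
        rwa [← hT _ (t.equivFin.symm i).2] at this
      · intro h x hx
        have := h (t.equivFin ⟨x, hx⟩)
        rw [Equiv.symm_apply_apply] at this
        rw [← hT x hx]
        exact this
    rw [e]
    exact h _ _ (fun i => (t.equivFin.symm i).1.2) _
  · have := h 0 (fun i => i.elim0) (fun i => i.elim0) univ
    exact this

section Mecke

variable {r : ℝ≥0} {P : Measure PointMeasure} (hP : IsPoissonLaw r P)

include hP

/-- Both sides are measures of `E`: one has density `cnt B`, the other is the law after adding a
point in `B`. They are finite and agree on all finite-dimensional count events. -/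
theorem IsPoissonLaw.setLIntegral_cnt {B : Set ℝ} (hB : BddBorel B) {E : Set PointMeasure}
    (hE : MeasurableSet E) :
    ∫⁻ μ in E, (cnt B μ : ℝ≥0∞) ∂P =
      r * ((volume.restrict B).prod P).map (fun z => addPoint z.2 z.1) E := by
  have := hP.isProbabilityMeasure
  have hadd : Measurable fun z : ℝ × PointMeasure => addPoint z.2 z.1 :=
    measurable_addPoint.comp measurable_swap
  have : IsFiniteMeasure (volume.restrict B) := ⟨by simpa using hB.volume_lt_top⟩
  have hcm : Measurable fun μ => (cnt B μ : ℝ≥0∞) :=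
    (measurable_from_top (f := fun k : ℕ => (k : ℝ≥0∞))).comp (measurable_cnt hB.1)
  have hfin : ∀ {ι : Type} [Fintype ι] (D : ι → Set ℝ) (hD : ∀ i, BddBorel (D i)) (i : ι),
      D i = B → ∀ T : Set (ι → ℕ), P.withDensity (fun μ => (cnt B μ : ℝ≥0∞))
        {μ | (fun j => cnt (D j) μ) ∈ T} =
      (r • ((volume.restrict B).prod P).map fun z => addPoint z.2 z.1)
        {μ | (fun j => cnt (D j) μ) ∈ T} := by
    classical
    intro ι _ D hD i hi T
    have hX : Measurable fun (μ : PointMeasure) (j : ι) => cnt (D j) μ :=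
      measurable_pi_lambda _ fun j => measurable_cnt (hD j).1
    have hT : MeasurableSet {μ : PointMeasure | (fun j => cnt (D j) μ) ∈ T} :=
      hX T.to_countable.measurableSet
    have h := hP.lintegral_cnt_mul_of_finite hD i (T.indicator 1)
    rw [hi] at h
    rw [withDensity_apply _ hT, ← lintegral_indicator hT, Measure.smul_apply,
      Measure.map_apply hadd hT, Measure.prod_apply (hadd hT)]
    refine Eq.trans ?_ (h.trans ?_)
    · refine lintegral_congr fun μ => ?_
      by_cases hμ : (fun j => cnt (D j) μ) ∈ T
      · rw [indicator_of_mem (show μ ∈ {μ : PointMeasure | (fun j => cnt (D j) μ) ∈ T} from hμ),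
          indicator_of_mem hμ]
        simp
      · rw [indicator_of_notMem (show μ ∉ {μ : PointMeasure | (fun j => cnt (D j) μ) ∈ T} from hμ),
          indicator_of_notMem hμ]
        simp
    · rw [ENNReal.smul_def, smul_eq_mul]
      congr 1
      refine lintegral_congr fun t => ?_
      rw [← lintegral_indicator_one (measurable_prodMk_left (hadd hT))]
      rfl
  have huniv := hfin (ι := Unit) (fun _ => B) (fun _ => hB) () rfl univ
  simp only [mem_univ] at huniv
  have hfinite : IsFiniteMeasure (P.withDensity (fun μ => (cnt B μ : ℝ≥0∞))) := by
    refine ⟨?_⟩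
    have e : (univ : Set PointMeasure) = {μ | True} := by ext; simp
    rw [e, huniv]
    exact measure_lt_top _ _
  have key : P.withDensity (fun μ => (cnt B μ : ℝ≥0∞)) =
      r • ((volume.restrict B).prod P).map fun z => addPoint z.2 z.1 := by
    refine measure_ext_cnt fun n D hD T => ?_
    -- `B` itself joins the family as the extra index `none`, and the event ignores its count.
    refine hfin (fun j : Option (Fin n) => j.elim B D) ?_ none rfl {k | (fun i => k (some i)) ∈ T}
    rintro (_ | i)
    exacts [hB, hD i]
  have h := congrArg (fun m : Measure PointMeasure => m E) key
  simp only [withDensity_apply _ hE, Measure.smul_apply, ENNReal.smul_def, smul_eq_mul] at h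
  exact h

/-- The Mecke equation. -/
theorem IsPoissonLaw.mecke {B : Set ℝ} (hB : BddBorel B) {F : PointMeasure × ℝ → ℝ≥0∞}
    (hF : Measurable F) :
    ∫⁻ μ, ∫⁻ s in B, F (μ, s) ∂μ.toMeasure ∂P =
      r * ∫⁻ t in B, ∫⁻ μ, F (addPoint μ t, t) ∂P := by
  have := hP.isProbabilityMeasure
  have hadd : Measurable fun z : ℝ × PointMeasure => (addPoint z.2 z.1, z.1) :=
    (measurable_addPoint.comp measurable_swap).prodMk measurable_fst
  have : IsFiniteMeasure (volume.restrict B) := ⟨by simpa using hB.volume_lt_top⟩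
  -- The equation is an identity of measures on pairs of a configuration and one of its points. On a
  -- rectangle `E ×ˢ D` it is `setLIntegral_cnt` for `D ∩ B`.
  have key : P ⊗ₘ (pointKernel.restrict hB.1) =
      r • ((volume.restrict B).prod P).map fun z => (addPoint z.2 z.1, z.1) := by
    symm
    refine Measure.ext_prod fun {E D} hE hD => ?_
    rw [Measure.compProd_apply_prod hE hD, Measure.smul_apply,
      Measure.map_apply hadd (hE.prod hD)]
    have hBD : BddBorel (D ∩ B) := hB.subset (hD.inter hB.1) inter_subset_right
    have h := hP.setLIntegral_cnt hBD hE
    have hadd' : Measurable fun z : ℝ × PointMeasure => addPoint z.2 z.1 :=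
      measurable_addPoint.comp measurable_swap
    rw [Measure.map_apply hadd' hE] at h
    simp only [Kernel.restrict_apply, pointKernel_apply, Measure.restrict_apply hD, hBD.apply_eq]
    rw [h, ENNReal.smul_def, smul_eq_mul]
    congr 1
    have e : (fun z : ℝ × PointMeasure => (addPoint z.2 z.1, z.1)) ⁻¹' E ×ˢ D =
        ((fun z : ℝ × PointMeasure => addPoint z.2 z.1) ⁻¹' E) ∩ (D ×ˢ univ) := by
      ext z; simp
    rw [e, ← Measure.restrict_apply (hadd' hE), ← Measure.prod_restrict, Measure.restrict_univ,
      Measure.restrict_restrict hD]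
  refine (Measure.lintegral_compProd (μ := P) (κ := pointKernel.restrict hB.1) hF).symm.trans ?_
  rw [key, lintegral_smul_measure,
    lintegral_map hF hadd]
  change (r : ℝ≥0∞) * _ = _
  congr 1
  exact lintegral_prod _ (hF.comp hadd).aemeasurable

end Mecke

end

/-! ### Existence of heads in both directions. -/

section

open Filter Topology

theorem exists_lt_lt_of_ncard_eq_three {S : Set ℝ} (h : S.ncard = 3) :
    ∃ a m b, a < m ∧ m < b ∧ S = {a, m, b} := by
  obtain ⟨x, y, z, hxy, hxz, hyz, rfl⟩ := ncard_eq_three.1 h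
  rcases hxy.lt_or_gt with h1 | h1 <;> rcases hxz.lt_or_gt with h2 | h2 <;>
    rcases hyz.lt_or_gt with h3 | h3
  · exact ⟨x, y, z, h1, h3, rfl⟩
  · exact ⟨x, z, y, h2, h3, by ext; simp only [mem_insert_iff, mem_singleton_iff]; tauto⟩
  · linarith
  · exact ⟨z, x, y, h2, h1, by ext; simp only [mem_insert_iff, mem_singleton_iff]; tauto⟩
  · exact ⟨y, x, z, h1, h2, by ext; simp only [mem_insert_iff, mem_singleton_iff]; tauto⟩
  · linarith
  · exact ⟨y, z, x, h3, h2, by ext; simp only [mem_insert_iff, mem_singleton_iff]; tauto⟩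
  · exact ⟨z, y, x, h3, h1, by ext; simp only [mem_insert_iff, mem_singleton_iff]; tauto⟩

/-- The margins and the center of `[c, c + 6)`. -/
def cellPart (c : ℝ) (i : Bool) : Set ℝ :=
  if i then Ico (c + 2) (c + 3) else Ico c (c + 2) ∪ Ico (c + 3) (c + 6)

theorem cellPart_subset (c : ℝ) (i : Bool) : cellPart c i ⊆ Ico c (c + 6) := by
  intro t ht
  cases i
  · rcases ht with ht | ht <;> exact ⟨by linarith [ht.1], by linarith [ht.2]⟩
  · have ht : t ∈ Ico (c + 2) (c + 3) := ht
    exact ⟨by linarith [ht.1], by linarith [ht.2]⟩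

theorem bddBorel_cellPart (c : ℝ) (i : Bool) : BddBorel (cellPart c i) := by
  refine ⟨?_, |c| + 6, fun t ht => ?_⟩
  · cases i
    exacts [measurableSet_Ico.union measurableSet_Ico, measurableSet_Ico]
  · have h := cellPart_subset c i ht
    exact ⟨by linarith [neg_abs_le c, h.1], by linarith [le_abs_self c, h.2]⟩

theorem volume_cellPart (c : ℝ) (i : Bool) : volume (cellPart c i) = if i then 1 else 5 := by
  cases i
  · change volume (Ico c (c + 2) ∪ Ico (c + 3) (c + 6)) = 5
    rw [measure_union _ measurableSet_Ico, Real.volume_Ico, Real.volume_Ico,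
      ← ENNReal.ofReal_add (by linarith) (by linarith)]
    · ring_nf; norm_num
    · rw [Set.disjoint_left]
      intro t h h'
      linarith [h.2, h'.1]
  · change volume (Ico (c + 2) (c + 3)) = 1
    rw [Real.volume_Ico]
    ring_nf; norm_num

theorem disjoint_cellPart (c : ℝ) : Disjoint (cellPart c true) (cellPart c false) := by
  rw [Set.disjoint_left]
  intro t h h'
  have h : t ∈ Ico (c + 2) (c + 3) := h
  rcases h' with h' | h'
  · linarith [h.1, h'.2]
  · linarith [h.2, h'.1]

/-- The head lies in `[c + 2, c + 3)`, so its window `[a - 1, a + 2]` stays inside `[c, c + 6)`,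
where the only points are the three in the center. -/
theorem exists_head_of_cnt {μ : PointMeasure} {c : ℝ} (h0 : cnt (cellPart c false) μ = 0)
    (h1 : cnt (cellPart c true) μ = 3) : ∃ a ∈ Ico (c + 2) (c + 3), IsHead μ.points a := by
  obtain ⟨a, m, b, ham, hmb, h⟩ := exists_lt_lt_of_ncard_eq_three h1
  have h1' : μ.points ∩ Ico (c + 2) (c + 3) = {a, m, b} := h
  have h0' : μ.points ∩ cellPart c false = ∅ :=
    (ncard_eq_zero ((bddBorel_cellPart c false).finite μ)).1 h0
  have hin : ∀ q, q = a ∨ q = m ∨ q = b → q ∈ μ.points ∩ Ico (c + 2) (c + 3) := by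
    intro q hq
    rw [h1']
    simpa using hq
  have ha := hin a (Or.inl rfl)
  have hm := hin m (Or.inr (Or.inl rfl))
  have hb := hin b (Or.inr (Or.inr rfl))
  refine ⟨a, ha.2, m, b, ham, hmb, by linarith [ha.2.1, hb.2.2], ?_⟩
  ext q
  simp only [mem_inter_iff, mem_Icc, mem_insert_iff, mem_singleton_iff]
  constructor
  · rintro ⟨hq, hq1, hq2⟩
    by_cases hc : q ∈ Ico (c + 2) (c + 3)
    · have : q ∈ μ.points ∩ Ico (c + 2) (c + 3) := ⟨hq, hc⟩
      rw [h1'] at this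
      simpa using this
    · exfalso
      have : q ∈ μ.points ∩ cellPart c false := by
        refine ⟨hq, ?_⟩
        change q ∈ Ico c (c + 2) ∪ Ico (c + 3) (c + 6)
        by_cases h2 : q < c + 2
        · exact Or.inl ⟨by linarith [ha.2.1], h2⟩
        · refine Or.inr ⟨?_, by linarith [ha.2.2]⟩
          by_contra h3
          exact hc ⟨not_lt.1 h2, not_le.1 h3⟩
      rw [h0'] at this
      exact this
  · intro hq
    have h2 := hin q hq
    have h3 := h2.2
    exact ⟨h2.1, by linarith [h3.1, ha.2.2], by linarith [h3.2, ha.2.1]⟩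

section

variable {r : ℝ≥0} {P : Measure PointMeasure} (hP : IsPoissonLaw r P)

include hP

/-- Second Borel–Cantelli lemma: the intervals `[6 c_k, 6 c_k + 6)` are disjoint, and each contains
a triple in its center and no further point with the same positive probability. -/
theorem IsPoissonLaw.ae_frequently_head (hr : 0 < r) {c : ℕ → ℤ} (hc : Function.Injective c) :
    ∀ᵐ μ ∂P, ∃ᶠ k in atTop, ∃ a ∈ Ico ((6 * c k : ℤ) + 2 : ℝ) ((6 * c k : ℤ) + 3),
      IsHead μ.points a := by
  classical
  have := hP.isProbabilityMeasure
  let B : ℕ × Bool → Set ℝ := fun p => cellPart ((6 * c p.1 : ℤ) : ℝ) p.2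
  let q : ℕ × Bool → ℕ := fun p => if p.2 then 3 else 0
  have hB : ∀ p, BddBorel (B p) := fun p => bddBorel_cellPart _ _
  have hd : Pairwise fun p p' => Disjoint (B p) (B p') := by
    rintro ⟨k, i⟩ ⟨k', i'⟩ hne
    by_cases hk : k = k'
    · subst hk
      cases i <;> cases i'
      · exact absurd rfl hne
      · exact (disjoint_cellPart _).symm
      · exact disjoint_cellPart _
      · exact absurd rfl hne
    · rw [Set.disjoint_left]
      intro t ht ht'
      have h1 := cellPart_subset _ _ ht
      have h2 := cellPart_subset _ _ ht'
      have h3 : ((6 * c k : ℤ) : ℝ) < ((6 * c k' + 6 : ℤ) : ℝ) := by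
        push_cast at h1 h2 ⊢; linarith [h1.1, h2.2]
      have h4 : ((6 * c k' : ℤ) : ℝ) < ((6 * c k + 6 : ℤ) : ℝ) := by
        push_cast at h1 h2 ⊢; linarith [h1.2, h2.1]
      have h3' := Int.cast_lt.1 h3
      have h4' := Int.cast_lt.1 h4
      exact hk (hc (by omega))
  let E : ℕ → Set PointMeasure := fun k => ⋂ i ∈ (Finset.univ : Finset Bool),
    {μ | cnt (B (k, i)) μ = q (k, i)}
  have hEm : ∀ k, MeasurableSet (E k) := fun k =>
    Finset.measurableSet_biInter _ fun i _ =>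
      measurable_cnt (hB (k, i)).1 (measurableSet_singleton _)
  have hprod : ∀ s : Finset ℕ, P (⋂ k ∈ s, E k) =
      ∏ k ∈ s, ∏ i ∈ (Finset.univ : Finset Bool), P {μ | cnt (B (k, i)) μ = q (k, i)} := by
    intro s
    rw [← Finset.prod_product', ← hP.measure_cnt_iInter hB hd]
    congr 1
    ext μ
    simp only [E, mem_iInter, Finset.mem_product, Finset.mem_univ, and_true, true_imp_iff, Prod.forall]
    exact ⟨fun h a b ha => h a ha b, fun h a ha b => h a b ha⟩
  have hE : ∀ k, P (E k) = ∏ i ∈ (Finset.univ : Finset Bool),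
      P {μ | cnt (B (k, i)) μ = q (k, i)} := by
    intro k
    have := hprod {k}
    simpa only [Finset.prod_singleton, Finset.mem_singleton, iInter_iInter_eq_left] using this
  have hind : iIndepSet E P := by
    rw [iIndepSet_iff_meas_biInter hEm]
    intro s
    rw [hprod]
    exact Finset.prod_congr rfl fun k _ => (hE k).symm
  have hconst : ∀ k, P (E k) = poissonMeasure r {3} * poissonMeasure (r * 5) {0} := by
    intro k
    rw [hE, Fintype.prod_bool, hP.measure_cnt_eq (hB _), hP.measure_cnt_eq (hB _)]
    simp only [B, q, volume_cellPart]
    simp [ENNReal.toNNReal_ofNat]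
  have hpos : ∀ (r' : ℝ≥0) (j : ℕ), 0 < r' → poissonMeasure r' {j} ≠ 0 := by
    intro r' j h h0
    have := poissonMeasure_real_singleton_pos j h
    rw [measureReal_def, h0] at this
    simp at this
  have hsum : ∑' k, P (E k) = ∞ := by
    simp_rw [hconst]
    exact ENNReal.tsum_const_eq_top_of_ne_zero
      (mul_ne_zero (hpos _ _ hr) (hpos _ _ (mul_pos hr (by norm_num))))
  have hlim := measure_limsup_eq_one hEm hind hsum
  have hlm : MeasurableSet (limsup E atTop) := MeasurableSet.measurableSet_limsup hEm
  have hae : ∀ᵐ μ ∂P, μ ∈ limsup E atTop := (prob_compl_eq_zero_iff hlm).2 hlim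
  filter_upwards [hae] with μ hμ
  rw [mem_limsup_iff_frequently_mem] at hμ
  refine hμ.mono fun k hk => ?_
  simp only [E, mem_iInter, mem_ofPred_eq, Finset.mem_univ, true_imp_iff] at hk
  exact exists_head_of_cnt (hk false) (hk true)

theorem IsPoissonLaw.ae_rich (hr : 0 < r) : ∀ᵐ μ ∂P, Rich μ.points := by
  filter_upwards [hP.ae_frequently_head hr (c := fun k => (k : ℤ)) Nat.cast_injective,
    hP.ae_frequently_head hr (c := fun k => -(k : ℤ))
      (neg_injective.comp Nat.cast_injective)] with μ h1 h2 x
  obtain ⟨N, hN⟩ := exists_nat_ge |x|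
  have hN' := abs_le.1 hN
  constructor
  · obtain ⟨k, hk, a, ha, ha'⟩ := (frequently_atTop.1 h2) (N + 1)
    refine ⟨a, ?_, ha'⟩
    have h3 : ((N + 1 : ℕ) : ℝ) ≤ k := by exact_mod_cast hk
    have := ha.2
    push_cast at this h3
    have hN0 : (0 : ℝ) ≤ N := Nat.cast_nonneg N
    linarith [hN'.1]
  · obtain ⟨k, hk, a, ha, ha'⟩ := (frequently_atTop.1 h1) (N + 1)
    refine ⟨a, ?_, ha'⟩
    have h3 : ((N + 1 : ℕ) : ℝ) ≤ k := by exact_mod_cast hk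
    have := ha.1
    push_cast at this h3
    have hN0 : (0 : ℝ) ≤ N := Nat.cast_nonneg N
    change x < a
    linarith [hN'.2]

end

end

/-! ### Fresh marks in a block. -/

section

open Filter Topology

section Merge

variable {A : Type*}

/-- Replaces the marks of the first `k` points in the cell `n`. -/
def merge (n : ℤ) (k : ℕ) (v : ℕ → A) (m : ℤ × ℕ → A) (p : ℤ × ℕ) : A :=
  if p.1 = n ∧ p.2 < k then v p.2 else m p

/-- Replaces the marks of the first `k` points in the cell `n`. -/
def mergeFin (n : ℤ) (k : ℕ) (z : (Fin k → A) × (ℤ × ℕ → A)) (p : ℤ × ℕ) : A :=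
  if h : p.1 = n ∧ p.2 < k then z.1 ⟨p.2, h.2⟩ else z.2 p

theorem mergeFin_eq (n : ℤ) (k : ℕ) (v : ℕ → A) (m : ℤ × ℕ → A) :
    mergeFin n k (fun j => v j, m) = merge n k v m := by
  funext p
  by_cases h : p.1 = n ∧ p.2 < k
  · rw [mergeFin, merge, dif_pos h, if_pos h]
  · rw [mergeFin, merge, dif_neg h, if_neg h]

end Merge

section

variable {A : Type*} [MeasurableSpace A] (α : Measure A) [IsProbabilityMeasure α]

/-- Distinct coordinates of an independent family form an independent family. -/
theorem map_infinitePi_comp {ι κ : Type*} {e : κ → ι} (he : Function.Injective e) :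
    (Measure.infinitePi fun _ : ι => α).map (fun m k => m (e k)) =
      Measure.infinitePi fun _ : κ => α := by
  classical
  refine Measure.eq_infinitePi _ fun s t ht => ?_
  have hm : Measurable fun (m : ι → A) (k : κ) => m (e k) :=
    measurable_pi_lambda _ fun k => measurable_pi_apply _
  rw [Measure.map_apply hm (MeasurableSet.pi s.countable_toSet fun i _ => ht i)]
  let t' : ι → Set A := fun p => if h : ∃ k, e k = p then t h.choose else univ
  have ht' : ∀ k, t' (e k) = t k := by
    intro k
    have h : ∃ j, e j = e k := ⟨k, rfl⟩
    have := he h.choose_spec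
    simp only [t', dif_pos h, this]
  have e1 : (fun (m : ι → A) (k : κ) => m (e k)) ⁻¹' Set.pi s t =
      Set.pi (s.map ⟨e, he⟩ : Finset ι) t' := by
    ext m
    simp [Set.mem_pi, ht']
  rw [e1, Measure.infinitePi_pi]
  · simp [ht']
  · intro p hp
    obtain ⟨k, -, rfl⟩ := Finset.mem_map.1 hp
    change MeasurableSet (t' (e k))
    rw [ht']
    exact ht k

theorem measurable_mergeFin (n : ℤ) (k : ℕ) : Measurable (mergeFin (A := A) n k) := by
  refine measurable_pi_lambda _ fun p => ?_
  by_cases h : p.1 = n ∧ p.2 < k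
  · simp only [mergeFin, dif_pos h]
    exact (measurable_pi_apply _).comp measurable_fst
  · simp only [mergeFin, dif_neg h]
    exact (measurable_pi_apply _).comp measurable_snd

/-- Replacing finitely many iid marks by independent fresh ones does not change the law of the
family. -/
theorem map_mergeFin (n : ℤ) (k : ℕ) :
    ((Measure.pi fun _ : Fin k => α).prod (Measure.infinitePi fun _ : ℤ × ℕ => α)).map
      (mergeFin n k) = Measure.infinitePi fun _ : ℤ × ℕ => α := by
  classical
  refine Measure.eq_infinitePi _ fun s t ht => ?_
  rw [Measure.map_apply (measurable_mergeFin n k)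
    (MeasurableSet.pi s.countable_toSet fun i _ => ht i)]
  let t₁ : Fin k → Set A := fun j => if (n, (j : ℕ)) ∈ s then t (n, j) else univ
  let t₂ : ℤ × ℕ → Set A := fun p => if p.1 = n ∧ p.2 < k then univ else t p
  have e1 : mergeFin n k ⁻¹' Set.pi s t = Set.pi univ t₁ ×ˢ Set.pi s t₂ := by
    ext ⟨v, m⟩
    simp only [mem_preimage, Set.mem_pi, mem_prod, Finset.mem_coe, mem_univ, true_imp_iff]
    constructor
    · intro h
      refine ⟨fun j => ?_, fun p hp => ?_⟩
      · by_cases hj : (n, (j : ℕ)) ∈ s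
        · have := h _ hj
          simp only [mergeFin, j.2, and_self, dite_true] at this
          simpa only [t₁, if_pos hj] using this
        · simp [t₁, if_neg hj]
      · by_cases hp' : p.1 = n ∧ p.2 < k
        · simp [t₂, if_pos hp']
        · have := h _ hp
          simp only [mergeFin, dif_neg hp'] at this
          simpa only [t₂, if_neg hp'] using this
    · rintro ⟨h1, h2⟩ p hp
      by_cases hp' : p.1 = n ∧ p.2 < k
      · have := h1 ⟨p.2, hp'.2⟩
        have e : (n, p.2) = p := Prod.ext hp'.1.symm rfl
        simp only [t₁, e, if_pos hp] at this
        simpa only [mergeFin, dif_pos hp'] using this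
      · have := h2 p hp
        simp only [t₂, if_neg hp'] at this
        simpa only [mergeFin, dif_neg hp'] using this
  have ht₂ : ∀ p ∈ s, MeasurableSet (t₂ p) := by
    intro p _
    simp only [t₂]
    split_ifs
    exacts [MeasurableSet.univ, ht p]
  rw [e1, Measure.prod_prod, Measure.pi_pi, Measure.infinitePi_pi _ ht₂,
    ← Finset.prod_filter_mul_prod_filter_not s (fun p => p.1 = n ∧ p.2 < k) fun p => α (t p)]
  congr 1
  · have h1 : ∀ j : Fin k, α (t₁ j) = if (n, (j : ℕ)) ∈ s then α (t (n, j)) else 1 := by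
      intro j
      simp only [t₁]
      split_ifs <;> simp
    simp_rw [h1]
    rw [← Finset.prod_filter]
    refine Finset.prod_bij (fun j _ => (n, (j : ℕ))) ?_ ?_ ?_ ?_
    · intro j hj
      simp only [Finset.mem_filter, Finset.mem_univ, true_and] at hj
      simp [hj]
    · intro i _ j _ h
      exact Fin.ext (Prod.ext_iff.1 h).2
    · rintro ⟨p1, p2⟩ hp
      simp only [Finset.mem_filter] at hp
      obtain ⟨hp, rfl, h3⟩ := hp
      exact ⟨⟨p2, h3⟩, by simpa using hp, rfl⟩
    · intro j _
      rfl
  · rw [Finset.prod_filter]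
    refine Finset.prod_congr rfl fun p _ => ?_
    by_cases hp : p.1 = n ∧ p.2 < k
    · simp [t₂, hp]
    · simp only [t₂, if_neg hp, hp, not_false_eq_true, if_true]

variable {α} (C : Coding α)

/-- Encoding a uniform variable gives a uniform variable and `k` fresh marks. -/
theorem lintegral_enc_merge (n : ℤ) (k : ℕ) {h : ℝ × (ℤ × ℕ → A) → ℝ≥0∞} (hh : Measurable h) :
    ∫⁻ u in Ioo (0 : ℝ) 1, ∫⁻ m, h ((C.enc k u).1, merge n k (C.enc k u).2 m)
        ∂(Measure.infinitePi fun _ : ℤ × ℕ => α) =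
      ∫⁻ u in Ioo (0 : ℝ) 1, ∫⁻ m, h (u, m) ∂(Measure.infinitePi fun _ : ℤ × ℕ => α) := by
  set ω := Measure.infinitePi fun _ : ℤ × ℕ => α
  have hH : Measurable fun z : (ℝ × (Fin k → A)) × (ℤ × ℕ → A) =>
      h (z.1.1, mergeFin n k (z.1.2, z.2)) := by
    refine hh.comp (measurable_fst.fst.prodMk ((measurable_mergeFin n k).comp ?_))
    exact measurable_fst.snd.prodMk measurable_snd
  let H : ℝ × (Fin k → A) → ℝ≥0∞ := fun z => ∫⁻ m, h (z.1, mergeFin n k (z.2, m)) ∂ω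
  have hHm : Measurable H := hH.lintegral_prod_right'
  have henc : Measurable fun u => ((C.enc k u).1, fun j : Fin k => (C.enc k u).2 j) :=
    (C.measurable_enc k).fst.prodMk (measurable_pi_lambda _ fun j =>
      (measurable_pi_apply _).comp (C.measurable_enc k).snd)
  calc _ = ∫⁻ u in Ioo (0 : ℝ) 1, H ((C.enc k u).1, fun j : Fin k => (C.enc k u).2 j) := by
        refine lintegral_congr fun u => ?_
        simp only [H, mergeFin_eq]
    _ = ∫⁻ z, H z ∂((volume.restrict (Ioo (0 : ℝ) 1)).prod (Measure.pi fun _ : Fin k => α)) := by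
        rw [← C.map_enc k, lintegral_map hHm henc]
    _ = ∫⁻ u in Ioo (0 : ℝ) 1, ∫⁻ v, H (u, v) ∂(Measure.pi fun _ : Fin k => α) :=
        lintegral_prod _ hHm.aemeasurable
    _ = _ := by
        refine lintegral_congr fun u => ?_
        have hu : Measurable fun m => h (u, m) := hh.comp measurable_prodMk_left
        conv_rhs => rw [show ω = _ from (map_mergeFin α n k).symm]
        rw [lintegral_map hu (measurable_mergeFin n k)]
        exact (lintegral_prod _ (hu.comp (measurable_mergeFin n k)).aemeasurable).symm

end

end

/-! ### Reinserting a single middle point. -/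

section Single

variable {S : Set ℝ} {a b t : ℝ}

/-- Moving a single middle point. -/
theorem move_update (h : Trip S a t b) {v : ℝ → ℝ} (hv : ∀ c ≠ a, IsHead S c → v c = ratio S c) :
    move S v = insert (a + (b - a) * v a) (S \ {t}) := by
  ext q
  rw [mem_move, mem_insert_iff, mem_sdiff, mem_singleton_iff]
  constructor
  · rintro (⟨h1, h2⟩ | ⟨c, m, d, h1, rfl⟩)
    · exact Or.inr ⟨h1, by rintro rfl; exact h2 ⟨a, b, h⟩⟩
    · by_cases hc : c = a
      · subst hc
        rw [(h.eq_of_left h1).2]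
        exact Or.inl rfl
      · rw [hv c hc h1.isHead, h1.mid_eq]
        exact Or.inr ⟨h1.mem_mid, by rintro rfl; exact hc (h1.eq_of_mid h).1⟩
  · rintro (rfl | ⟨h1, h2⟩)
    · exact Or.inr ⟨a, t, b, h, rfl⟩
    · by_cases hq : ∃ c d, Trip S c q d
      · obtain ⟨c, d, hq⟩ := hq
        have hc : c ≠ a := by rintro rfl; exact h2 (hq.eq_of_left h).1
        exact Or.inr ⟨c, q, d, hq, by rw [hv c hc hq.isHead, hq.mid_eq]⟩
      · exact Or.inl ⟨h1, hq⟩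

open Classical in
theorem insert_eq_move {t₀ : ℝ} (h0 : t₀ ∉ S) (h : Trip (insert t₀ S) a t₀ b) :
    insert t S = move (insert t₀ S) (Function.update (ratio (insert t₀ S)) a ((t - a) / (b - a))) := by
  have hab := h.lt
  rw [move_update h fun c hc _ => Function.update_of_ne hc _ _, Function.update_self,
    mul_div_cancel₀ _ (by linarith)]
  have : insert t₀ S \ {t₀} = S := by
    rw [insert_sdiff_of_mem _ (mem_singleton _)]
    exact sdiff_singleton_eq_self h0
  rw [this, add_sub_cancel]

/-- If `t` is put between `a` and `b` then the triple is preserved, with the same block size. -/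
theorem Trip.of_insert {t₀ : ℝ} (h0 : t₀ ∉ S) (h : Trip (insert t₀ S) a t₀ b) (ht : t ∈ Ioo a b) :
    Trip (insert t S) a t b ∧ blkSize (insert t S) a = blkSize (insert t₀ S) a ∧ t ∉ S := by
  classical
  have hab := h.lt
  have hab' : 0 < b - a := by linarith
  have hv : ∀ c, Function.update (ratio (insert t₀ S)) a ((t - a) / (b - a)) c ∈
      Ioo (0 : ℝ) 1 := by
    intro c
    by_cases hc : c = a
    · subst hc
      rw [Function.update_self]
      refine ⟨div_pos (by linarith [ht.1]) hab', ?_⟩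
      rw [div_lt_one hab']
      linarith [ht.2]
    · rw [Function.update_of_ne hc]
      exact ratio_mem _ _
  rw [insert_eq_move (t := t) h0 h]
  refine ⟨?_, blkSize_move h.isHead hv, fun hS => ?_⟩
  · have := h.move hv
    rwa [Function.update_self, mul_div_cancel₀ _ (by linarith), add_sub_cancel] at this
  · have h3 := h.2.2.1
    have h4 := (h.mem_iff (q := t) (by linarith [ht.1]) (by linarith [ht.2])).1 (Or.inr hS)
    have h1 := ht.1
    have h2 := ht.2
    rcases h4 with h4 | h4 | h4
    · linarith
    · exact h0 (h4 ▸ hS)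
    · linarith

/-- Once the middle point is removed, its cell determines the two end points. With `Trip.of_insert`,
the positions outside `S` where a point completes a triple starting in this cell form the interval
`(a, b)` or nothing at all. -/
theorem Trip.eq_of_insert {t₀ a' b' : ℝ} (h0 : t₀ ∉ S) (h : Trip (insert t₀ S) a t₀ b)
    (h1 : t ∉ S) (h' : Trip (insert t S) a' t b') (hf : ⌊a'⌋ = ⌊a⌋) : a' = a ∧ b' = b := by
  have hl : ∀ {s x y : ℝ}, s ∉ S → Trip (insert s S) x s y → x ∈ S ∧ y ∈ S := by
    intro s x y hs hT
    have e1 := hT.1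
    have e2 := hT.2.1
    have e3 := hT.mem_left
    have e4 := hT.mem_right
    rw [mem_insert_iff] at e3 e4
    exact ⟨e3.resolve_left (by linarith), e4.resolve_left (by linarith)⟩
  obtain ⟨ha, hb⟩ := hl h0 h
  obtain ⟨ha', hb'⟩ := hl h1 h'
  have hd := abs_lt.1 (Int.abs_sub_lt_one_of_floor_eq_floor hf)
  obtain ⟨q1, q2, q3, -⟩ := id h
  obtain ⟨q1', q2', q3', -⟩ := id h'
  have e1 := (h.mem_iff (q := a') (by linarith) (by linarith)).1 (Or.inr ha')
  have e2 := (h'.mem_iff (q := a) (by linarith) (by linarith)).1 (Or.inr ha)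
  have key : a' = a := by
    rcases e1 with e1 | e1 | e1
    · exact e1
    · exact absurd (e1 ▸ ha') h0
    · rcases e2 with e2 | e2 | e2 <;> linarith
  subst key
  refine ⟨rfl, ?_⟩
  have e3 := (h.mem_iff (q := b') (by linarith) (by linarith)).1 (Or.inr hb')
  rcases e3 with e3 | e3 | e3
  · linarith
  · exact absurd (e3 ▸ hb') h0
  · exact e3

end Single

/-! ### Coding in one cell preserves the law. -/

section Cell

variable {A : Type*} [MeasurableSpace A] {α : Measure A} (C : Coding α)

/-- The point `s` is the middle of a triple that starts in the cell `n`. -/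
def MidIn (n : ℤ) (S : Set ℝ) (s : ℝ) : Prop := ∃ a b, Trip S a s b ∧ ⌊a⌋ = n

theorem measurableSet_midIn (n : ℤ) :
    MeasurableSet {z : PointMeasure × ℝ | MidIn n z.1.points z.2} := by
  refine measurableSet_exists_trip_mid (π := fun z : PointMeasure × ℝ => z.1) measurable_fst
    measurable_snd (p := fun _ a _ => ⌊a⌋ = n) ?_
  exact measurable_floorInt measurable_fst.snd (measurableSet_singleton n)

theorem MidIn.mem_Icc {n : ℤ} {S : Set ℝ} {s : ℝ} (h : MidIn n S s) :
    s ∈ Icc (n : ℝ) (n + 2) := by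
  obtain ⟨a, b, h, rfl⟩ := h
  obtain ⟨h1, h2, h3, -⟩ := h
  have h4 := Int.floor_le a
  have h5 := Int.lt_floor_add_one a
  exact ⟨by linarith, by linarith⟩

theorem partMap_of_not {n : ℤ} {y : PointMeasure × (ℤ × ℕ → A)}
    (h : ¬ ∃ s, MidIn n y.1.points s) : partMap C {n} y = y := by
  have h' : ∀ a, IsHead y.1.points a → ⌊a⌋ ≠ n := by
    rintro a ⟨m, b, ha⟩ hn
    exact h ⟨m, a, b, ha, hn⟩
  refine Prod.ext (PointMeasure.ext_points ?_) ?_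
  · simp only [partMap, points_ofSet, partSet]
    conv_rhs => rw [← move_ratio (S := y.1.points)]
    refine move_congr fun a ha => ?_
    rw [partPos, if_neg]
    exact h' a ha
  · funext p
    refine partMarks_of_not C ?_ y.2
    rintro ⟨hp, a, ha⟩
    exact h' a ha.1 (ha.2.1.trans hp)

/-- For fixed `μ`, the position `t` enters only through its ratio in `(a, b)`: the end points and
the block size are the same for all `t` in between. -/
theorem partMap_addPoint {n : ℤ} {μ : PointMeasure} {t a b : ℝ} (ht : t ∉ μ.points)
    (h : Trip (insert t μ.points) a t b) (hn : ⌊a⌋ = n) (m : ℤ × ℕ → A) :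
    partMap C {n} (addPoint μ t, m) =
      (addPoint μ (a + (b - a) * (C.enc (blkSize (insert t μ.points) a) ((t - a) / (b - a))).1),
        merge n (blkSize (insert t μ.points) a)
          (C.enc (blkSize (insert t μ.points) a) ((t - a) / (b - a))).2 m) := by
  refine Prod.ext (PointMeasure.ext_points ?_) ?_
  · simp only [partMap, points_ofSet, partSet, points_addPoint]
    rw [move_update h]
    · rw [partPos, if_pos (show ⌊a⌋ ∈ ({n} : Set ℤ) from hn), encPos, h.ratio_eq]
      rw [insert_sdiff_of_mem _ (mem_singleton _), sdiff_singleton_eq_self ht]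
    · intro c hc hc'
      rw [partPos, if_neg]
      intro hcn
      exact hc (hc'.eq_of_floor h.isHead ((hcn : ⌊c⌋ = n).trans hn.symm))
  · funext p
    simp only [partMap, points_addPoint, merge]
    by_cases hp : p.1 = n ∧ p.2 < blkSize (insert t μ.points) a
    · rw [if_pos hp, partMarks_of_owns C (show p.1 ∈ ({n} : Set ℤ) from hp.1)
        ⟨h.isHead, hn.trans hp.1.symm, hp.2⟩, h.ratio_eq]
    · rw [if_neg hp, partMarks_of_not]
      rintro ⟨h1, c, hc⟩
      have : c = a := hc.1.eq_of_floor h.isHead (hc.2.1.trans ((h1 : p.1 = n).trans hn.symm))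
      subst this
      exact hp ⟨h1, hc.2.2⟩

/-- A cell has at most one triple, so the sum over the middle points has at most one term. This puts
an integral over configurations into the form required by the Mecke equation. -/
theorem lintegral_midIn {n : ℤ} (μ : PointMeasure) (g : ℝ≥0∞) :
    ∫⁻ s in Icc (n : ℝ) (n + 2), {s | MidIn n μ.points s}.indicator (fun _ => g) s ∂μ.toMeasure =
      {μ : PointMeasure | ∃ s, MidIn n μ.points s}.indicator (fun _ => g) μ := by
  have hm : MeasurableSet {s | MidIn n μ.points s} :=
    measurableSet_section (p := fun (μ : PointMeasure) s => MidIn n μ.points s)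
      (measurableSet_midIn n) μ
  have hsub : {s | MidIn n μ.points s} ⊆ Icc (n : ℝ) (n + 2) := fun s hs => MidIn.mem_Icc hs
  rw [lintegral_indicator hm, Measure.restrict_restrict hm, setLIntegral_const,
    inter_eq_self_of_subset_left hsub, μ.apply_eq hm]
  by_cases h : ∃ s, MidIn n μ.points s
  · obtain ⟨s, a, b, h, hn⟩ := id h
    have e : μ.points ∩ {s | MidIn n μ.points s} = {s} := by
      ext s'
      simp only [mem_inter_iff, mem_ofPred_eq, mem_singleton_iff]
      constructor
      · rintro ⟨-, a', b', h', hn'⟩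
        have := h'.isHead.eq_of_floor h.isHead (hn'.trans hn.symm)
        subst this
        exact (h'.eq_of_left h).1
      · rintro rfl
        exact ⟨h.mem_mid, a, b, h, hn⟩
    rw [e, indicator_of_mem (show μ ∈ {μ : PointMeasure | ∃ s, MidIn n μ.points s} from
      ⟨s, a, b, h, hn⟩)]
    simp
  · have e : μ.points ∩ {s | MidIn n μ.points s} = ∅ := by
      ext s'
      simp only [mem_inter_iff, mem_ofPred_eq, mem_empty_iff_false, iff_false, not_and]
      exact fun _ h' => h ⟨s', h'⟩
    rw [e, indicator_of_notMem (show μ ∉ {μ : PointMeasure | ∃ s, MidIn n μ.points s} from h)]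
    simp

theorem lintegral_Ioo_affine {a b : ℝ} (hab : a < b) (f : ℝ → ℝ≥0∞) :
    ∫⁻ t in Ioo a b, f t =
      ENNReal.ofReal (b - a) * ∫⁻ u in Ioo (0 : ℝ) 1, f (a + (b - a) * u) := by
  have hba : 0 < b - a := by linarith
  have himg : (fun u => a + (b - a) * u) '' Ioo (0 : ℝ) 1 = Ioo a b := by
    ext t
    simp only [mem_image, mem_Ioo]
    constructor
    · rintro ⟨u, hu, rfl⟩
      exact new_mem_Ioo hab hu
    · rintro ⟨h1, h2⟩
      refine ⟨(t - a) / (b - a), ⟨div_pos (by linarith) hba, ?_⟩, ?_⟩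
      · rw [div_lt_one hba]; linarith
      · rw [mul_div_cancel₀ _ hba.ne']; ring
  have hinj : InjOn (fun u => a + (b - a) * u) (Ioo (0 : ℝ) 1) := by
    intro u _ w _ h
    simp only [add_right_inj] at h
    exact mul_left_cancel₀ hba.ne' h
  have hderiv : ∀ u ∈ Ioo (0 : ℝ) 1, HasDerivWithinAt (fun u => a + (b - a) * u) (b - a)
      (Ioo 0 1) u := by
    intro u _
    have := ((hasDerivAt_id u).const_mul (b - a)).const_add a
    simpa using this.hasDerivWithinAt
  rw [← himg, lintegral_image_eq_lintegral_abs_deriv_mul measurableSet_Ioo hderiv hinj,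
    abs_of_pos hba, lintegral_const_mul' _ _ ENNReal.ofReal_ne_top]

variable [IsProbabilityMeasure α]

/-- The heart of the law computation. With the remaining points fixed, the integral over `t` runs
over one interval `(a, b)` up to a null set. In relative coordinates the point is uniform, and
coding replaces it by a uniform position with fresh marks, which has no effect by
`lintegral_enc_merge`. -/
theorem lintegral_addPoint_partMap (n : ℤ) (μ : PointMeasure)
    {h : PointMeasure × (ℤ × ℕ → A) → ℝ≥0∞} (hh : Measurable h) :
    ∫⁻ t in Icc (n : ℝ) (n + 2), {t | MidIn n (addPoint μ t).points t}.indicator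
        (fun t => ∫⁻ m, h (partMap C {n} (addPoint μ t, m))
          ∂(Measure.infinitePi fun _ : ℤ × ℕ => α)) t =
      ∫⁻ t in Icc (n : ℝ) (n + 2), {t | MidIn n (addPoint μ t).points t}.indicator
        (fun t => ∫⁻ m, h (addPoint μ t, m) ∂(Measure.infinitePi fun _ : ℤ × ℕ => α)) t := by
  set ω := Measure.infinitePi fun _ : ℤ × ℕ => α
  have hnull : ∀ᵐ t ∂(volume.restrict (Icc (n : ℝ) (n + 2))), t ∉ μ.points :=
    ae_restrict_of_ae (μ.locFin.countable.ae_notMem _)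
  by_cases hD : ∃ t₀, t₀ ∉ μ.points ∧ MidIn n (insert t₀ μ.points) t₀
  · obtain ⟨t₀, h0, a, b, hT, hn⟩ := hD
    have hab := hT.lt
    have hba : 0 < b - a := by linarith
    have hsub : Ioo a b ⊆ Icc (n : ℝ) (n + 2) := by
      intro t ht
      have h3 := hT.2.2.1
      have h4 := Int.floor_le a
      have h5 := Int.lt_floor_add_one a
      rw [hn] at h4 h5
      exact ⟨by linarith [ht.1], by linarith [ht.2]⟩
    have hred : ∀ g : ℝ → ℝ≥0∞, ∫⁻ t in Icc (n : ℝ) (n + 2),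
        {t | MidIn n (addPoint μ t).points t}.indicator g t = ∫⁻ t in Ioo a b, g t := by
      intro g
      have e : ∫⁻ t in Icc (n : ℝ) (n + 2),
        {t | MidIn n (addPoint μ t).points t}.indicator g t =
          ∫⁻ t in Icc (n : ℝ) (n + 2), (Ioo a b).indicator g t := by
        refine lintegral_congr_ae ?_
        filter_upwards [hnull] with t ht
        have : MidIn n (addPoint μ t).points t ↔ t ∈ Ioo a b := by
          rw [points_addPoint]
          constructor
          · rintro ⟨a', b', h', hn'⟩
            obtain ⟨rfl, rfl⟩ := Trip.eq_of_insert h0 hT ht h' (hn'.trans hn.symm)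
            exact ⟨h'.1, h'.2.1⟩
          · intro ht'
            exact ⟨a, b, (hT.of_insert h0 ht').1, hn⟩
        by_cases hc : t ∈ Ioo a b
        · rw [indicator_of_mem hc, indicator_of_mem
            (show t ∈ {t | MidIn n (addPoint μ t).points t} from this.2 hc)]
        · rw [indicator_of_notMem hc, indicator_of_notMem
            (show t ∉ {t | MidIn n (addPoint μ t).points t} from fun hc' => hc (this.1 hc'))]
      rw [e, lintegral_indicator measurableSet_Ioo, Measure.restrict_restrict measurableSet_Ioo,
        inter_eq_self_of_subset_left hsub]
    rw [hred, hred, lintegral_Ioo_affine hab, lintegral_Ioo_affine hab]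
    congr 1
    have hm : Measurable fun z : ℝ × (ℤ × ℕ → A) => h (addPoint μ (a + (b - a) * z.1), z.2) := by
      refine hh.comp (Measurable.prodMk ?_ measurable_snd)
      exact (measurable_addPoint.comp measurable_prodMk_left).comp (by fun_prop)
    rw [← lintegral_enc_merge C n (blkSize (insert t₀ μ.points) a) hm]
    refine setLIntegral_congr_fun measurableSet_Ioo fun u hu => ?_
    have ht := new_mem_Ioo hab hu
    obtain ⟨h1, h2, h3⟩ := hT.of_insert (t := a + (b - a) * u) h0 ht
    refine lintegral_congr fun m => ?_
    rw [partMap_addPoint C h3 h1 hn, h2, add_sub_cancel_left, mul_div_cancel_left₀ _ hba.ne']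
  · have hz : ∀ g : ℝ → ℝ≥0∞, ∫⁻ t in Icc (n : ℝ) (n + 2),
        {t | MidIn n (addPoint μ t).points t}.indicator g t = 0 := by
      intro g
      rw [← lintegral_zero (μ := volume.restrict (Icc (n : ℝ) (n + 2)))]
      refine lintegral_congr_ae ?_
      filter_upwards [hnull] with t ht
      refine indicator_of_notMem (fun hc => ?_) _
      rw [mem_ofPred_eq, points_addPoint] at hc
      exact hD ⟨t, ht, hc⟩
    rw [hz, hz]

variable {r : ℝ≥0} {P : Measure PointMeasure}

theorem bddBorel_Icc (x y : ℝ) : BddBorel (Icc x y) := by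
  refine ⟨measurableSet_Icc, max |x| |y|, Icc_subset_Icc ?_ ?_⟩
  · exact neg_le.1 ((neg_le_abs x).trans (le_max_left _ _))
  · exact (le_abs_self y).trans (le_max_right _ _)

/-- Coding in a single cell preserves the law of a marked Poisson process. -/
theorem IsPoissonLaw.map_partMap_singleton (hP : IsPoissonLaw r P) (n : ℤ) :
    (P.prod (Measure.infinitePi fun _ : ℤ × ℕ => α)).map (partMap C {n}) =
      P.prod (Measure.infinitePi fun _ : ℤ × ℕ => α) := by
  have := hP.isProbabilityMeasure
  set ω := Measure.infinitePi fun _ : ℤ × ℕ => α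
  refine Measure.ext_of_lintegral _ fun h hh => ?_
  have hpm := measurable_partMap C {n}
  rw [lintegral_map hh hpm]
  refine (lintegral_prod _ (hh.comp hpm).aemeasurable).trans ?_
  rw [lintegral_prod _ hh.aemeasurable]
  set g₁ : PointMeasure → ℝ≥0∞ := fun μ => ∫⁻ m, h (partMap C {n} (μ, m)) ∂ω
  set g₂ : PointMeasure → ℝ≥0∞ := fun μ => ∫⁻ m, h (μ, m) ∂ω
  have hg₁ : Measurable g₁ := (hh.comp hpm).lintegral_prod_right'
  have hg₂ : Measurable g₂ := hh.lintegral_prod_right'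
  have hset : MeasurableSet {μ : PointMeasure | ∃ s, MidIn n μ.points s} := by
    have : {μ : PointMeasure | ∃ s, MidIn n μ.points s} =
        {μ : PointMeasure | ∃ s ∈ μ.points, MidIn n μ.points s} := by
      ext μ
      exact ⟨fun ⟨s, a, b, hs⟩ => ⟨s, hs.1.mem_mid, a, b, hs⟩, fun ⟨s, _, hs⟩ => ⟨s, hs⟩⟩
    rw [this]
    exact measurableSet_exists measurable_id (p := fun μ s => MidIn n μ.points s)
      (measurableSet_midIn n)
  -- On the event that the cell has a triple, Mecke's equation removes the middle point and adds it
  -- again as an integration variable. Off this event the coding does nothing, see `k2`.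
  have key : ∀ g : PointMeasure → ℝ≥0∞, Measurable g →
      ∫⁻ μ in {μ | ∃ s, MidIn n μ.points s}, g μ ∂P =
        r * ∫⁻ μ, (∫⁻ t in Icc (n : ℝ) (n + 2), {t | MidIn n (addPoint μ t).points t}.indicator
          (fun t => g (addPoint μ t)) t) ∂P := by
    intro g hg
    have hF : Measurable fun z : PointMeasure × ℝ =>
        {z : PointMeasure × ℝ | MidIn n z.1.points z.2}.indicator (fun z => g z.1) z :=
      (hg.comp measurable_fst).indicator (measurableSet_midIn n)
    have hM := hP.mecke (bddBorel_Icc n (n + 2)) hF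
    have e1 : ∀ μ : PointMeasure, ∫⁻ s in Icc (n : ℝ) (n + 2),
        {z : PointMeasure × ℝ | MidIn n z.1.points z.2}.indicator (fun z => g z.1) (μ, s)
          ∂μ.toMeasure = {μ : PointMeasure | ∃ s, MidIn n μ.points s}.indicator g μ :=
      fun μ => lintegral_midIn μ (g μ)
    simp_rw [e1] at hM
    rw [lintegral_indicator hset] at hM
    rw [hM, lintegral_lintegral_swap]
    · rfl
    · have : Measurable fun z : ℝ × PointMeasure => (addPoint z.2 z.1, z.1) :=
        (measurable_addPoint.comp measurable_swap).prodMk measurable_fst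
      exact (hF.comp this).aemeasurable
  have k1 : ∫⁻ μ in {μ | ∃ s, MidIn n μ.points s}, g₁ μ ∂P =
      ∫⁻ μ in {μ | ∃ s, MidIn n μ.points s}, g₂ μ ∂P := by
    rw [key g₁ hg₁, key g₂ hg₂]
    congr 1
    exact lintegral_congr fun μ => lintegral_addPoint_partMap C n μ hh
  have k2 : ∫⁻ μ in {μ | ∃ s, MidIn n μ.points s}ᶜ, g₁ μ ∂P =
      ∫⁻ μ in {μ | ∃ s, MidIn n μ.points s}ᶜ, g₂ μ ∂P := by
    refine setLIntegral_congr_fun hset.compl fun μ hμ => ?_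
    refine lintegral_congr fun m => ?_
    rw [partMap_of_not C (y := (μ, m)) hμ]
  change ∫⁻ μ, g₁ μ ∂P = ∫⁻ μ, g₂ μ ∂P
  rw [← lintegral_add_compl g₁ hset, ← lintegral_add_compl g₂ hset, k1, k2]

end Cell

/-! ### From one cell to all cells. -/

section Local

variable {A : Type*}

/-- The points in `[-N, N]` and the marks in the cells `-N, …, N` are the same. -/
def AgreeUpTo (N : ℕ) (y y' : PointMeasure × (ℤ × ℕ → A)) : Prop :=
  y.1.points ∩ Icc (-(N : ℝ)) N = y'.1.points ∩ Icc (-(N : ℝ)) N ∧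
    ∀ p : ℤ × ℕ, |p.1| ≤ N → y.2 p = y'.2 p

theorem AgreeUpTo.mono {N M : ℕ} (h : N ≤ M) {y y' : PointMeasure × (ℤ × ℕ → A)}
    (hy : AgreeUpTo M y y') : AgreeUpTo N y y' := by
  have hNM : (N : ℝ) ≤ M := by exact_mod_cast h
  have hI : Icc (-(N : ℝ)) N ⊆ Icc (-(M : ℝ)) M := Icc_subset_Icc (by linarith) hNM
  refine ⟨?_, fun p hp => hy.2 p (by omega)⟩
  rw [← inter_eq_self_of_subset_right hI, ← inter_assoc, ← inter_assoc, hy.1]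

/-- The measurable sets that depend on a bounded window only. -/
def localSets (A : Type*) [MeasurableSpace A] : Set (Set (PointMeasure × (ℤ × ℕ → A))) :=
  {Q | MeasurableSet Q ∧ ∃ N, ∀ y y', AgreeUpTo N y y' → (y ∈ Q ↔ y' ∈ Q)}

theorem move_inter_Icc_subset {S : Set ℝ} {v w : ℝ → ℝ} (hv : ∀ a, v a ∈ Ioo (0 : ℝ) 1) {x y : ℝ}
    (h : ∀ a, x - 1 ≤ a → a ≤ y → v a = w a) : move S v ∩ Icc x y ⊆ move S w := by
  rintro q ⟨hq, h1, h2⟩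
  rw [mem_move] at hq ⊢
  rcases hq with hq | ⟨a, m, b, ht, rfl⟩
  · exact Or.inl hq
  · obtain ⟨n1, n2⟩ := new_mem_Ioo ht.lt (hv a)
    have h3 := ht.2.2.1
    exact Or.inr ⟨a, m, b, ht, by rw [h a (by linarith) (by linarith)]⟩

variable [MeasurableSpace A]

theorem isPiSystem_localSets : IsPiSystem (localSets A) := by
  rintro Q ⟨hQ, N, hN⟩ R ⟨hR, M, hM⟩ -
  refine ⟨hQ.inter hR, max N M, fun y y' h => ?_⟩
  rw [mem_inter_iff, mem_inter_iff, hN y y' (h.mono (le_max_left _ _)),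
    hM y y' (h.mono (le_max_right _ _))]

theorem generateFrom_localSets :
    (inferInstance : MeasurableSpace (PointMeasure × (ℤ × ℕ → A))) =
      MeasurableSpace.generateFrom (localSets A) := by
  refine le_antisymm (sup_le ?_ ?_) (MeasurableSpace.generateFrom_le fun Q hQ => hQ.1)
  · refine (MeasurableSpace.comap_mono eq_iSup_comap_cnt.le).trans ?_
    rw [MeasurableSpace.comap_iSup]
    refine iSup_le fun B => ?_
    rw [MeasurableSpace.comap_comp]
    rintro _ ⟨T, -, rfl⟩
    refine MeasurableSpace.measurableSet_generateFrom ⟨?_, ?_⟩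
    · exact ((measurable_cnt B.2.1).comp measurable_fst) (MeasurableSpace.measurableSet_top)
    · obtain ⟨c, hc⟩ := B.2.2
      obtain ⟨N, hN⟩ := exists_nat_ge c
      refine ⟨N, fun y y' h => ?_⟩
      have hI : B.1 ⊆ Icc (-(N : ℝ)) N := hc.trans (Icc_subset_Icc (by linarith) hN)
      have : y.1.points ∩ B.1 = y'.1.points ∩ B.1 := by
        rw [← inter_eq_self_of_subset_right hI, ← inter_assoc, ← inter_assoc, h.1]
      simp only [mem_preimage, Function.comp_apply, cnt, this]
  · rw [MeasurableSpace.pi, MeasurableSpace.comap_iSup]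
    refine iSup_le fun p => ?_
    rw [MeasurableSpace.comap_comp]
    rintro _ ⟨T, hT, rfl⟩
    refine MeasurableSpace.measurableSet_generateFrom ⟨?_, p.1.natAbs, fun y y' h => ?_⟩
    · exact ((measurable_pi_apply p).comp measurable_snd) hT
    · simp only [mem_preimage, Function.comp_apply]
      rw [h.2 p (Int.abs_eq_natAbs p.1).le]

variable {α : Measure A} (C : Coding α)

/-- A moved point in `[-N, N]` is at most one to the right of its head, hence the additional cell
`-N - 1`. -/
theorem agreeUpTo_partMap (N : ℕ) (y : PointMeasure × (ℤ × ℕ → A)) :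
    AgreeUpTo N (partMap C univ y)
      (partMap C (Finset.Icc (-(N : ℤ) - 1) N : Finset ℤ) y) := by
  have hv : ∀ a : ℝ, -(N : ℝ) - 1 ≤ a → a ≤ N → partPos C univ y.1.points a =
      partPos C (Finset.Icc (-(N : ℤ) - 1) N : Finset ℤ) y.1.points a := by
    intro a h1 h2
    have h3 : -(N : ℤ) - 1 ≤ ⌊a⌋ := Int.le_floor.2 (by push_cast; exact h1)
    have h4 : ⌊a⌋ ≤ N := by
      have := Int.floor_le_floor h2
      rwa [Int.floor_natCast] at this
    rw [partPos, partPos, if_pos (mem_univ _), if_pos]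
    rw [Finset.mem_coe, Finset.mem_Icc]
    exact ⟨h3, h4⟩
  refine ⟨?_, fun p hp => ?_⟩
  · simp only [partMap, points_ofSet, partSet]
    exact subset_antisymm
      (subset_inter (move_inter_Icc_subset (partPos_mem C _ _) hv) inter_subset_right)
      (subset_inter (move_inter_Icc_subset (partPos_mem C _ _) fun a h1 h2 => (hv a h1 h2).symm)
        inter_subset_right)
  · have hpF : p.1 ∈ ((Finset.Icc (-(N : ℤ) - 1) N : Finset ℤ) : Set ℤ) := by
      rw [Finset.mem_coe, Finset.mem_Icc]
      have := abs_le.1 hp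
      omega
    simp only [partMap]
    by_cases h : ∃ a, Owns y.1.points p a
    · obtain ⟨a, h⟩ := h
      rw [partMarks_of_owns C (mem_univ _) h, partMarks_of_owns C hpF h]
    · rw [partMarks_of_not C (fun h' => h h'.2), partMarks_of_not C (fun h' => h h'.2)]

theorem partMap_empty : partMap C ∅ = id := by
  funext y
  refine Prod.ext (PointMeasure.ext_points ?_) (funext fun p => ?_)
  · simp only [partMap, points_ofSet, partSet, id]
    conv_rhs => rw [← move_ratio (S := y.1.points)]
    exact move_congr fun a _ => by rw [partPos, if_neg (notMem_empty _)]
  · exact partMarks_of_not C (fun h => notMem_empty _ h.1) _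

variable [IsProbabilityMeasure α] {r : ℝ≥0} {P : Measure PointMeasure}

theorem IsPoissonLaw.map_partMap_finset (hP : IsPoissonLaw r P) (F : Finset ℤ) :
    (P.prod (Measure.infinitePi fun _ : ℤ × ℕ => α)).map (partMap C F) =
      P.prod (Measure.infinitePi fun _ : ℤ × ℕ => α) := by
  classical
  induction F using Finset.induction_on with
  | empty => rw [Finset.coe_empty, partMap_empty, Measure.map_id]
  | insert n F hn ih =>
    have e : partMap C ((insert n F : Finset ℤ) : Set ℤ) = partMap C {n} ∘ partMap C F := by
      funext y
      rw [Finset.coe_insert]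
      exact (partMap_partMap C (F := F) (by exact_mod_cast hn) y).symm
    rw [e, ← Measure.map_map (measurable_partMap C _) (measurable_partMap C _), ih,
      hP.map_partMap_singleton]

/-- No limit is needed: an event that depends on a bounded window has the same preimage under coding
in all cells and in finitely many, and such events form a generating π-system. -/
theorem IsPoissonLaw.map_partMap_univ (hP : IsPoissonLaw r P) :
    (P.prod (Measure.infinitePi fun _ : ℤ × ℕ => α)).map (partMap C univ) =
      P.prod (Measure.infinitePi fun _ : ℤ × ℕ => α) := by
  have := hP.isProbabilityMeasure
  have hm := measurable_partMap C univ
  have := Measure.isProbabilityMeasure_map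
    (μ := P.prod (Measure.infinitePi fun _ : ℤ × ℕ => α)) hm.aemeasurable
  refine ext_of_generate_finite (localSets A) generateFrom_localSets isPiSystem_localSets ?_ ?_
  · rintro Q ⟨hQ, N, hN⟩
    have hF := measurable_partMap C (Finset.Icc (-(N : ℤ) - 1) N : Finset ℤ)
    rw [Measure.map_apply hm hQ]
    conv_rhs => rw [← hP.map_partMap_finset C (Finset.Icc (-(N : ℤ) - 1) N)]
    rw [Measure.map_apply hF hQ]
    congr 1
    ext y
    exact hN _ _ (agreeUpTo_partMap C N y)
  · rw [measure_univ, measure_univ]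

end Local

/-! ### From addresses back to labels, and the law of the encoder. -/

section Read

variable {S : Set ℝ}

theorem Rich.exists_lab_ge (h : Rich S) (hS : LocFin S) (k : ℕ) :
    ∃ y, IsHead S y ∧ (k : ℤ) ≤ lab S y := by
  induction k with
  | zero =>
    obtain ⟨y, hy, hy'⟩ := (h 0).2
    have := lab_mono hS (le_of_lt hy)
    exact ⟨y, hy', by simpa [lab] using this⟩
  | succ k ih =>
    obtain ⟨y, -, hk⟩ := ih
    obtain ⟨z, hz, hz'⟩ := (h y).2
    have := lab_lt_of_mem hS hz'.mem hz
    exact ⟨z, hz', by push_cast; omega⟩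

theorem Rich.exists_lab_le (h : Rich S) (hS : LocFin S) (k : ℕ) :
    ∃ x, IsHead S x ∧ lab S x ≤ -(k : ℤ) := by
  induction k with
  | zero =>
    obtain ⟨y, hy, hy'⟩ := (h 0).1
    have := lab_mono hS (le_of_lt hy)
    exact ⟨y, hy', by simpa [lab] using this⟩
  | succ k ih =>
    obtain ⟨y, hy, hk⟩ := ih
    obtain ⟨z, hz, hz'⟩ := (h y).1
    have := lab_lt_of_mem hS hy.mem hz
    exact ⟨z, hz', by push_cast; omega⟩

theorem Rich.exists_slot (h : Rich S) (hS : LocFin S) (i : ℤ) : ∃ a, Slot S i a := by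
  obtain ⟨x, hx, hx'⟩ := h.exists_lab_le hS |i|.toNat
  obtain ⟨y, hy, hy'⟩ := h.exists_lab_ge hS (|i|.toNat + 1)
  have h1 := le_abs_self i
  have h2 := neg_abs_le i
  obtain ⟨a, -, -, ha⟩ := MarkedPoisson.exists_slot hS hx hy (i := i) (by omega)
    (by push_cast at hy'; omega)
  exact ⟨a, ha⟩

variable {A : Type*} [MeasurableSpace A] (α : Measure A) [IsProbabilityMeasure α] (a₀ : A)

/-- With heads in both directions every label has an address. Different labels have different
addresses, because the cell determines the head; so reading selects distinct coordinates of an iid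
family. -/
theorem Rich.measurable_map_readMarks (h : Rich S) (hS : LocFin S) :
    Measurable (readMarks a₀ S) ∧
      (Measure.infinitePi fun _ : ℤ × ℕ => α).map (readMarks a₀ S) =
        Measure.infinitePi fun _ : ℤ => α := by
  choose a ha using h.exists_slot hS
  have e : readMarks a₀ S = fun m i => m (⌊a i⌋, (i - lab S (a i)).toNat) := by
    funext m i
    exact readMarks_of_slot a₀ hS (ha i) m
  have hinj : Function.Injective fun i => (⌊a i⌋, (i - lab S (a i)).toNat) := by
    intro i j hij
    obtain ⟨h1, h2⟩ := Prod.ext_iff.1 hij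
    simp only at h1 h2
    rw [(ha i).1.eq_of_floor (ha j).1 h1] at h2
    have h3 := (ha i).2.1
    rw [(ha i).1.eq_of_floor (ha j).1 h1] at h3
    have h4 := (ha j).2.1
    omega
  rw [e]
  exact ⟨measurable_pi_lambda _ fun i => measurable_pi_apply _, map_infinitePi_comp α hinj⟩

variable {r : ℝ≥0} {P : Measure PointMeasure}

theorem IsPoissonLaw.map_readMap (hP : IsPoissonLaw r P) (hr : 0 < r) :
    (P.prod (Measure.infinitePi fun _ : ℤ × ℕ => α)).map (readMap a₀) =
      P.prod (Measure.infinitePi fun _ : ℤ => α) := by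
  have := hP.isProbabilityMeasure
  have hm := measurable_readMap (A := A) a₀
  refine Measure.ext_of_lintegral _ fun h hh => ?_
  rw [lintegral_map hh hm]
  refine (lintegral_prod _ (hh.comp hm).aemeasurable).trans ?_
  rw [lintegral_prod _ hh.aemeasurable]
  refine lintegral_congr_ae ?_
  filter_upwards [hP.ae_rich hr] with μ hμ
  obtain ⟨h1, h2⟩ := hμ.measurable_map_readMarks α a₀ μ.locFin
  have hμh : Measurable fun x => h (μ, x) := hh.comp measurable_prodMk_left
  rw [← h2, lintegral_map hμh h1]
  rfl

variable {α} (C : Coding α)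

/-- The law of the encoded process. -/
theorem IsPoissonLaw.map_encMap (hP : IsPoissonLaw r P) (hr : 0 < r) :
    P.map (encMap C a₀) = P.prod (Measure.infinitePi fun _ : ℤ => α) := by
  have := hP.isProbabilityMeasure
  set ω := Measure.infinitePi fun _ : ℤ × ℕ => α
  -- Auxiliary marks are added to `μ` although the encoder ignores them; this makes the
  -- factorization through the cells available.
  have e : encMap C a₀ ∘ Prod.fst = readMap a₀ ∘ partMap C univ := by
    funext y
    exact (readMap_partMap_univ C a₀ y).symm
  have e1 : (P.prod ω).map Prod.fst = P := by
    rw [Measure.map_fst_prod, measure_univ, one_smul]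
  conv_lhs => rw [← e1]
  rw [Measure.map_map (measurable_encMap C a₀) measurable_fst, e,
    ← Measure.map_map (measurable_readMap a₀) (measurable_partMap C univ),
    hP.map_partMap_univ C, hP.map_readMap α a₀ hr]

end Read

theorem measurableSet_eq_pointMeasure {X : Type*} [MeasurableSpace X] {f g : X → PointMeasure}
    (hf : Measurable f) (hg : Measurable g) : MeasurableSet {x | f x = g x} := by
  have key : ∀ {f g : X → PointMeasure}, Measurable f → Measurable g →
      MeasurableSet {x | ¬ ∃ s ∈ (f x).points, s ∉ (g x).points} := fun hf hg =>
    (measurableSet_exists hf (measurableSet_mem_points (hg.comp measurable_fst)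
      measurable_snd).compl).compl
  have e : {x | f x = g x} = {x | ¬ ∃ s ∈ (f x).points, s ∉ (g x).points} ∩
      {x | ¬ ∃ s ∈ (g x).points, s ∉ (f x).points} := by
    ext x
    simp only [mem_ofPred_eq, mem_inter_iff, not_exists, not_and, not_not]
    constructor
    · intro h
      rw [h]
      exact ⟨fun _ h => h, fun _ h => h⟩
    · rintro ⟨h1, h2⟩
      exact PointMeasure.ext_points (subset_antisymm h1 h2)
  rw [e]
  exact (key hf hg).inter (key hg hf)

end MarkedPoisson

end

/-! ### The main theorem. -/

theorem mainTheorem2 {A : Type*} [MeasurableSpace A] [StandardBorelSpace A]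
    (α : Measure A) [IsProbabilityMeasure α] :
    ∃ (ψ : MarkedPoisson.PointMeasure → MarkedPoisson.PointMeasure × (ℤ → A))
      (φ : MarkedPoisson.PointMeasure × (ℤ → A) → MarkedPoisson.PointMeasure),
      Measurable ψ ∧ Measurable φ ∧
      -- `ψ` is translation-equivariant
      (∀ (t : ℝ) (μ : MarkedPoisson.PointMeasure),
        ψ (μ.translate t) = MarkedPoisson.translateMarked t (ψ μ)) ∧
      ∀ r : ℝ≥0, 0 < r → ∀ P : Measure MarkedPoisson.PointMeasure,
        MarkedPoisson.IsPoissonLaw r P →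
        -- laws of the two coordinates, and their independence
        MarkedPoisson.IsPoissonLaw r (P.map (fun μ => (ψ μ).1)) ∧
        P.map (fun μ => (ψ μ).2) = Measure.infinitePi (fun _ : ℤ => α) ∧
        IndepFun (fun μ => (ψ μ).1) (fun μ => (ψ μ).2) P ∧
        -- `ψ` is injective on a set of full measure
        (∃ G : Set MarkedPoisson.PointMeasure, MeasurableSet G ∧ P Gᶜ = 0 ∧ Set.InjOn ψ G) ∧
        -- `ψ` is finitary
        (∃ w : MarkedPoisson.PointMeasure → ℕ∞,
          MarkedPoisson.IsCodingWindow ψ w ∧ ∀ᵐ μ ∂P, w μ < ⊤) ∧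
        -- `φ` is the almost sure inverse of `ψ`
        (∀ᵐ μ ∂P, φ (ψ μ) = μ) ∧
        (∀ᵐ y ∂(P.prod (Measure.infinitePi (fun _ : ℤ => α))), ψ (φ y) = y) ∧
        -- `φ` is finitary
        (∃ w : MarkedPoisson.PointMeasure × (ℤ → A) → ℕ∞,
          MarkedPoisson.IsCodingWindowMarked φ w ∧
            ∀ᵐ y ∂(P.prod (Measure.infinitePi (fun _ : ℤ => α))), w y < ⊤) := by
  classical
  obtain ⟨a₀⟩ := nonempty_of_isProbabilityMeasure α
  obtain ⟨C⟩ := MarkedPoisson.nonempty_coding α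
  have hψ := MarkedPoisson.measurable_encMap C a₀
  have hφ := MarkedPoisson.measurable_decMap C
  have hinv := MarkedPoisson.decMap_encMap C a₀
  refine ⟨MarkedPoisson.encMap C a₀, MarkedPoisson.decMap C, hψ, hφ,
    MarkedPoisson.encMap_translate C a₀, fun r hr P hP => ?_⟩
  have := hP.isProbabilityMeasure
  have hlaw := hP.map_encMap a₀ C hr
  have hrich := hP.ae_rich hr
  have h1 : P.map (fun μ => (MarkedPoisson.encMap C a₀ μ).1) = P := by
    change P.map (Prod.fst ∘ MarkedPoisson.encMap C a₀) = P
    rw [← Measure.map_map measurable_fst hψ, hlaw, Measure.map_fst_prod, measure_univ, one_smul]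
  have h2 : P.map (fun μ => (MarkedPoisson.encMap C a₀ μ).2) =
      Measure.infinitePi (fun _ : ℤ => α) := by
    change P.map (Prod.snd ∘ MarkedPoisson.encMap C a₀) = _
    rw [← Measure.map_map measurable_snd hψ, hlaw, Measure.map_snd_prod, measure_univ, one_smul]
  refine ⟨by rwa [h1], h2, ?_, ?_, ?_, ?_, ?_, ?_⟩
  · rw [indepFun_iff_map_prod_eq_prod_map_map hψ.fst.aemeasurable hψ.snd.aemeasurable, h1, h2]
    exact hlaw
  -- Injectivity needs no exceptional set, as the decoder is a left inverse everywhere.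
  · refine ⟨univ, MeasurableSet.univ, by simp, ?_⟩
    exact (Function.LeftInverse.injective hinv).injOn
  · exact ⟨_, MarkedPoisson.isCodingWindow_encMap C a₀,
      hrich.mono fun μ hμ => MarkedPoisson.codingWindow_lt_top hμ⟩
  · exact Filter.Eventually.of_forall hinv
  · have hE : MeasurableSet {y : MarkedPoisson.PointMeasure × (ℤ → A) |
        MarkedPoisson.encMap C a₀ (MarkedPoisson.decMap C y) = y} := by
      simp only [Prod.ext_iff]
      exact (MarkedPoisson.measurableSet_eq_pointMeasure (hψ.comp hφ).fst measurable_fst).inter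
        (measurableSet_eq_fun (hψ.comp hφ).snd measurable_snd)
    -- The product law is the image of `P`, so the identity need only be checked at points `y` in
    -- the range of the encoder, where it follows from the left inverse.
    rw [← hlaw, ae_map_iff hψ.aemeasurable hE]
    exact Filter.Eventually.of_forall fun μ => by rw [hinv]
  · exact ⟨_, MarkedPoisson.isCodingWindowMarked_decMap C,
      (Measure.quasiMeasurePreserving_fst.ae hrich).mono fun y hy =>
        MarkedPoisson.codingWindow_lt_top hy⟩
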